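/- Let $\mathcal B$ be a generalized Boolean algebra (a distributive lattice with least element $\emptyset$ and relative complements), $\mathcal L$ a set, $\theta=(\theta_a)_{a\in\mathcal L}$ a family of endomorphisms of $\mathcal B$ (maps preserving $\emptyset,\cup,\cap,\setminus$), and $\mathcal I=(\mathcal I_a)_{a\in\mathcal L}$ a family of ideals of $\mathcal B$ such that $\theta_a(C)\supseteq A$ for some $C\in\mathcal B$ implies $A\in\mathcal I_a$. Put $\Delta_A=\{a\in\mathcal L:\theta_a(A)\neq\emptyset\}$ and $\mathcal B_{\rm reg}=\{A\in\mathcal B: 0<|\Delta_C|<\infty \text{ for all } \emptyset\neq C\subseteq A\}$. Let $R$ be a commutative unital ring, and let $L_R(\mathcal B,\mathcal L,\theta,\mathcal I)$ be the universal associative, not necessarily unital, $R$-algebra generated by $p_A$ ($A\in\mathcal B$) and $s_{a,A},s^*_{a,A}$ ($a\in\mathcal L$, $A\in\mathcal I_a$) subject to 1. $p_\emptyset=0$, $p_{A\cap A'}=p_Ap_{A'}$, $p_{A\cup A'}=p_A+p_{A'}-p_{A\cap A'}$; 2. $p_As_{a,C}=s_{a,C}p_{\theta_a(A)}$ and $s^*_{a,C}p_A=p_{\theta_a(A)}s^*_{a,C}$;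 3. $s^*_{a,C}s_{a',C'}=\delta_{a,a'}\,p_{C\cap C'}$; 4. $s_{a,C}p_{C'}=s_{a,C\cap C'}$ and $p_{C'}s^*_{a,C}=s^*_{a,C\cap C'}$; 5. $p_A=\sum_{a\in\Delta_A}s_{a,\theta_a(A)}s^*_{a,\theta_a(A)}$ for $A\in\mathcal B_{\rm reg}$. For a finite word $\alpha=\alpha_1\cdots\alpha_n$ over $\mathcal L$ let $\theta_\alpha=\theta_{\alpha_n}\circ\cdots\circ\theta_{\alpha_1}$; let $\mathcal I_\alpha=\{A: A\subseteq\theta_{\alpha_2\cdots\alpha_n}(C)\text{ for some }C\in\mathcal I_{\alpha_1}\}$ if $n\ge1$, and $\theta_\omega=\mathrm{id}$, $\mathcal I_\omega=\mathcal B$ for the empty word $\omega$. Let $S=S_{(\mathcal B,\mathcal L,\theta,\mathcal I)}$ be the inverse semigroup with zero consisting of $0$ and the triples $(\alpha,A,\beta)$ with $\alpha,\beta$ finite words and $\emptyset\neq A\in\mathcal I_\alpha\cap\mathcal I_\beta$, with $(\alpha,A,\beta)^*=(\beta,A,\alpha)$ and with product $$(\alpha,A,\beta)(\gamma,C,\delta)=\begin{cases}(\alpha\gamma',\theta_{\gamma'}(A)\cap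 C,\delta)&\gamma=\beta\gamma',\\(\alpha,A\cap\theta_{\beta'}(C),\delta\beta')&\beta=\gamma\beta',\\0&\text{otherwise,}\end{cases}$$ where a triple with middle entry $\emptyset$ is read as $0$. The map $\varphi(\alpha,A,\beta)=\alpha\beta^{-1}$ from $S\setminus\{0\}$ to the free group $\mathbb F[\mathcal L]$ on $\mathcal L$ makes $S$ strongly $E^*$-unitary, that is, $\varphi(st)=\varphi(s)\varphi(t)$ whenever $st\ne0$, and $\varphi^{-1}(e)$ consists of idempotents. Let $E$ be the semilattice of idempotents of $S$. A finite set $Z$ of elements below $x\in E$ is a cover of $x$ if every $0\neq y\le x$ satisfies $yz\neq0$ for some $z\in Z$; a tight filter is a proper filter of $E$ that meets every finite cover of each of its elements. Let $T$ be the space of tight filters, with the topology induced from $\{0,1\}^E$, and let $V_x=\{\xi\in T:x\in\xi\}$. For $g\in\mathbb F[\mathcal L]$ let $E_g=\{ss^*:s\ne0,\ \varphi(s)=g\}\cup\{0\}$, let $U_g=\bigcup_{x\in E_g}V_x$, and let $D_g$ be the $R$-module of locally constant, compactly supported functions $T\to R$ with support in $U_g$. The maps $E_{g^{-1}}\to E_g$,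 $s^*s\mapsto ss^*$ ($\varphi(s)=g$), induce homeomorphisms $\phi_g:U_{g^{-1}}\to U_g$ and isomorphisms $\alpha_g:D_{g^{-1}}\to D_g$, $f\mapsto f\circ\phi_{g^{-1}}$. The partial skew group ring $L_R(S)$ is $\bigoplus_{g}D_g\delta_g$ with $(a\delta_g)(b\delta_h)=\alpha_g(\alpha_{g^{-1}}(a)b)\delta_{gh}$. For $x\in E_g$ write $x\delta_g$ for $1_{V_x}\delta_g$. Theorem. There is an isomorphism of (not necessarily unital) $R$-algebras $L_R(\mathcal B,\mathcal L,\theta,\mathcal I)\to L_R(S_{(\mathcal B,\mathcal L,\theta,\mathcal I)})$ with $$p_A\mapsto(\omega,A,\omega)\delta_e,\qquad s_{a,A}\mapsto(a,A,a)\delta_a,\qquad s^*_{a,A}\mapsto(\omega,A,\omega)\delta_{a^{-1}}$$ for all $A\in\mathcal B$ in the first case, and all $a\in\mathcal L$ and $A\in\mathcal I_a$ in the other two. -/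

import Mathlib

/-- An inverse semigroup with zero: a regular semigroup with zero whose idempotents commute
(equivalently, every `s` has a unique inverse `s⁻¹`, i.e. a unique element with
`s * s⁻¹ * s = s` and `s⁻¹ * s * s⁻¹ = s⁻¹`). -/
class InverseSemigroupWithZero (S : Type*) extends SemigroupWithZero S, Inv S where
  mul_inv_mul : ∀ s : S, s * s⁻¹ * s = s
  inv_mul_inv : ∀ s : S, s⁻¹ * s * s⁻¹ = s⁻¹
  idem_comm : ∀ e f : S, e * e = e → f * f = f → e * f = f * e

namespace InverseSemigroupWithZero

variable {S : Type*} [InverseSemigroupWithZero S]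

theorem inv_unique {s t : S} (h1 : s * t * s = s) (h2 : t * s * t = t) : t = s⁻¹ := by
  have e1 : (s * t) * (s * t) = s * t := by rw [← mul_assoc, h1]
  have e2 : (t * s) * (t * s) = t * s := by rw [← mul_assoc, h2]
  have e3 : (s * s⁻¹) * (s * s⁻¹) = s * s⁻¹ := by rw [← mul_assoc, mul_inv_mul]
  have e4 : (s⁻¹ * s) * (s⁻¹ * s) = s⁻¹ * s := by rw [← mul_assoc, inv_mul_inv]
  calc t = t * (s * s⁻¹ * s) * t := by rw [mul_inv_mul, h2]
    _ = t * ((s * s⁻¹) * (s * t)) := by simp only [mul_assoc]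
    _ = t * ((s * t) * (s * s⁻¹)) := by rw [idem_comm _ _ e3 e1]
    _ = (t * s * t) * s * s⁻¹ := by simp only [mul_assoc]
    _ = t * s * s⁻¹ := by rw [h2]
    _ = t * s * (s⁻¹ * s * s⁻¹) := by rw [inv_mul_inv]
    _ = (t * s) * (s⁻¹ * s) * s⁻¹ := by simp only [mul_assoc]
    _ = (s⁻¹ * s) * (t * s) * s⁻¹ := by rw [idem_comm _ _ e2 e4]
    _ = s⁻¹ * (s * t * s) * s⁻¹ := by simp only [mul_assoc]
    _ = s⁻¹ := by rw [h1, inv_mul_inv]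

theorem inv_inv' (s : S) : s⁻¹⁻¹ = s := (inv_unique (inv_mul_inv s) (mul_inv_mul s)).symm

theorem mul_inv_idem (s : S) : (s * s⁻¹) * (s * s⁻¹) = s * s⁻¹ := by
  rw [← mul_assoc, mul_inv_mul]

theorem inv_mul_idem (s : S) : (s⁻¹ * s) * (s⁻¹ * s) = s⁻¹ * s := by
  rw [← mul_assoc, inv_mul_inv]

theorem inv_of_idem {e : S} (he : e * e = e) : e⁻¹ = e :=
  (inv_unique (by rw [he, he]) (by rw [he, he])).symm

theorem mul_inv_rev' (s t : S) : (s * t)⁻¹ = t⁻¹ * s⁻¹ := by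
  have h := idem_comm _ _ (inv_mul_idem s) (mul_inv_idem t)
  refine (inv_unique ?_ ?_).symm
  · calc s * t * (t⁻¹ * s⁻¹) * (s * t) = s * ((t * t⁻¹) * (s⁻¹ * s)) * t := by
          simp only [mul_assoc]
      _ = s * ((s⁻¹ * s) * (t * t⁻¹)) * t := by rw [h]
      _ = (s * s⁻¹ * s) * (t * t⁻¹ * t) := by simp only [mul_assoc]
      _ = s * t := by rw [mul_inv_mul, mul_inv_mul]
  · calc t⁻¹ * s⁻¹ * (s * t) * (t⁻¹ * s⁻¹) = t⁻¹ * ((s⁻¹ * s) * (t * t⁻¹)) * s⁻¹ := by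
          simp only [mul_assoc]
      _ = t⁻¹ * ((t * t⁻¹) * (s⁻¹ * s)) * s⁻¹ := by rw [h]
      _ = (t⁻¹ * t * t⁻¹) * (s⁻¹ * s * s⁻¹) := by simp only [mul_assoc]
      _ = t⁻¹ * s⁻¹ := by rw [inv_mul_inv, inv_mul_inv]

theorem conj_idem (s : S) {e : S} (he : e * e = e) :
    (s * e * s⁻¹) * (s * e * s⁻¹) = s * e * s⁻¹ := by
  calc (s * e * s⁻¹) * (s * e * s⁻¹) = s * (e * (s⁻¹ * s)) * e * s⁻¹ := by
        simp only [mul_assoc]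
    _ = s * ((s⁻¹ * s) * e) * e * s⁻¹ := by rw [idem_comm _ _ he (inv_mul_idem s)]
    _ = (s * s⁻¹ * s) * (e * e) * s⁻¹ := by simp only [mul_assoc]
    _ = s * e * s⁻¹ := by rw [mul_inv_mul, he]

/-- The set of idempotents of `S`. -/
@[ext]
structure Idem (S : Type*) [InverseSemigroupWithZero S] where
  val : S
  idem : val * val = val

/-- The semilattice of idempotents: `e ≤ f` iff `e * f = e`, and `e ⊓ f = e * f`. -/
instance : SemilatticeInf (Idem S) where
  le e f := e.1 * f.1 = e.1
  le_refl e := e.2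
  le_trans a b c hab hbc := by
    rw [← hab, mul_assoc, hbc]
  le_antisymm a b hab hba := Idem.ext <| by
    rw [← hab, idem_comm _ _ a.2 b.2]; exact hba
  inf e f := ⟨e.1 * f.1, by
    calc (e.1 * f.1) * (e.1 * f.1) = e.1 * (f.1 * e.1) * f.1 := by simp only [mul_assoc]
      _ = e.1 * (e.1 * f.1) * f.1 := by rw [idem_comm _ _ f.2 e.2]
      _ = (e.1 * e.1) * (f.1 * f.1) := by simp only [mul_assoc]
      _ = e.1 * f.1 := by rw [e.2, f.2]⟩
  inf_le_left e f := by
    change e.1 * f.1 * e.1 = e.1 * f.1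
    rw [mul_assoc, idem_comm _ _ f.2 e.2, ← mul_assoc, e.2]
  inf_le_right e f := by
    change e.1 * f.1 * f.1 = e.1 * f.1
    rw [mul_assoc, f.2]
  le_inf a b c hab hac := by
    change a.1 * (b.1 * c.1) = a.1
    rw [← mul_assoc, hab, hac]

instance : OrderBot (Idem S) where
  bot := ⟨0, by rw [zero_mul]⟩
  bot_le a := zero_mul a.1

theorem Idem.le_def {e f : Idem S} : e ≤ f ↔ e.1 * f.1 = e.1 := Iff.rfl

theorem Idem.inf_val (e f : Idem S) : (e ⊓ f).1 = e.1 * f.1 := rfl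

theorem Idem.bot_val : (⊥ : Idem S).1 = 0 := rfl

theorem Idem.ne_bot_iff {e : Idem S} : e ≠ ⊥ ↔ e.1 ≠ 0 :=
  not_congr ⟨fun h => by rw [h]; rfl, fun h => Idem.ext h⟩

/-- The range idempotent `s s⁻¹`. -/
def ran (s : S) : Idem S := ⟨s * s⁻¹, mul_inv_idem s⟩

/-- The source idempotent `s⁻¹ s`. -/
def src (s : S) : Idem S := ⟨s⁻¹ * s, inv_mul_idem s⟩

/-- The conjugate `s e s⁻¹` of an idempotent `e`. -/
def conj (s : S) (e : Idem S) : Idem S := ⟨s * e.1 * s⁻¹, conj_idem s e.2⟩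

end InverseSemigroupWithZero

/-- A finite set `Z` is a cover of `x` in a meet semilattice with minimum if its elements are
below `x` and every nonzero `y ≤ x` meets some element of `Z`. -/
def IsFiniteCover {E : Type*} [SemilatticeInf E] [OrderBot E] (Z : Finset E) (x : E) : Prop :=
  (∀ z ∈ Z, z ≤ x) ∧ ∀ y ≤ x, y ≠ ⊥ → ∃ z ∈ Z, z ⊓ y ≠ ⊥

/-- Tight filters of a meet semilattice `E` with minimum: proper filters `ξ` such that every
finite cover of an element of `ξ` meets `ξ`. -/
@[ext]
structure TightFilter (E : Type*) [SemilatticeInf E] [OrderBot E] where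
  carrier : Set E
  nonempty : carrier.Nonempty
  bot_notMem : ⊥ ∉ carrier
  mem_of_le : ∀ {x y : E}, x ∈ carrier → x ≤ y → y ∈ carrier
  inf_mem : ∀ {x y : E}, x ∈ carrier → y ∈ carrier → x ⊓ y ∈ carrier
  tight : ∀ x ∈ carrier, ∀ Z : Finset E, IsFiniteCover Z x → ∃ z ∈ Z, z ∈ carrier

namespace TightFilter

variable {E : Type*} [SemilatticeInf E] [OrderBot E]

open Classical in
/-- The indicator of a tight filter, as a point of `{0,1}^E`. -/
noncomputable def indicator (ξ : TightFilter E) : E → Bool := fun x => decide (x ∈ ξ.carrier)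

/-- The space of tight filters has the topology of pointwise convergence, i.e. the subspace
topology from the product space `{0,1}^E` of discrete spaces. -/
noncomputable instance : TopologicalSpace (TightFilter E) :=
  TopologicalSpace.induced indicator inferInstance

/-- The basic set `V_x` of all tight filters containing `x`. -/
def V (x : E) : Set (TightFilter E) := {ξ | x ∈ ξ.carrier}

theorem isClopen_V (x : E) : IsClopen (V x) := by
  have hc : Continuous (indicator (E := E)) := continuous_induced_dom
  have h : V x = (fun ξ : TightFilter E => indicator ξ x) ⁻¹' {true} := by
    ext ξ; simp [V, indicator]
  rw [h]
  exact (isClopen_discrete _).preimage ((continuous_apply x).comp hc)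

theorem isCompact_V (x : E) : IsCompact (V x) := by
  have hi : Topology.IsInducing (indicator (E := E)) := ⟨rfl⟩
  rw [hi.isCompact_iff]
  have hcl : ∀ (y : E) (b : Bool), IsClosed {χ : E → Bool | χ y = b} := fun y b =>
    isClosed_eq (continuous_apply y) continuous_const
  have himg : indicator '' (V x) =
      {χ : E → Bool | χ x = true} ∩ {χ | χ ⊥ = false} ∩
      (⋂ y, ⋂ z, ⋂ (_ : y ≤ z), ({χ | χ y = false} ∪ {χ | χ z = true})) ∩
      (⋂ y, ⋂ z, ({χ | χ y = false} ∪ {χ | χ z = false} ∪ {χ | χ (y ⊓ z) = true})) ∩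
      (⋂ y, ⋂ Z : Finset E, ⋂ (_ : IsFiniteCover Z y),
        ({χ | χ y = false} ∪ ⋃ z ∈ Z, {χ | χ z = true})) := by
    ext χ
    simp only [Set.mem_image, Set.mem_inter_iff, Set.mem_ofPred_eq, Set.mem_iInter, Set.mem_union,
      Set.mem_iUnion, exists_prop]
    constructor
    · rintro ⟨ξ, hξ, rfl⟩
      simp only [indicator, decide_eq_true_eq, decide_eq_false_iff_not]
      refine ⟨⟨⟨⟨hξ, ξ.bot_notMem⟩, ?_⟩, ?_⟩, ?_⟩
      · intro y z hyz
        by_cases h : y ∈ ξ.carrier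
        · exact Or.inr (ξ.mem_of_le h hyz)
        · exact Or.inl h
      · intro y z
        by_cases h : y ∈ ξ.carrier
        · by_cases h' : z ∈ ξ.carrier
          · exact Or.inr (ξ.inf_mem h h')
          · exact Or.inl (Or.inr h')
        · exact Or.inl (Or.inl h)
      · intro y Z hZ
        by_cases h : y ∈ ξ.carrier
        · exact Or.inr (ξ.tight y h Z hZ)
        · exact Or.inl h
    · rintro ⟨⟨⟨⟨h1, h2⟩, h3⟩, h4⟩, h5⟩
      refine ⟨⟨{y | χ y = true}, ⟨x, h1⟩, by simp [h2], ?_, ?_, ?_⟩, h1, ?_⟩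
      · intro y z hy hyz
        simpa [show χ y = true from hy] using h3 y z hyz
      · intro y z hy hz
        simpa [show χ y = true from hy, show χ z = true from hz] using h4 y z
      · intro y hy Z hZ
        simpa [show χ y = true from hy] using h5 y Z hZ
      · funext y
        simp [indicator]
  rw [himg]
  refine IsClosed.isCompact ?_
  refine (((((hcl _ _).inter (hcl _ _)).inter ?_).inter ?_).inter ?_)
  · exact isClosed_iInter fun y => isClosed_iInter fun z => isClosed_iInter fun _ =>
      (hcl _ _).union (hcl _ _)
  · exact isClosed_iInter fun y => isClosed_iInter fun z =>
      ((hcl _ _).union (hcl _ _)).union (hcl _ _)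
  · exact isClosed_iInter fun y => isClosed_iInter fun Z => isClosed_iInter fun _ =>
      (hcl _ _).union (Set.Finite.isClosed_biUnion Z.finite_toSet fun z _ => hcl _ _)

end TightFilter

/-- A grading `φ : S ∖ {0} → G` making `S` strongly `E*`-unitary: `φ (s t) = φ s φ t` whenever
`s t ≠ 0`, and `φ⁻¹(1)` consists of idempotents. The value of `φ` at `0` plays no role. -/
structure StrongGrading (S G : Type*) [InverseSemigroupWithZero S] [Group G] where
  toFun : S → G
  map_mul : ∀ s t : S, s * t ≠ 0 → toFun (s * t) = toFun s * toFun t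
  idem_of_eq_one : ∀ s : S, s ≠ 0 → toFun s = 1 → s * s = s

namespace StrongGrading

open InverseSemigroupWithZero

variable {S G : Type*} [InverseSemigroupWithZero S] [Group G] (φ : StrongGrading S G)

/-- `E_g = {s s⁻¹ : s ≠ 0, φ s = g} ∪ {0}`. -/
def E (g : G) : Set (Idem S) := {e | e = ⊥ ∨ ∃ s : S, s ≠ 0 ∧ φ.toFun s = g ∧ ran s = e}

/-- The open set `U_g` of tight filters that meet `E_g`. -/
def U (g : G) : Set (TightFilter (Idem S)) := {ξ | ∃ e ∈ φ.E g, e ∈ ξ.carrier}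

theorem ne_zero_of_mul_inv {s : S} (h : s * s⁻¹ ≠ 0) : s ≠ 0 := by
  rintro rfl; exact h (zero_mul _)

theorem ran_ne_bot {s : S} (h : s ≠ 0) : ran s ≠ ⊥ := by
  rw [Idem.ne_bot_iff]
  intro h'
  apply h
  rw [← mul_inv_mul s, show s * s⁻¹ = 0 from h', zero_mul]

theorem inv_ne_zero' {s : S} (h : s ≠ 0) : s⁻¹ ≠ 0 := by
  intro h'
  apply h
  rw [← mul_inv_mul s, h', mul_zero, zero_mul]

theorem ran_inv (s : S) : ran s⁻¹ = src s := Idem.ext <| by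
  change s⁻¹ * s⁻¹⁻¹ = s⁻¹ * s
  rw [inv_inv']

theorem src_inv (s : S) : src s⁻¹ = ran s := Idem.ext <| by
  change s⁻¹⁻¹ * s⁻¹ = s * s⁻¹
  rw [inv_inv']

theorem src_ne_bot {s : S} (h : s ≠ 0) : src s ≠ ⊥ := by
  rw [← ran_inv]; exact ran_ne_bot (inv_ne_zero' h)

theorem ne_zero_of_src {s : S} (h : src s ≠ ⊥) : s ≠ 0 := by
  rintro rfl
  exact h (Idem.ext (mul_zero _))

theorem ne_zero_of_src_mem {s : S} {ξ : TightFilter (Idem S)} (h : src s ∈ ξ.carrier) : s ≠ 0 :=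
  ne_zero_of_src fun h' => ξ.bot_notMem (h' ▸ h)

theorem ne_zero_of_ran_mem {s : S} {ξ : TightFilter (Idem S)} (h : ran s ∈ ξ.carrier) : s ≠ 0 := by
  rw [← src_inv] at h
  have := inv_ne_zero' (ne_zero_of_src_mem h)
  rwa [inv_inv'] at this

theorem map_idem {e : S} (he : e * e = e) (h0 : e ≠ 0) : φ.toFun e = 1 := by
  have h := φ.map_mul e e (by rwa [he])
  rw [he] at h
  exact left_eq_mul.1 h

theorem map_inv {s : S} (h : s ≠ 0) : φ.toFun s⁻¹ = (φ.toFun s)⁻¹ := by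
  have h1 : s * s⁻¹ ≠ 0 := Idem.ne_bot_iff.1 (ran_ne_bot h)
  have h2 := φ.map_mul _ _ h1
  rw [φ.map_idem (mul_inv_idem s) h1] at h2
  exact (inv_eq_of_mul_eq_one_right h2.symm).symm

theorem mem_U_iff {g : G} {ξ : TightFilter (Idem S)} :
    ξ ∈ φ.U g ↔ ∃ s : S, φ.toFun s = g ∧ ran s ∈ ξ.carrier := by
  constructor
  · rintro ⟨e, he | ⟨s, _, hs, rfl⟩, hξ⟩
    · exact absurd (he ▸ hξ) ξ.bot_notMem
    · exact ⟨s, hs, hξ⟩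
  · rintro ⟨s, hs, hξ⟩
    exact ⟨_, Or.inr ⟨s, ne_zero_of_ran_mem hξ, hs, rfl⟩, hξ⟩

theorem src_mul (s t : S) : (src (s * t)).1 = t⁻¹ * (src s).1 * t := by
  change (s * t)⁻¹ * (s * t) = t⁻¹ * (s⁻¹ * s) * t
  rw [mul_inv_rev']; simp only [mul_assoc]

theorem ran_mul (s t : S) : (ran (s * t)).1 = s * (ran t).1 * s⁻¹ := by
  change (s * t) * (s * t)⁻¹ = s * (t * t⁻¹) * s⁻¹
  rw [mul_inv_rev']; simp only [mul_assoc]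

theorem src_idem (e : Idem S) : src e.1 = e := Idem.ext <| by
  change e.1⁻¹ * e.1 = e.1
  rw [inv_of_idem e.2, e.2]

theorem ran_idem (e : Idem S) : ran e.1 = e := Idem.ext <| by
  change e.1 * e.1⁻¹ = e.1
  rw [inv_of_idem e.2, e.2]

theorem ran_mul_le (s t : S) : ran (s * t) ≤ ran s := by
  rw [Idem.le_def, ran_mul]
  change s * (t * t⁻¹) * s⁻¹ * (s * s⁻¹) = _
  calc s * (t * t⁻¹) * s⁻¹ * (s * s⁻¹) = s * (t * t⁻¹) * (s⁻¹ * s * s⁻¹) := by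
        simp only [mul_assoc]
    _ = _ := by rw [inv_mul_inv]; rfl

theorem src_mul_le (s t : S) : src (s * t) ≤ src t := by
  have h := ran_mul_le t⁻¹ s⁻¹
  rwa [← mul_inv_rev', ran_inv, ran_inv] at h

theorem conj_src_eq (s : S) (e : Idem S) : src (e.1 * s) = conj s⁻¹ e := Idem.ext <| by
  rw [src_mul, src_idem]
  change _ = s⁻¹ * e.1 * s⁻¹⁻¹
  rw [inv_inv']

/-- If `s` and `t` have equal degree and compatible sources, then `s t⁻¹` is idempotent. -/
theorem idem_mul_inv {s t : S} (h : φ.toFun s = φ.toFun t) (h0 : s * (t⁻¹ * t) ≠ 0) :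
    (s * t⁻¹) * (s * t⁻¹) = s * t⁻¹ := by
  have h1 : s * t⁻¹ ≠ 0 := by
    intro h'
    apply h0
    rw [← mul_assoc, h', zero_mul]
  have ht : t ≠ 0 := by
    rintro rfl
    exact h0 (by rw [mul_zero, mul_zero])
  refine φ.idem_of_eq_one _ h1 ?_
  rw [φ.map_mul _ _ h1, φ.map_inv ht, h, mul_inv_cancel]

theorem src_inf (s t : S) : src (s * (t⁻¹ * t)) = src s ⊓ src t := Idem.ext <| by
  rw [src_mul, inv_of_idem (inv_mul_idem t), Idem.inf_val]
  change (t⁻¹ * t) * (s⁻¹ * s) * (t⁻¹ * t) = (s⁻¹ * s) * (t⁻¹ * t)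
  rw [idem_comm _ _ (inv_mul_idem t) (inv_mul_idem s), mul_assoc, inv_mul_idem]

/-- If `φ t = g` and `t⁻¹ t ∈ ξ`, then the translate of `ξ` by `g` consists of all `y` with
`t⁻¹ y t ∈ ξ`. -/
theorem translate_aux {t : S} {ξ : TightFilter (Idem S)} (ht : src t ∈ ξ.carrier) (y : Idem S) :
    (∃ s : S, φ.toFun s = φ.toFun t ∧ src s ∈ ξ.carrier ∧ ran s ≤ y) ↔
      conj t⁻¹ y ∈ ξ.carrier := by
  constructor
  · rintro ⟨s, hs, hsξ, hsy⟩
    have hmem := ξ.inf_mem hsξ ht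
    rw [← src_inf] at hmem
    have hf := φ.idem_mul_inv hs (ne_zero_of_src_mem hmem)
    set f : Idem S := ⟨s * t⁻¹, hf⟩ with hfdef
    have hft : s * (t⁻¹ * t) = f.1 * t := by rw [← mul_assoc]
    rw [hft] at hmem
    have hfy : f ≤ y := by
      refine le_trans ?_ hsy
      rw [← ran_idem f]
      exact ran_mul_le _ _
    refine ξ.mem_of_le hmem ?_
    rw [Idem.le_def]
    rw [Idem.le_def] at hfy
    rw [conj_src_eq]
    change t⁻¹ * f.1 * t⁻¹⁻¹ * (t⁻¹ * y.1 * t⁻¹⁻¹) = t⁻¹ * f.1 * t⁻¹⁻¹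
    rw [inv_inv']
    calc t⁻¹ * f.1 * t * (t⁻¹ * y.1 * t) = t⁻¹ * (f.1 * (t * t⁻¹)) * y.1 * t := by
          simp only [mul_assoc]
      _ = t⁻¹ * ((t * t⁻¹) * f.1) * y.1 * t := by rw [idem_comm _ _ f.2 (mul_inv_idem t)]
      _ = (t⁻¹ * t * t⁻¹) * (f.1 * y.1) * t := by simp only [mul_assoc]
      _ = t⁻¹ * f.1 * t := by rw [inv_mul_inv, hfy]
  · intro h
    rw [← conj_src_eq] at h
    have h0 := ne_zero_of_src_mem h
    refine ⟨y.1 * t, ?_, h, ?_⟩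
    · rw [φ.map_mul _ _ h0, φ.map_idem y.2, one_mul]
      intro hy
      exact h0 (by rw [hy, zero_mul])
    · have := ran_mul_le y.1 t
      rwa [ran_idem] at this

theorem conj_inf (s : S) (x y : Idem S) : conj s (x ⊓ y) = conj s x ⊓ conj s y :=
  Idem.ext <| by
    rw [Idem.inf_val]
    change s * (x.1 * y.1) * s⁻¹ = s * x.1 * s⁻¹ * (s * y.1 * s⁻¹)
    calc s * (x.1 * y.1) * s⁻¹ = (s * s⁻¹ * s) * (x.1 * y.1) * s⁻¹ := by rw [mul_inv_mul]
      _ = s * ((s⁻¹ * s) * x.1) * y.1 * s⁻¹ := by simp only [mul_assoc]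
      _ = s * (x.1 * (s⁻¹ * s)) * y.1 * s⁻¹ := by rw [idem_comm _ _ (inv_mul_idem s) x.2]
      _ = _ := by simp only [mul_assoc]

theorem conj_mono (s : S) {x y : Idem S} (h : x ≤ y) : conj s x ≤ conj s y := by
  rw [← inf_eq_left] at h ⊢
  rw [← conj_inf, h]

theorem conj_bot (s : S) : conj s (⊥ : Idem S) = ⊥ := Idem.ext <| by
  change s * 0 * s⁻¹ = 0
  rw [mul_zero, zero_mul]

theorem conj_inv_conj (s : S) (x : Idem S) : conj s⁻¹ (conj s x) = src s ⊓ x :=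
  Idem.ext <| by
    rw [Idem.inf_val]
    change s⁻¹ * (s * x.1 * s⁻¹) * s⁻¹⁻¹ = s⁻¹ * s * x.1
    rw [inv_inv']
    calc s⁻¹ * (s * x.1 * s⁻¹) * s = (s⁻¹ * s) * (x.1 * (s⁻¹ * s)) := by simp only [mul_assoc]
      _ = (s⁻¹ * s) * ((s⁻¹ * s) * x.1) := by rw [idem_comm _ _ x.2 (inv_mul_idem s)]
      _ = _ := by rw [← mul_assoc, inv_mul_idem]

theorem conj_conj_inv (s : S) (x : Idem S) : conj s (conj s⁻¹ x) = ran s ⊓ x := by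
  have h := conj_inv_conj s⁻¹ x
  rwa [inv_inv', src_inv] at h

theorem conj_le_ran (s : S) (x : Idem S) : conj s x ≤ ran s := by
  have h := ran_mul_le s x.1
  have h2 : ran (s * x.1) = conj s x := Idem.ext <| by rw [ran_mul, ran_idem]; rfl
  rwa [h2] at h

/-- The partial homeomorphism `φ_g : U_{g⁻¹} → U_g`: it sends `ξ` to the filter generated by the
elements `s s⁻¹` with `φ s = g` and `s⁻¹ s ∈ ξ`, extending the maps
`E_{g⁻¹} → E_g`, `s⁻¹ s ↦ s s⁻¹`. -/
noncomputable def translate (g : G) (ξ : TightFilter (Idem S)) (hξ : ξ ∈ φ.U g⁻¹) :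
    TightFilter (Idem S) :=
  have ht : ∃ t : S, φ.toFun t = g ∧ src t ∈ ξ.carrier := by
    obtain ⟨s, hs, hsξ⟩ := φ.mem_U_iff.1 hξ
    refine ⟨s⁻¹, ?_, by rwa [src_inv]⟩
    rw [φ.map_inv (ne_zero_of_ran_mem hsξ), hs, inv_inv]
  have key : ∃ t : S, src t ∈ ξ.carrier ∧ ∀ y : Idem S,
      ((∃ s : S, φ.toFun s = g ∧ src s ∈ ξ.carrier ∧ ran s ≤ y) ↔ conj t⁻¹ y ∈ ξ.carrier) := by
    obtain ⟨t, rfl, ht⟩ := ht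
    exact ⟨t, ht, fun y => φ.translate_aux ht y⟩
  { carrier := {y | ∃ s : S, φ.toFun s = g ∧ src s ∈ ξ.carrier ∧ ran s ≤ y}
    nonempty := by
      obtain ⟨t, h1, h2⟩ := ht
      exact ⟨ran t, t, h1, h2, le_rfl⟩
    bot_notMem := by
      rintro ⟨s, -, hs, hs0⟩
      exact ran_ne_bot (ne_zero_of_src_mem hs) (le_bot_iff.1 hs0)
    mem_of_le := by
      rintro x y ⟨s, h1, h2, h3⟩ hxy
      exact ⟨s, h1, h2, h3.trans hxy⟩
    inf_mem := by
      obtain ⟨t, -, key⟩ := key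
      intro x y hx hy
      have hx' := (key x).1 hx
      have hy' := (key y).1 hy
      refine (key (x ⊓ y)).2 ?_
      rw [conj_inf]
      exact ξ.inf_mem hx' hy'
    tight := by
      classical
      obtain ⟨t, ht, key⟩ := key
      intro x hx Z hZ
      have hx' := (key x).1 hx
      obtain ⟨w, hw, hwξ⟩ := ξ.tight _ hx' (Z.image (conj t⁻¹)) (by
        constructor
        · intro w hw
          obtain ⟨z, hz, rfl⟩ := Finset.mem_image.1 hw
          exact conj_mono _ (hZ.1 z hz)
        · intro y hy hy0
          have hyt : y ≤ src t := hy.trans (by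
            have := conj_le_ran t⁻¹ x
            rwa [ran_inv] at this)
          have hback : conj t⁻¹ (conj t y) = y := by
            rw [conj_inv_conj, inf_eq_right.2 hyt]
          obtain ⟨z, hz, hz0⟩ := hZ.2 (conj t y)
            ((conj_mono t hy).trans (by rw [conj_conj_inv]; exact inf_le_right))
            (fun h => hy0 (by rw [← hback, h, conj_bot]))
          refine ⟨_, Finset.mem_image_of_mem _ hz, fun h => hz0 ?_⟩
          have h2 : conj t (conj t⁻¹ z ⊓ y) = z ⊓ conj t y := by
            rw [conj_inf, conj_conj_inv, inf_comm (ran t) z, inf_assoc,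
              inf_eq_right.2 (conj_le_ran t y)]
          rw [← h2, h, conj_bot])
      obtain ⟨z, hz, rfl⟩ := Finset.mem_image.1 hw
      exact ⟨z, hz, (key z).2 hwξ⟩ }

theorem mem_translate {g : G} {ξ : TightFilter (Idem S)} {hξ : ξ ∈ φ.U g⁻¹} {y : Idem S} :
    y ∈ (φ.translate g ξ hξ).carrier ↔
      ∃ s : S, φ.toFun s = g ∧ src s ∈ ξ.carrier ∧ ran s ≤ y := Iff.rfl

theorem translate_mem (g : G) (ξ : TightFilter (Idem S)) (hξ : ξ ∈ φ.U g⁻¹) :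
    φ.translate g ξ hξ ∈ φ.U g := by
  obtain ⟨s, hs, hsξ⟩ := φ.mem_U_iff.1 hξ
  refine φ.mem_U_iff.2 ⟨s⁻¹, ?_, φ.mem_translate.2 ⟨s⁻¹, ?_, by rwa [src_inv], le_rfl⟩⟩ <;>
  rw [φ.map_inv (ne_zero_of_ran_mem hsξ), hs, inv_inv]

theorem translate_translate (g : G) (ξ : TightFilter (Idem S)) (hξ : ξ ∈ φ.U g⁻¹)
    (h' : φ.translate g ξ hξ ∈ φ.U g⁻¹⁻¹) :
    φ.translate g⁻¹ (φ.translate g ξ hξ) h' = ξ := by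
  obtain ⟨s, hs, hsξ⟩ := φ.mem_U_iff.1 hξ
  have hs0 := ne_zero_of_ran_mem hsξ
  have ht : φ.toFun s⁻¹ = g := by rw [φ.map_inv hs0, hs, inv_inv]
  have h1 : src s ∈ (φ.translate g ξ hξ).carrier :=
    φ.mem_translate.2 ⟨s⁻¹, ht, by rwa [src_inv], by rw [ran_inv]⟩
  ext y
  rw [mem_translate, ← hs, φ.translate_aux h1, mem_translate, ← ht,
    φ.translate_aux (by rwa [src_inv]), inv_inv', conj_conj_inv]
  exact ⟨fun h => ξ.mem_of_le h inf_le_right, fun h => ξ.inf_mem hsξ h⟩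

theorem isOpen_U (g : G) : IsOpen (φ.U g) := by
  have h : φ.U g = ⋃ e ∈ φ.E g, TightFilter.V e := by
    ext ξ; simp [U, TightFilter.V]
  rw [h]
  exact isOpen_biUnion fun e _ => (TightFilter.isClopen_V e).isOpen

theorem continuous_translate (g : G) :
    Continuous fun ξ : φ.U g⁻¹ => φ.translate g ξ.1 ξ.2 := by
  refine continuous_induced_rng.2 (continuous_pi fun y => ?_)
  rw [continuous_iff_continuousAt]
  rintro ⟨ξ, hξ⟩
  obtain ⟨s, hs, hsξ⟩ := φ.mem_U_iff.1 hξ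
  obtain ⟨t, rfl⟩ : ∃ t, s = t⁻¹ := ⟨s⁻¹, (inv_inv' s).symm⟩
  have ht0 : t ≠ 0 := by
    have := inv_ne_zero' (ne_zero_of_ran_mem hsξ)
    rwa [inv_inv'] at this
  rw [φ.map_inv ht0, inv_inj] at hs
  subst hs
  rw [ran_inv] at hsξ
  have hopen : IsOpen {η : φ.U (φ.toFun t)⁻¹ | src t ∈ η.1.carrier} :=
    (TightFilter.isClopen_V (src t)).isOpen.preimage continuous_subtype_val
  have hc : Continuous fun η : φ.U (φ.toFun t)⁻¹ => TightFilter.indicator η.1 (conj t⁻¹ y) :=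
    (continuous_apply (conj t⁻¹ y)).comp
      ((continuous_induced_dom (f := TightFilter.indicator)).comp continuous_subtype_val)
  refine hc.continuousAt.congr ?_
  filter_upwards [hopen.mem_nhds hsξ] with η hη
  have := φ.translate_aux hη y
  simp only [TightFilter.indicator, Function.comp_apply, decide_eq_decide]
  rw [← this]
  rfl

theorem isClosed_support' {X R : Type*} [TopologicalSpace X] [Zero R] {f : X → R}
    (hf : IsLocallyConstant f) : IsClosed (Function.support f) :=
  (hf.isOpen_fiber 0).isClosed_compl

variable (R : Type*) [CommRing R]

/-- The coefficient ideal `D_g` of all locally constant, compactly supported functions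
`f : T(E) → R` on the space of tight filters whose support is contained in `U_g`. -/
def D (g : G) : Submodule R (TightFilter (Idem S) → R) where
  carrier := {f | IsLocallyConstant f ∧ IsCompact (Function.support f) ∧
    Function.support f ⊆ φ.U g}
  add_mem' := by
    rintro a b ⟨ha1, ha2, ha3⟩ ⟨hb1, hb2, hb3⟩
    have hab : IsLocallyConstant (a + b) := ha1.add hb1
    exact ⟨hab, (ha2.union hb2).of_isClosed_subset (isClosed_support' hab)
      (Function.support_add a b),
      (Function.support_add a b).trans (Set.union_subset ha3 hb3)⟩
  zero_mem' := ⟨IsLocallyConstant.const 0, by simp, by simp⟩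
  smul_mem' := by
    rintro r a ⟨ha1, ha2, ha3⟩
    have hab : IsLocallyConstant (r • a) := ha1.comp (r • ·)
    have hs : Function.support (r • a) ⊆ Function.support a :=
      Function.support_const_smul_subset r a
    exact ⟨hab, ha2.of_isClosed_subset (isClosed_support' hab) hs, hs.trans ha3⟩

variable {R}

theorem mem_U_inv_inv {g : G} {ξ : TightFilter (Idem S)} (h : ξ ∈ φ.U g) : ξ ∈ φ.U g⁻¹⁻¹ := by
  rwa [inv_inv]

open Classical in
/-- The map `α_g : D_{g⁻¹} → D_g`, `α_g(f) = f ∘ φ_{g⁻¹}` on `U_g`, extended by zero. -/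
noncomputable def alpha (g : G) (f : TightFilter (Idem S) → R) : TightFilter (Idem S) → R :=
  fun ξ => if h : ξ ∈ φ.U g then f (φ.translate g⁻¹ ξ (φ.mem_U_inv_inv h)) else 0

theorem alpha_add (g : G) (a b : TightFilter (Idem S) → R) :
    φ.alpha g (a + b) = φ.alpha g a + φ.alpha g b := by
  funext ξ
  by_cases h : ξ ∈ φ.U g <;> simp [alpha, h]

theorem alpha_smul (g : G) (r : R) (a : TightFilter (Idem S) → R) :
    φ.alpha g (r • a) = r • φ.alpha g a := by
  funext ξ
  by_cases h : ξ ∈ φ.U g <;> simp [alpha, h]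

theorem support_alpha_subset (g : G) (f : TightFilter (Idem S) → R) :
    Function.support (φ.alpha g f) ⊆ φ.U g := by
  intro ξ hξ
  by_contra h
  exact hξ (by simp [alpha, h])

theorem translate_congr {g g' : G} (h : g = g') {ξ ξ' : TightFilter (Idem S)} (h2 : ξ = ξ')
    (h3 : ξ ∈ φ.U g⁻¹) (h4 : ξ' ∈ φ.U g'⁻¹) : φ.translate g ξ h3 = φ.translate g' ξ' h4 := by
  subst h; subst h2; rfl

theorem isCompact_support_alpha (g : G) {f : TightFilter (Idem S) → R} (hf : f ∈ φ.D R g⁻¹) :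
    IsCompact (Function.support (φ.alpha g f)) := by
  obtain ⟨-, hf2, hf3⟩ := hf
  have h1 : IsCompact ((Subtype.val : φ.U g⁻¹ → _) ⁻¹' Function.support f) := by
    refine (Topology.IsInducing.subtypeVal.isCompact_preimage_iff ?_).2 hf2
    rwa [Subtype.range_coe]
  have h2 := h1.image (φ.continuous_translate g)
  convert h2 using 1
  ext ξ
  constructor
  · intro hξ
    have hU := φ.support_alpha_subset g f hξ
    have hξ' : f (φ.translate g⁻¹ ξ (φ.mem_U_inv_inv hU)) ≠ 0 := by
      simpa [alpha, hU] using hξ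
    refine ⟨⟨φ.translate g⁻¹ ξ (φ.mem_U_inv_inv hU), φ.translate_mem _ _ _⟩, hξ', ?_⟩
    have h3 := φ.translate_translate g⁻¹ ξ (φ.mem_U_inv_inv hU)
      (φ.mem_U_inv_inv (φ.translate_mem _ _ _))
    refine Eq.trans ?_ h3
    exact φ.translate_congr (inv_inv g).symm rfl _ _
  · rintro ⟨⟨η, hη⟩, hη', rfl⟩
    have hU := φ.translate_mem g η hη
    change φ.alpha g f (φ.translate g η hη) ≠ 0
    simp only [alpha, hU, dif_pos]
    rw [φ.translate_translate]
    exact hη'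

theorem _root_.TightFilter.t2Space {E : Type*} [SemilatticeInf E] [OrderBot E] :
    T2Space (TightFilter E) := by
  refine T2Space.of_injective_continuous (f := TightFilter.indicator) ?_ continuous_induced_dom
  intro ξ η h
  ext x
  simpa [TightFilter.indicator] using congrFun h x

theorem isLocallyConstant_alpha (g : G) {f : TightFilter (Idem S) → R} (hf : f ∈ φ.D R g⁻¹) :
    IsLocallyConstant (φ.alpha g f) := by
  have := TightFilter.t2Space (E := Idem S)
  rw [IsLocallyConstant.iff_eventually_eq]
  intro ξ
  by_cases h : ξ ∈ φ.U g
  · have h1 : IsLocallyConstant fun η : φ.U g⁻¹⁻¹ => f (φ.translate g⁻¹ η.1 η.2) :=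
      hf.1.comp_continuous (φ.continuous_translate g⁻¹)
    have h2 := (IsLocallyConstant.iff_eventually_eq _).1 h1 ⟨ξ, φ.mem_U_inv_inv h⟩
    rw [nhds_subtype_eq_comap, Filter.eventually_comap] at h2
    filter_upwards [h2, (φ.isOpen_U g).mem_nhds h] with η hη hU
    have := hη ⟨η, φ.mem_U_inv_inv hU⟩ rfl
    simpa [alpha, h, hU] using this
  · have hz : φ.alpha g f ξ = 0 := by simp [alpha, h]
    have hcl := (φ.isCompact_support_alpha g hf).isClosed
    filter_upwards [hcl.isOpen_compl.mem_nhds (show ξ ∈ (Function.support (φ.alpha g f))ᶜ from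
      fun h' => h' hz)] with η hη
    rw [hz]
    exact Function.notMem_support.1 hη

theorem alpha_mem (g : G) {f : TightFilter (Idem S) → R} (hf : f ∈ φ.D R g⁻¹) :
    φ.alpha g f ∈ φ.D R g :=
  ⟨φ.isLocallyConstant_alpha g hf, φ.isCompact_support_alpha g hf, φ.support_alpha_subset g f⟩

theorem mulCoeff_mem {g h : G} {a b : TightFilter (Idem S) → R} (ha : a ∈ φ.D R g)
    (hb : b ∈ φ.D R h) : φ.alpha g (φ.alpha g⁻¹ a * b) ∈ φ.D R (g * h) := by
  have ha' : φ.alpha g⁻¹ a ∈ φ.D R g⁻¹ := φ.alpha_mem g⁻¹ (by rwa [inv_inv])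
  have hc : φ.alpha g⁻¹ a * b ∈ φ.D R g⁻¹ := by
    have hl : IsLocallyConstant (φ.alpha g⁻¹ a * b) := ha'.1.mul hb.1
    have hs : Function.support (φ.alpha g⁻¹ a * b) ⊆ Function.support (φ.alpha g⁻¹ a) := by
      intro ξ hξ h0
      exact hξ (by simp [h0])
    exact ⟨hl, ha'.2.1.of_isClosed_subset (isClosed_support' hl) hs, hs.trans ha'.2.2⟩
  have hm := φ.alpha_mem g hc
  refine ⟨hm.1, hm.2.1, ?_⟩
  intro ξ hξ
  have hU := hm.2.2 hξ
  have hξ' : (φ.alpha g⁻¹ a * b) (φ.translate g⁻¹ ξ (φ.mem_U_inv_inv hU)) ≠ 0 := by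
    simpa only [alpha, hU, dif_pos, Function.mem_support] using hξ
  have hbU := hb.2.2 (show φ.translate g⁻¹ ξ (φ.mem_U_inv_inv hU) ∈ Function.support b from
    fun h0 => hξ' (by rw [Pi.mul_apply, h0, mul_zero]))
  obtain ⟨t, ht, htξ⟩ := φ.mem_U_iff.1 hbU
  obtain ⟨s, hs, hsξ, hst⟩ := φ.mem_translate.1 htξ
  have hr : ran (s⁻¹ * t) = src s := by
    refine Idem.ext ?_
    rw [ran_mul, inv_inv']
    change s⁻¹ * (ran t).1 * s = s⁻¹ * s
    rw [Idem.le_def] at hst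
    have hst' : s * s⁻¹ * (ran t).1 = s * s⁻¹ := hst
    calc s⁻¹ * (ran t).1 * s = s⁻¹ * (s * s⁻¹ * (ran t).1) * s := by
          conv_lhs => rw [← inv_mul_inv s]
          simp only [mul_assoc]
      _ = s⁻¹ * s * s⁻¹ * s := by rw [hst']; simp only [mul_assoc]
      _ = s⁻¹ * s := by rw [inv_mul_inv]
  have hmem : ran (s⁻¹ * t) ∈ ξ.carrier := by rwa [hr]
  refine φ.mem_U_iff.2 ⟨s⁻¹ * t, ?_, hmem⟩
  rw [φ.map_mul _ _ (ne_zero_of_ran_mem hmem), φ.map_inv (ne_zero_of_src_mem hsξ), hs, ht, inv_inv]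

variable (R)

/-- The product `(a δ_g) (b δ_h) = α_g (α_{g⁻¹}(a) b) δ_{g h}` on coefficients. -/
noncomputable def mulCoeff (g h : G) : φ.D R g →ₗ[R] φ.D R h →ₗ[R] φ.D R (g * h) :=
  LinearMap.mk₂ R (fun a b => ⟨φ.alpha g (φ.alpha g⁻¹ a.1 * b.1), φ.mulCoeff_mem a.2 b.2⟩)
    (fun a a' b => Subtype.ext <| by simp [alpha_add, add_mul])
    (fun r a b => Subtype.ext <| by simp [alpha_smul])
    (fun a b b' => Subtype.ext <| by simp [alpha_add, mul_add])
    (fun r a b => Subtype.ext <| by simp [alpha_smul])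

/-- The partial skew group ring `L_R(S)` of the partial action of `G` on the space of tight
filters: finite formal sums `∑ a_g δ_g` with `a_g ∈ D_g`. -/
def SkewRing : Type _ := DirectSum G fun g => φ.D R g

noncomputable instance : AddCommGroup (φ.SkewRing R) :=
  inferInstanceAs (AddCommGroup (DirectSum G fun g => φ.D R g))

noncomputable instance : Module R (φ.SkewRing R) :=
  inferInstanceAs (Module R (DirectSum G fun g => φ.D R g))

open Classical in
/-- The element `a δ_g` for `a ∈ D_g`. -/
noncomputable def delta (g : G) : φ.D R g →ₗ[R] φ.SkewRing R :=
  DirectSum.lof R G (fun g => φ.D R g) g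

open Classical in
/-- The linear map on `SkewRing` with given values on the summands `D_g δ_g`. -/
noncomputable def skewLift {M : Type*} [AddCommMonoid M] [Module R M]
    (f : ∀ g, φ.D R g →ₗ[R] M) : φ.SkewRing R →ₗ[R] M :=
  DirectSum.toModule R G M f

open Classical in
theorem skewLift_delta {M : Type*} [AddCommMonoid M] [Module R M]
    (f : ∀ g, φ.D R g →ₗ[R] M) (g : G) (a : φ.D R g) :
    φ.skewLift R f (φ.delta R g a) = f g a :=
  (DirectSum.toModule_lof (M := fun g => φ.D R g) (φ := f) R g a :)

/-- The bilinear multiplication of the partial skew group ring. -/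
noncomputable def skewMul : φ.SkewRing R →ₗ[R] φ.SkewRing R →ₗ[R] φ.SkewRing R :=
  φ.skewLift R fun g => LinearMap.flip <| φ.skewLift R fun h =>
    LinearMap.flip <| (φ.mulCoeff R g h).compr₂ (φ.delta R (g * h))

noncomputable instance : NonUnitalNonAssocRing (φ.SkewRing R) where
  mul x y := φ.skewMul R x y
  left_distrib x y z := map_add (φ.skewMul R x) y z
  right_distrib x y z := LinearMap.map_add₂ (φ.skewMul R) x y z
  zero_mul x := LinearMap.map_zero₂ (φ.skewMul R) x
  mul_zero x := map_zero (φ.skewMul R x)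

instance : IsScalarTower R (φ.SkewRing R) (φ.SkewRing R) where
  smul_assoc r x y := LinearMap.map_smul₂ (φ.skewMul R) r x y

instance : SMulCommClass R (φ.SkewRing R) (φ.SkewRing R) where
  smul_comm r x y := (map_smul (φ.skewMul R x) r y).symm

theorem delta_mul_delta (g h : G) (a : φ.D R g) (b : φ.D R h) :
    φ.delta R g a * φ.delta R h b = φ.delta R (g * h) (φ.mulCoeff R g h a b) := by
  change φ.skewMul R (φ.delta R g a) (φ.delta R h b) = _
  simp [skewMul, skewLift_delta]

theorem isLocallyConstant_indicator {X : Type*} [TopologicalSpace X] {A : Set X} (hA : IsClopen A) :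
    IsLocallyConstant (Set.indicator A (fun _ => (1 : R))) := by
  rw [IsLocallyConstant.iff_eventually_eq]
  intro x
  by_cases h : x ∈ A
  · filter_upwards [hA.isOpen.mem_nhds h] with y hy
    simp [h, hy]
  · filter_upwards [hA.isClosed.isOpen_compl.mem_nhds h] with y hy
    simp [h, show y ∉ A from hy]

theorem indicator_mem {g : G} {x : Idem S} (hx : x ∈ φ.E g) :
    Set.indicator (TightFilter.V x) (fun _ => (1 : R)) ∈ φ.D R g := by
  have hl : IsLocallyConstant (Set.indicator (TightFilter.V x) (fun _ => (1 : R))) :=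
    isLocallyConstant_indicator R (TightFilter.isClopen_V x)
  have hs : Function.support (Set.indicator (TightFilter.V x) (fun _ => (1 : R))) ⊆
      TightFilter.V x := Set.support_indicator_subset
  exact ⟨hl, (TightFilter.isCompact_V x).of_isClosed_subset (isClosed_support' hl) hs,
    hs.trans fun ξ hξ => ⟨x, hx, hξ⟩⟩

/-- The element `x δ_g` for `x ∈ E_g`, where `x` stands for the characteristic function of `V_x`. -/
noncomputable def idemDelta (g : G) (x : Idem S) (hx : x ∈ φ.E g) : φ.SkewRing R :=
  φ.delta R g ⟨_, φ.indicator_mem R hx⟩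

end StrongGrading

/-- A generalized Boolean dynamical system `(𝓑, 𝓛, θ, 𝓘)`: for each letter `a` an endomorphism
`θ_a` of the generalized Boolean algebra `𝓑` and an ideal `𝓘_a` of `𝓑` that contains
`𝓕_a = {A : A ≤ θ_a C for some C}`. -/
structure GenBoolDynSystem (B L : Type*) [GeneralizedBooleanAlgebra B] where
  θ : L → B → B
  map_bot : ∀ a, θ a ⊥ = ⊥
  map_sup : ∀ a A C, θ a (A ⊔ C) = θ a A ⊔ θ a C
  map_inf : ∀ a A C, θ a (A ⊓ C) = θ a A ⊓ θ a C
  map_sdiff : ∀ a A C, θ a (A \ C) = θ a A \ θ a C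
  I : L → Order.Ideal B
  mem_I_of_le : ∀ a A C, A ≤ θ a C → A ∈ I a

namespace GenBoolDynSystem

variable {B L : Type*} [GeneralizedBooleanAlgebra B] (𝒟 : GenBoolDynSystem B L)

/-- `Δ_A`, the set of letters `a` with `θ_a(A) ≠ ∅`. -/
def Δ (A : B) : Set L := {a | 𝒟.θ a A ≠ ⊥}

/-- The set `𝓑_reg` of regular elements: `0 < |Δ_C| < ∞` for all `∅ ≠ C ≤ A`. -/
def Reg : Set B := {A | ∀ C ≤ A, C ≠ ⊥ → (𝒟.Δ C).Nonempty ∧ (𝒟.Δ C).Finite}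

theorem Δ_finite_of_reg {A : B} (hA : A ∈ 𝒟.Reg) : (𝒟.Δ A).Finite := by
  by_cases h : A = ⊥
  · subst h
    have : 𝒟.Δ ⊥ = ∅ := by
      ext a; simp [Δ, 𝒟.map_bot]
    rw [this]; exact Set.finite_empty
  · exact (hA A le_rfl h).2

theorem θ_mem_I (a : L) (A : B) : 𝒟.θ a A ∈ 𝒟.I a := 𝒟.mem_I_of_le a _ A le_rfl

theorem inf_mem_I {a : L} {A : B} (hA : A ∈ 𝒟.I a) (C : B) : A ⊓ C ∈ 𝒟.I a :=
  (𝒟.I a).lower inf_le_left hA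

/-! The algebra of the system. -/

/-- The generators `p_A` for `A ∈ 𝓑`, and `s_{a,A}`, `s*_{a,A}` for `A ∈ 𝓘_a`. -/
inductive Gen
  | p (A : B)
  | s (a : L) (A : B) (hA : A ∈ 𝒟.I a)
  | sStar (a : L) (A : B) (hA : A ∈ 𝒟.I a)

variable (R : Type*) [CommRing R]

/-- The free (associative, not necessarily unital) `R`-algebra on the generators. -/
abbrev FreeAlg : Type _ := MonoidAlgebra R (FreeSemigroup 𝒟.Gen)

variable {𝒟} in
/-- A generator, as an element of the free algebra. -/
noncomputable def ι (x : 𝒟.Gen) : 𝒟.FreeAlg R := MonoidAlgebra.single (FreeSemigroup.of x) 1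

open Gen in
/-- The defining relations. -/
inductive Rel : 𝒟.FreeAlg R → 𝒟.FreeAlg R → Prop
  | p_bot : Rel (ι R (p ⊥)) 0
  | p_inf (A A' : B) : Rel (ι R (p (A ⊓ A'))) (ι R (p A) * ι R (p A'))
  | p_sup (A A' : B) :
      Rel (ι R (p (A ⊔ A'))) (ι R (p A) + ι R (p A') - ι R (p (A ⊓ A')))
  | p_s (A : B) (a : L) (C : B) (hC : C ∈ 𝒟.I a) :
      Rel (ι R (p A) * ι R (s a C hC)) (ι R (s a C hC) * ι R (p (𝒟.θ a A)))
  | sStar_p (A : B) (a : L) (C : B) (hC : C ∈ 𝒟.I a) :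
      Rel (ι R (sStar a C hC) * ι R (p A)) (ι R (p (𝒟.θ a A)) * ι R (sStar a C hC))
  | sStar_s_same (a : L) (C C' : B) (hC : C ∈ 𝒟.I a) (hC' : C' ∈ 𝒟.I a) :
      Rel (ι R (sStar a C hC) * ι R (s a C' hC')) (ι R (p (C ⊓ C')))
  | sStar_s_ne (a a' : L) (haa' : a ≠ a') (C C' : B) (hC : C ∈ 𝒟.I a) (hC' : C' ∈ 𝒟.I a') :
      Rel (ι R (sStar a C hC) * ι R (s a' C' hC')) 0
  | s_p (a : L) (C : B) (hC : C ∈ 𝒟.I a) (C' : B) :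
      Rel (ι R (s a C hC) * ι R (p C')) (ι R (s a (C ⊓ C') (𝒟.inf_mem_I hC C')))
  | p_sStar (a : L) (C : B) (hC : C ∈ 𝒟.I a) (C' : B) :
      Rel (ι R (p C') * ι R (sStar a C hC)) (ι R (sStar a (C ⊓ C') (𝒟.inf_mem_I hC C')))
  | p_reg (A : B) (hA : A ∈ 𝒟.Reg) :
      Rel (ι R (p A)) (∑ a ∈ (𝒟.Δ_finite_of_reg hA).toFinset,
        ι R (s a (𝒟.θ a A) (𝒟.θ_mem_I a A)) * ι R (sStar a (𝒟.θ a A) (𝒟.θ_mem_I a A)))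

/-- The smallest `R`-algebra congruence that contains the defining relations. (The relations are
taken with all scalar multiples, so that the congruence respects the scalar multiplication.) -/
noncomputable def con : RingCon (𝒟.FreeAlg R) :=
  ringConGen fun x y => ∃ (r : R) (x' y' : 𝒟.FreeAlg R),
    𝒟.Rel R x' y' ∧ x = r • x' ∧ y = r • y'

theorem con_smul (r : R) {x y : 𝒟.FreeAlg R} (h : 𝒟.con R x y) : 𝒟.con R (r • x) (r • y) := by
  change RingConGen.Rel _ x y at h
  change RingConGen.Rel _ (r • x) (r • y)
  induction h with
  | of x y h =>
    obtain ⟨r', x', y', h, rfl, rfl⟩ := h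
    exact .of _ _ ⟨r * r', x', y', h, smul_smul _ _ _, smul_smul _ _ _⟩
  | refl x => exact .refl _
  | symm _ ih => exact .symm ih
  | trans _ _ ih1 ih2 => exact .trans ih1 ih2
  | add _ _ ih1 ih2 => rw [smul_add, smul_add]; exact .add ih1 ih2
  | mul _ h2 ih1 _ => rw [← smul_mul_assoc, ← smul_mul_assoc]; exact .mul ih1 h2

/-- The `R`-algebra `L_R(𝓑, 𝓛, θ, 𝓘)`: the universal (associative, not necessarily unital)
`R`-algebra on the generators subject to the defining relations. -/
def LeavittAlgebra : Type _ := (𝒟.con R).Quotient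

noncomputable instance : NonUnitalRing (𝒟.LeavittAlgebra R) :=
  inferInstanceAs (NonUnitalRing (𝒟.con R).Quotient)

/-- The quotient map from the free algebra. -/
noncomputable def LeavittAlgebra.mk (x : 𝒟.FreeAlg R) : 𝒟.LeavittAlgebra R := (x : (𝒟.con R).Quotient)

noncomputable instance : SMul R (𝒟.LeavittAlgebra R) where
  smul r := Quotient.map (r • ·) fun _ _ h => 𝒟.con_smul R r h

noncomputable instance : Module R (𝒟.LeavittAlgebra R) :=
  Function.Surjective.module R
    (⟨⟨LeavittAlgebra.mk 𝒟 R, rfl⟩, fun _ _ => rfl⟩ : 𝒟.FreeAlg R →+ 𝒟.LeavittAlgebra R)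
    Quotient.mk_surjective fun _ _ => rfl

instance : IsScalarTower R (𝒟.LeavittAlgebra R) (𝒟.LeavittAlgebra R) where
  smul_assoc r x y := by
    induction x using Quotient.inductionOn with | _ x =>
    induction y using Quotient.inductionOn with | _ y =>
    exact congrArg (LeavittAlgebra.mk 𝒟 R) (smul_mul_assoc r x y)

instance : SMulCommClass R (𝒟.LeavittAlgebra R) (𝒟.LeavittAlgebra R) where
  smul_comm r x y := by
    induction x using Quotient.inductionOn with | _ x =>
    induction y using Quotient.inductionOn with | _ y =>
    exact congrArg (LeavittAlgebra.mk 𝒟 R) (mul_smul_comm r x y).symm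

/-- The element `p_A`. -/
noncomputable def p (A : B) : 𝒟.LeavittAlgebra R := LeavittAlgebra.mk 𝒟 R (ι R (.p A))

/-- The element `s_{a,A}`. -/
noncomputable def s (a : L) (A : B) (hA : A ∈ 𝒟.I a) : 𝒟.LeavittAlgebra R :=
  LeavittAlgebra.mk 𝒟 R (ι R (.s a A hA))

/-- The element `s*_{a,A}`. -/
noncomputable def sStar (a : L) (A : B) (hA : A ∈ 𝒟.I a) : 𝒟.LeavittAlgebra R :=
  LeavittAlgebra.mk 𝒟 R (ι R (.sStar a A hA))

/-! The inverse semigroup of the system. -/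

/-- `θ_α = θ_{α_n} ∘ ⋯ ∘ θ_{α_1}` for a word `α = α_1 ⋯ α_n`; it is the identity for the empty
word. -/
def θw : List L → B → B
  | [], A => A
  | a :: α, A => θw α (𝒟.θ a A)

/-- `𝓘_α = {A : A ≤ θ_{α_2 ⋯ α_n}(C) for some C ∈ 𝓘_{α_1}}` for a nonempty word
`α = α_1 ⋯ α_n`, and `𝓘_ω = 𝓑` for the empty word `ω`. -/
def Iw : List L → Set B
  | [] => Set.univ
  | a :: α => {A | ∃ C ∈ 𝒟.I a, A ≤ 𝒟.θw α C}

theorem θw_bot (α : List L) : 𝒟.θw α ⊥ = ⊥ := by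
  induction α with
  | nil => rfl
  | cons a α ih => rw [θw, 𝒟.map_bot, ih]

theorem θw_inf (α : List L) (A C : B) : 𝒟.θw α (A ⊓ C) = 𝒟.θw α A ⊓ 𝒟.θw α C := by
  induction α generalizing A C with
  | nil => rfl
  | cons a α ih => rw [θw, 𝒟.map_inf, ih]; rfl

theorem θw_mono (α : List L) {A C : B} (h : A ≤ C) : 𝒟.θw α A ≤ 𝒟.θw α C := by
  rw [← inf_eq_left] at h ⊢
  rw [← θw_inf, h]

theorem θw_append (α β : List L) (A : B) : 𝒟.θw (α ++ β) A = 𝒟.θw β (𝒟.θw α A) := by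
  induction α generalizing A with
  | nil => rfl
  | cons a α ih => exact ih _

theorem Iw_mono {α : List L} {A C : B} (h : A ≤ C) (hC : C ∈ 𝒟.Iw α) : A ∈ 𝒟.Iw α := by
  cases α with
  | nil => trivial
  | cons a α =>
    obtain ⟨D, hD, hCD⟩ := hC
    exact ⟨D, hD, h.trans hCD⟩

theorem Iw_append {α : List L} {A : B} (hA : A ∈ 𝒟.Iw α) (β : List L) :
    𝒟.θw β A ∈ 𝒟.Iw (α ++ β) := by
  cases α with
  | nil =>
    cases β with
    | nil => trivial
    | cons b β => exact ⟨𝒟.θ b A, 𝒟.θ_mem_I b A, le_rfl⟩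
  | cons a α =>
    obtain ⟨D, hD, hAD⟩ := hA
    exact ⟨D, hD, (𝒟.θw_mono β hAD).trans (𝒟.θw_append α β D).ge⟩

theorem mem_Iw_singleton {a : L} {A : B} (hA : A ∈ 𝒟.I a) : A ∈ 𝒟.Iw [a] := ⟨A, hA, le_rfl⟩

/-- The inverse semigroup `S_{(𝓑, 𝓛, θ, 𝓘)}`: zero and the triples `(α, A, β)` with
`∅ ≠ A ∈ 𝓘_α ∩ 𝓘_β`. -/
inductive InvSgp
  | zero
  | triple (α : List L) (A : B) (β : List L) (hA : A ≠ ⊥) (hα : A ∈ 𝒟.Iw α) (hβ : A ∈ 𝒟.Iw β)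

namespace InvSgp

instance : Zero 𝒟.InvSgp := ⟨zero⟩

variable {𝒟}

open Classical in
/-- The triple `(α, A, β)`, read as `0` if `A = ∅`. -/
noncomputable def mk (α : List L) (A : B) (β : List L) (hα : A ∈ 𝒟.Iw α) (hβ : A ∈ 𝒟.Iw β) :
    𝒟.InvSgp :=
  if h : A = ⊥ then 0 else triple α A β h hα hβ

theorem inf_mem_left {α : List L} {A : B} (hA : A ∈ 𝒟.Iw α) (C : B) : A ⊓ C ∈ 𝒟.Iw α :=
  𝒟.Iw_mono inf_le_left hA

theorem inf_mem_right {α : List L} {A : B} (hA : A ∈ 𝒟.Iw α) (C : B) : C ⊓ A ∈ 𝒟.Iw α :=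
  𝒟.Iw_mono inf_le_right hA

open Classical in
/-- The product `(α, A, β) (γ, C, δ)`: it is `(α γ', θ_{γ'}(A) ∧ C, δ)` if `γ = β γ'`, it is
`(α, A ∧ θ_{β'}(C), δ β')` if `β = γ β'`, and `0` otherwise. -/
noncomputable instance : Mul 𝒟.InvSgp where
  mul
    | zero, _ => 0
    | triple .., zero => 0
    | triple α A β _ hα _, triple γ C δ _ _ hδ =>
      if β <+: γ then
        mk (α ++ γ.drop β.length) (𝒟.θw (γ.drop β.length) A ⊓ C) δ
          (inf_mem_left (𝒟.Iw_append hα _) _) (inf_mem_right hδ _)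
      else if γ <+: β then
        mk α (A ⊓ 𝒟.θw (β.drop γ.length) C) (δ ++ β.drop γ.length)
          (inf_mem_left hα _) (inf_mem_right (𝒟.Iw_append hδ _) _)
      else 0

/-- `(α, A, β)⁻¹ = (β, A, α)`. -/
instance : Inv 𝒟.InvSgp where
  inv
    | zero => 0
    | triple α A β hA hα hβ => triple β A α hA hβ hα

protected theorem zero_mul (x : 𝒟.InvSgp) : 0 * x = 0 := by cases x <;> rfl

protected theorem mul_zero (x : 𝒟.InvSgp) : x * 0 = 0 := by cases x <;> rfl

theorem mk_bot {α β : List L} (hα : (⊥ : B) ∈ 𝒟.Iw α) (hβ : ⊥ ∈ 𝒟.Iw β) :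
    mk α ⊥ β hα hβ = 0 := dif_pos rfl

theorem mk_of_eq_bot {α β : List L} {A : B} {hα : A ∈ 𝒟.Iw α} {hβ : A ∈ 𝒟.Iw β} (h : A = ⊥) :
    mk α A β hα hβ = 0 := dif_pos h

theorem mk_of_ne {α β : List L} {A : B} {hα : A ∈ 𝒟.Iw α} {hβ : A ∈ 𝒟.Iw β} (h : A ≠ ⊥) :
    mk α A β hα hβ = triple α A β h hα hβ := dif_neg h

theorem mk_congr {α β α' β' : List L} {A A' : B} {hα : A ∈ 𝒟.Iw α} {hβ : A ∈ 𝒟.Iw β}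
    {hα' : A' ∈ 𝒟.Iw α'} {hβ' : A' ∈ 𝒟.Iw β'} (h1 : α = α') (h2 : A = A') (h3 : β = β') :
    mk α A β hα hβ = mk α' A' β' hα' hβ' := by
  subst h1; subst h2; subst h3; rfl

theorem exists_mk (x : 𝒟.InvSgp) : x = 0 ∨ ∃ α A β hα hβ, x = mk α A β hα hβ := by
  cases x with
  | zero => exact Or.inl rfl
  | triple α A β hA hα hβ => exact Or.inr ⟨α, A, β, hα, hβ, (mk_of_ne hA).symm⟩

theorem inv_mk {α β : List L} {A : B} (hα : A ∈ 𝒟.Iw α) (hβ : A ∈ 𝒟.Iw β) :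
    (mk α A β hα hβ)⁻¹ = mk β A α hβ hα := by
  by_cases h : A = ⊥
  · rw [mk_of_eq_bot h, mk_of_eq_bot h]; rfl
  · rw [mk_of_ne h, mk_of_ne h]; rfl

theorem mk_mul_left {α β γ' δ : List L} {A C : B} (hα : A ∈ 𝒟.Iw α) (hβ : A ∈ 𝒟.Iw β)
    (hγ : C ∈ 𝒟.Iw (β ++ γ')) (hδ : C ∈ 𝒟.Iw δ) :
    mk α A β hα hβ * mk (β ++ γ') C δ hγ hδ =
      mk (α ++ γ') (𝒟.θw γ' A ⊓ C) δ (inf_mem_left (𝒟.Iw_append hα _) _)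
        (inf_mem_right hδ _) := by
  by_cases hA : A = ⊥
  · rw [mk_of_eq_bot hA, InvSgp.zero_mul, mk_of_eq_bot (by rw [hA, θw_bot, bot_inf_eq])]
  by_cases hC : C = ⊥
  · rw [mk_of_eq_bot hC, InvSgp.mul_zero, mk_of_eq_bot (by rw [hC, inf_bot_eq])]
  rw [mk_of_ne hA, mk_of_ne hC]
  refine (if_pos (List.prefix_append β γ')).trans ?_
  exact mk_congr (by rw [List.drop_left]) (by rw [List.drop_left]) rfl

theorem mk_mul_right {α γ β' δ : List L} {A C : B} (hα : A ∈ 𝒟.Iw α)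
    (hβ : A ∈ 𝒟.Iw (γ ++ β')) (hγ : C ∈ 𝒟.Iw γ) (hδ : C ∈ 𝒟.Iw δ) :
    mk α A (γ ++ β') hα hβ * mk γ C δ hγ hδ =
      mk α (A ⊓ 𝒟.θw β' C) (δ ++ β') (inf_mem_left hα _)
        (inf_mem_right (𝒟.Iw_append hδ _) _) := by
  by_cases hb : β' = []
  · subst hb
    simp only [List.append_nil] at hβ ⊢
    have h := mk_mul_left (γ' := []) hα hβ (by rwa [List.append_nil]) hδ
    simp only [List.append_nil] at h
    exact h
  by_cases hA : A = ⊥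
  · rw [mk_of_eq_bot hA, InvSgp.zero_mul, mk_of_eq_bot (by rw [hA, bot_inf_eq])]
  by_cases hC : C = ⊥
  · rw [mk_of_eq_bot hC, InvSgp.mul_zero, mk_of_eq_bot (by rw [hC, θw_bot, inf_bot_eq])]
  rw [mk_of_ne hA, mk_of_ne hC]
  have hn : ¬ (γ ++ β' <+: γ) := fun h => hb (by simpa using h.length_le)
  refine (if_neg hn).trans ((if_pos (List.prefix_append γ β')).trans ?_)
  exact mk_congr rfl (by rw [List.drop_left]) (by rw [List.drop_left])

theorem mk_mul_none {α β γ δ : List L} {A C : B} (hα : A ∈ 𝒟.Iw α) (hβ : A ∈ 𝒟.Iw β)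
    (hγ : C ∈ 𝒟.Iw γ) (hδ : C ∈ 𝒟.Iw δ) (h1 : ¬ β <+: γ) (h2 : ¬ γ <+: β) :
    mk α A β hα hβ * mk γ C δ hγ hδ = 0 := by
  by_cases hA : A = ⊥
  · rw [mk_of_eq_bot hA, InvSgp.zero_mul]
  by_cases hC : C = ⊥
  · rw [mk_of_eq_bot hC, InvSgp.mul_zero]
  rw [mk_of_ne hA, mk_of_ne hC]
  exact (if_neg h1).trans (if_neg h2)

theorem mk_mul_same {α β δ : List L} {A C : B} (hα : A ∈ 𝒟.Iw α) (hβ : A ∈ 𝒟.Iw β)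
    (hβ' : C ∈ 𝒟.Iw β) (hδ : C ∈ 𝒟.Iw δ) :
    mk α A β hα hβ * mk β C δ hβ' hδ =
      mk α (A ⊓ C) δ (inf_mem_left hα _) (inf_mem_right hδ _) := by
  have h := mk_mul_left (γ' := []) hα hβ (by rwa [List.append_nil]) hδ
  simp only [List.append_nil] at h
  exact h

theorem prefix_cases (β γ : List L) :
    (∃ γ', γ = β ++ γ') ∨ (∃ β', β = γ ++ β') ∨ (¬ β <+: γ ∧ ¬ γ <+: β) := by
  by_cases h1 : β <+: γ
  · obtain ⟨t, rfl⟩ := h1; exact Or.inl ⟨t, rfl⟩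
  by_cases h2 : γ <+: β
  · obtain ⟨t, rfl⟩ := h2; exact Or.inr (Or.inl ⟨t, rfl⟩)
  exact Or.inr (Or.inr ⟨h1, h2⟩)

theorem not_prefix_append {β γ : List L} (h1 : ¬ β <+: γ) (h2 : ¬ γ <+: β) (ε : List L) :
    ¬ β <+: γ ++ ε ∧ ¬ γ ++ ε <+: β :=
  ⟨fun h => (List.prefix_or_prefix_of_prefix h (List.prefix_append γ ε)).elim h1 h2,
    fun h => h2 ((List.prefix_append γ ε).trans h)⟩

protected theorem mul_assoc (x y z : 𝒟.InvSgp) : x * y * z = x * (y * z) := by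
  rcases exists_mk x with rfl | ⟨α, A, β, hα, hβ, rfl⟩
  · simp only [InvSgp.zero_mul]
  rcases exists_mk y with rfl | ⟨γ, C, δ, hγ, hδ, rfl⟩
  · simp only [InvSgp.zero_mul, InvSgp.mul_zero]
  rcases exists_mk z with rfl | ⟨ε, D, ζ, hε, hζ, rfl⟩
  · simp only [InvSgp.mul_zero]
  rcases prefix_cases β γ with ⟨γ', rfl⟩ | ⟨β', rfl⟩ | ⟨h1, h2⟩
  · rcases prefix_cases δ ε with ⟨ε', rfl⟩ | ⟨δ', rfl⟩ | ⟨h3, h4⟩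
    · rw [mk_mul_left, mk_mul_left, mk_mul_left]
      have h : ∀ (w : List L) (hw : w = β ++ (γ' ++ ε')) (E : B) (hE : E ∈ 𝒟.Iw w)
          (hE' : E ∈ 𝒟.Iw ζ), mk α A β hα hβ * mk w E ζ hE hE' =
          mk (α ++ (γ' ++ ε')) (𝒟.θw (γ' ++ ε') A ⊓ E) ζ
            (inf_mem_left (𝒟.Iw_append hα _) _) (inf_mem_right hE' _) := by
        rintro w rfl E hE hE'; exact mk_mul_left _ _ _ _
      rw [h _ (List.append_assoc _ _ _)]
      exact mk_congr (List.append_assoc _ _ _)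
        (by rw [θw_append, θw_inf, inf_assoc]) rfl
    · rw [mk_mul_left, mk_mul_right, mk_mul_right, mk_mul_left]
      exact mk_congr rfl (by rw [inf_assoc]) rfl
    · rw [mk_mul_left, mk_mul_none _ _ _ _ h3 h4, mk_mul_none _ _ _ _ h3 h4, InvSgp.mul_zero]
  · rcases prefix_cases δ ε with ⟨ε', rfl⟩ | ⟨δ', rfl⟩ | ⟨h3, h4⟩
    · rw [mk_mul_right, mk_mul_left]
      rcases prefix_cases β' ε' with ⟨μ, rfl⟩ | ⟨μ, rfl⟩ | ⟨h5, h6⟩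
      · have hl : ∀ (w : List L) (hw : w = (δ ++ β') ++ μ) (x1 : List L) (E D : B)
            (e1 : E ∈ 𝒟.Iw x1) (e2 : E ∈ 𝒟.Iw (δ ++ β')) (d1 : D ∈ 𝒟.Iw w) (d2 : D ∈ 𝒟.Iw ζ),
            mk x1 E (δ ++ β') e1 e2 * mk w D ζ d1 d2 =
            mk (x1 ++ μ) (𝒟.θw μ E ⊓ D) ζ
            (inf_mem_left (𝒟.Iw_append e1 _) _) (inf_mem_right d2 _) := by
          rintro w rfl _ E D _ _ _ _; exact mk_mul_left _ _ _ _
        have hr : ∀ (w : List L) (hw : w = (γ ++ β') ++ μ) (E : B)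
            (e1 : E ∈ 𝒟.Iw w) (e2 : E ∈ 𝒟.Iw ζ),
            mk α A (γ ++ β') hα hβ * mk w E ζ e1 e2 =
            mk (α ++ μ) (𝒟.θw μ A ⊓ E) ζ
            (inf_mem_left (𝒟.Iw_append hα _) _) (inf_mem_right e2 _) := by
          rintro w rfl E _ _; exact mk_mul_left _ _ _ _
        rw [hl _ (List.append_assoc _ _ _).symm, hr _ (List.append_assoc _ _ _).symm]
        exact mk_congr rfl (by rw [θw_inf, θw_append, inf_assoc]) rfl
      · have hl : ∀ (w : List L) (hw : w = (δ ++ ε') ++ μ) (x1 : List L) (E : B)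
            (e1 : E ∈ 𝒟.Iw x1) (e2 : E ∈ 𝒟.Iw w),
            mk x1 E w e1 e2 * mk (δ ++ ε') D ζ hε hζ =
            mk x1 (E ⊓ 𝒟.θw μ D) (ζ ++ μ)
            (inf_mem_left e1 _) (inf_mem_right (𝒟.Iw_append hζ _) _) := by
          rintro w rfl _ E _ _; exact mk_mul_right _ _ _ _
        have hr : ∀ (w : List L) (hw : w = (γ ++ ε') ++ μ) (E : B) (a2 : A ∈ 𝒟.Iw w)
            (e1 : E ∈ 𝒟.Iw (γ ++ ε')) (e2 : E ∈ 𝒟.Iw ζ),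
            mk α A w hα a2 * mk (γ ++ ε') E ζ e1 e2 =
            mk α (A ⊓ 𝒟.θw μ E) (ζ ++ μ)
            (inf_mem_left hα _) (inf_mem_right (𝒟.Iw_append e2 _) _) := by
          rintro w rfl E _ _ _; exact mk_mul_right _ _ _ _
        rw [hl _ (List.append_assoc _ _ _).symm, hr _ (List.append_assoc _ _ _).symm]
        exact mk_congr rfl (by rw [θw_inf, θw_append, inf_assoc]) rfl
      · have hp : ∀ (x : List L) {u v : List L}, ¬ u <+: v → ¬ x ++ u <+: x ++ v :=
          fun x u v h h' => h ((List.prefix_append_right_inj x).1 h')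
        rw [mk_mul_none _ _ _ _ (hp δ h5) (hp δ h6), mk_mul_none _ _ _ _ (hp γ h5) (hp γ h6)]
    · rw [mk_mul_right, mk_mul_right, mk_mul_right]
      have h : ∀ (w : List L) (hw : w = δ' ++ β') (w' : List L) (hw' : w' = ε ++ (δ' ++ β'))
          (E : B) (e1 : E ∈ 𝒟.Iw α) (e2 : E ∈ 𝒟.Iw w'),
          mk α E w' e1 e2 * mk ε D ζ hε hζ =
          mk α (E ⊓ 𝒟.θw (δ' ++ β') D) (ζ ++ (δ' ++ β'))
            (inf_mem_left e1 _) (inf_mem_right (𝒟.Iw_append hζ _) _) := by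
        rintro w rfl w' rfl E e1 e2; exact mk_mul_right _ _ _ _
      rw [h _ rfl _ (List.append_assoc _ _ _)]
      exact mk_congr rfl (by rw [θw_append, θw_inf, inf_assoc]) (List.append_assoc _ _ _).symm
    · rw [mk_mul_right, mk_mul_none _ _ _ _ h3 h4, InvSgp.mul_zero]
      have h5 := not_prefix_append h4 h3 β'
      exact mk_mul_none _ _ _ _ h5.2 h5.1
  · rw [mk_mul_none _ _ _ _ h1 h2, InvSgp.zero_mul]
    rcases prefix_cases δ ε with ⟨ε', rfl⟩ | ⟨δ', rfl⟩ | ⟨h3, h4⟩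
    · rw [mk_mul_left]
      have h5 := not_prefix_append h1 h2 ε'
      exact (mk_mul_none _ _ _ _ h5.1 h5.2).symm
    · rw [mk_mul_right, mk_mul_none _ _ _ _ h1 h2]
    · rw [mk_mul_none _ _ _ _ h3 h4, InvSgp.mul_zero]

/-- An idempotent is zero or of the form `(α, A, α)`. -/
theorem exists_of_idem {x : 𝒟.InvSgp} (h : x * x = x) : x = 0 ∨ ∃ α A hα, x = mk α A α hα hα := by
  cases x with
  | zero => exact Or.inl rfl
  | triple α A β hA hα hβ =>
    right
    suffices hs : α = β by
      subst hs; exact ⟨α, A, hα, (mk_of_ne hA).symm⟩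
    rw [← mk_of_ne hA] at h
    rcases prefix_cases β α with ⟨γ', rfl⟩ | ⟨β', rfl⟩ | ⟨h1, h2⟩
    · rw [mk_mul_left, mk_of_ne hA] at h
      by_cases h0 : 𝒟.θw γ' A ⊓ A = ⊥
      · rw [mk_of_eq_bot h0] at h; cases h
      · rw [mk_of_ne h0] at h
        injection h with h3
        simpa using h3
    · rw [mk_mul_right, mk_of_ne hA] at h
      by_cases h0 : A ⊓ 𝒟.θw β' A = ⊥
      · rw [mk_of_eq_bot h0] at h; cases h
      · rw [mk_of_ne h0] at h
        injection h with _ _ h3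
        simpa using h3
    · rw [mk_mul_none _ _ _ _ h1 h2, mk_of_ne hA] at h; cases h

noncomputable instance : InverseSemigroupWithZero 𝒟.InvSgp where
  mul_assoc := InvSgp.mul_assoc
  zero_mul := InvSgp.zero_mul
  mul_zero := InvSgp.mul_zero
  mul_inv_mul x := by
    rcases exists_mk x with rfl | ⟨α, A, β, hα, hβ, rfl⟩
    · rw [InvSgp.mul_zero]
    · rw [inv_mk, mk_mul_same, mk_mul_same]
      exact mk_congr rfl (by simp) rfl
  inv_mul_inv x := by
    rcases exists_mk x with rfl | ⟨α, A, β, hα, hβ, rfl⟩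
    · rfl
    · rw [inv_mk, mk_mul_same, mk_mul_same]
      exact mk_congr rfl (by simp) rfl
  idem_comm e f he hf := by
    rcases exists_of_idem he with rfl | ⟨α, A, hα, rfl⟩
    · rw [InvSgp.mul_zero, InvSgp.zero_mul]
    rcases exists_of_idem hf with rfl | ⟨γ, C, hγ, rfl⟩
    · rw [InvSgp.mul_zero, InvSgp.zero_mul]
    rcases prefix_cases α γ with ⟨γ', rfl⟩ | ⟨β', rfl⟩ | ⟨h1, h2⟩
    · rw [mk_mul_left, mk_mul_right]
      exact mk_congr rfl (inf_comm _ _) rfl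
    · rw [mk_mul_left, mk_mul_right]
      exact mk_congr rfl (inf_comm _ _) rfl
    · rw [mk_mul_none _ _ _ _ h1 h2, mk_mul_none _ _ _ _ h2 h1]

end InvSgp

/-- A word `α_1 ⋯ α_n`, viewed as an element of the free group on `𝓛`. -/
def word (α : List L) : FreeGroup L := (α.map FreeGroup.of).prod

theorem word_append (α β : List L) : word (α ++ β) = word α * word β := by simp [word]

theorem word_injective : Function.Injective (word (L := L)) := by
  classical
  have h : ∀ α : List L, word α = FreeGroup.mk (α.map fun a => (a, true)) := by
    intro α
    induction α with
    | nil => rfl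
    | cons a α ih =>
      rw [show word (a :: α) = FreeGroup.of a * word α by simp [word], ih]
      rfl
  have hr : ∀ α : List L, FreeGroup.reduce (α.map fun a => (a, true)) =
      α.map fun a => (a, true) := by
    intro α
    apply FreeGroup.IsReduced.reduce_eq
    unfold FreeGroup.IsReduced
    rw [List.isChain_map]
    induction α with
    | nil => simp
    | cons a α ih =>
      cases α with
      | nil => simp
      | cons b α => exact List.isChain_cons_cons.2 ⟨fun _ => rfl, ih⟩
  intro α β hab
  rw [h, h] at hab
  have h2 := congrArg FreeGroup.toWord hab
  rw [FreeGroup.toWord_mk, FreeGroup.toWord_mk, hr, hr] at h2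
  exact List.map_injective_iff.2 (fun a b hab => (Prod.mk.inj hab).1) h2

/-- The underlying map `(α, A, β) ↦ α β⁻¹` of the grading (with an irrelevant value at `0`). -/
def degree : 𝒟.InvSgp → FreeGroup L
  | .zero => 1
  | .triple α _ β _ _ _ => word α * (word β)⁻¹

theorem degree_mk {α β : List L} {A : B} {hα : A ∈ 𝒟.Iw α} {hβ : A ∈ 𝒟.Iw β}
    (h : InvSgp.mk α A β hα hβ ≠ 0) :
    𝒟.degree (InvSgp.mk α A β hα hβ) = word α * (word β)⁻¹ := by
  by_cases hA : A = ⊥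
  · exact absurd (InvSgp.mk_of_eq_bot hA) h
  · rw [InvSgp.mk_of_ne hA]; rfl

/-- The grading `(α, A, β) ↦ α β⁻¹` of the inverse semigroup by the free group on `𝓛`, which
makes it strongly `E*`-unitary. -/
def grading : StrongGrading 𝒟.InvSgp (FreeGroup L) where
  toFun := 𝒟.degree
  map_mul x y hxy := by
    rcases InvSgp.exists_mk x with rfl | ⟨α, A, β, hα, hβ, rfl⟩
    · exact absurd (zero_mul _) hxy
    rcases InvSgp.exists_mk y with rfl | ⟨γ, C, δ, hγ, hδ, rfl⟩
    · exact absurd (mul_zero _) hxy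
    have hx := 𝒟.degree_mk (left_ne_zero_of_mul hxy)
    have hy := 𝒟.degree_mk (right_ne_zero_of_mul hxy)
    rw [hx, hy]
    rcases InvSgp.prefix_cases β γ with ⟨γ', rfl⟩ | ⟨β', rfl⟩ | ⟨h1, h2⟩
    · rw [InvSgp.mk_mul_left] at hxy ⊢
      rw [𝒟.degree_mk hxy, word_append, word_append]
      group
    · rw [InvSgp.mk_mul_right] at hxy ⊢
      rw [𝒟.degree_mk hxy, word_append, word_append]
      group
    · exact absurd (InvSgp.mk_mul_none _ _ _ _ h1 h2) hxy
  idem_of_eq_one x hx h := by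
    rcases InvSgp.exists_mk x with rfl | ⟨α, A, β, hα, hβ, rfl⟩
    · exact absurd rfl hx
    rw [𝒟.degree_mk hx, mul_inv_eq_one] at h
    obtain rfl := word_injective h
    rw [InvSgp.mk_mul_same]
    exact InvSgp.mk_congr rfl (by simp) rfl

/-- The idempotent `(α, A, α)` for `A ∈ 𝓘_α`, read as `0` if `A = ∅`. -/
noncomputable def idem (α : List L) (A : B) (hA : A ∈ 𝒟.Iw α) :
    InverseSemigroupWithZero.Idem 𝒟.InvSgp :=
  ⟨InvSgp.mk α A α hA hA, by
    rw [InvSgp.mk_mul_same]; exact InvSgp.mk_congr rfl (by simp) rfl⟩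

theorem idem_mem_E {α β : List L} {A : B} (hα : A ∈ 𝒟.Iw α) (hβ : A ∈ 𝒟.Iw β) :
    𝒟.idem α A hα ∈ 𝒟.grading.E (word α * (word β)⁻¹) := by
  by_cases hA : A = ⊥
  · exact Or.inl (InverseSemigroupWithZero.Idem.ext (InvSgp.mk_of_eq_bot hA))
  · have h0 : InvSgp.mk α A β hα hβ ≠ 0 := by
      rw [InvSgp.mk_of_ne hA]; intro h; cases h
    refine Or.inr ⟨InvSgp.mk α A β hα hβ, h0, 𝒟.degree_mk h0,
      InverseSemigroupWithZero.Idem.ext ?_⟩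
    change InvSgp.mk α A β hα hβ * (InvSgp.mk α A β hα hβ)⁻¹ = InvSgp.mk α A α hα hα
    rw [InvSgp.inv_mk, InvSgp.mk_mul_same]
    exact InvSgp.mk_congr rfl (by simp) rfl

theorem mem_E_one (A : B) : 𝒟.idem [] A trivial ∈ 𝒟.grading.E 1 := by
  have h := 𝒟.idem_mem_E (α := []) (β := []) (A := A) trivial trivial
  rwa [mul_inv_cancel] at h

theorem mem_E_of {a : L} {A : B} (hA : A ∈ 𝒟.I a) :
    𝒟.idem [a] A (𝒟.mem_Iw_singleton hA) ∈ 𝒟.grading.E (FreeGroup.of a) := by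
  have h := 𝒟.idem_mem_E (α := [a]) (β := []) (𝒟.mem_Iw_singleton hA) trivial
  simpa [word] using h

theorem mem_E_of_inv {a : L} {A : B} (hA : A ∈ 𝒟.I a) :
    𝒟.idem [] A trivial ∈ 𝒟.grading.E (FreeGroup.of a)⁻¹ := by
  have h := 𝒟.idem_mem_E (α := []) (β := [a]) trivial (𝒟.mem_Iw_singleton hA)
  simpa [word] using h

end GenBoolDynSystem

/-! Write `S` for the inverse semigroup of triples. Both algebras are spanned by multiplicative
images of `S`. In the skew ring the elements `monomial s`, that is `s s⁻¹ δ_{φ(s)}`, multiply as in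
`S` (`monomial_mul`) and span (`span_monomial`), because every function in `D_g` is a finite
combination of characteristic functions of sets `V_x` with `x ∈ E_g` (`mem_charSpan`). In the
universal algebra the elements `s_{α,A} s*_{β,A}` form a multiplicative map `rep` (`rep_mul`) whose
values span (`span_rep`).

The monomials satisfy the defining relations. Most of them hold in `S` already. The join relation
holds because `(ω, A, ω)` and `(ω, C, ω)` cover `(ω, A ∪ C, ω)`, and the relation at a regular `A`
because the elements `(a, θ_a(A), a)` with `a ∈ Δ_A` form a disjoint finite cover of `(ω, A, ω)`.
The resulting homomorphism sends `rep s` to `monomial s`, so it is surjective.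

Injectivity means that each linear relation between monomials also holds between the values of
`rep`. In one degree, a relation between monomials is a pointwise identity on the space of tight
filters. It passes to every tight multiplicative map `t` (`sum_eq_zero_of_sum_monomial_eq_zero`):
the commuting idempotents `t (s s⁻¹)` cut the unit into cells; on a cell the elements of equal
degree that do not vanish coincide (`mul_inv_mul_comm`), so the relation becomes a scalar times one
element; and a nonzero cell contains a tight filter (`exists_tightFilter_of_tight`), at which the
identity says that the scalar is zero.

It remains to see that the relations for joins and for regular elements force `rep` to be tight
(`IsCuntzKrieger.isTight`). Conjugation reduces to a cover of some `(ω, A, ω)`, and one inducts on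
the lengths of the words in the cover. The members with empty word are joined into one `A₀`; then `A
\ A₀` is covered by finitely many elements with nonempty words, which makes it regular. The relation
for regular elements splits it into letters, and conjugation strips the first letter from the words.
-/

/-! ### Existence of tight filters, and covers. -/

namespace TightFilter

variable {E : Type*} [SemilatticeInf E] [OrderBot E]

/-- The finite set `Z` covers `x`, without the requirement that its elements lie below `x`. -/
def _root_.Covers (Z : Finset E) (x : E) : Prop :=
  ∀ y ≤ x, y ≠ ⊥ → ∃ z ∈ Z, z ⊓ y ≠ ⊥

/-- A maximal proper filter is tight, so every nonzero element lies in a tight filter. -/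
theorem exists_mem (y : E) (hy : y ≠ ⊥) : ∃ ξ : TightFilter E, y ∈ ξ.carrier := by
  classical
  -- `P` consists of the proper filters and the empty set; nonemptiness comes from starting Zorn's
  -- lemma at `Set.Ici y`.
  let P : Set (Set E) := {F | ⊥ ∉ F ∧ (∀ a b, a ∈ F → a ≤ b → b ∈ F) ∧
    (∀ a b, a ∈ F → b ∈ F → a ⊓ b ∈ F)}
  have hchain : ∀ c ⊆ P, IsChain (· ⊆ ·) c → c.Nonempty → ∃ ub ∈ P, ∀ s ∈ c, s ⊆ ub := by
    intro c hc hch _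
    refine ⟨⋃₀ c, ⟨?_, ?_, ?_⟩, fun s hs => Set.subset_sUnion_of_mem hs⟩
    · rintro ⟨F, hF, h⟩
      exact (hc hF).1 h
    · rintro a b ⟨F, hF, h⟩ hab
      exact ⟨F, hF, (hc hF).2.1 a b h hab⟩
    · rintro a b ⟨F, hF, h⟩ ⟨F', hF', h'⟩
      rcases hch.total hF hF' with hs | hs
      · exact ⟨F', hF', (hc hF').2.2 a b (hs h) h'⟩
      · exact ⟨F, hF, (hc hF).2.2 a b h (hs h')⟩
  have hmem : Set.Ici y ∈ P :=
    ⟨fun h => hy (le_bot_iff.1 h), fun a b ha hab => le_trans ha hab, fun a b => le_inf⟩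
  obtain ⟨F, hyF, hF⟩ := zorn_subset_nonempty P hchain _ hmem
  have hyF' : y ∈ F := hyF (Set.mem_Ici.2 le_rfl)
  obtain ⟨hF0, hF1, hF2⟩ := hF.prop
  -- Otherwise `F` and `z` together would generate a strictly larger proper filter.
  have key : ∀ z, z ∉ F → ∃ w ∈ F, w ⊓ z = ⊥ := by
    intro z hz
    by_contra! hcon
    have hP : {a | ∃ w ∈ F, w ⊓ z ≤ a} ∈ P := by
      refine ⟨?_, ?_, ?_⟩
      · rintro ⟨w, hw, h⟩
        exact hcon w hw (le_bot_iff.1 h)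
      · rintro a b ⟨w, hw, h⟩ hab
        exact ⟨w, hw, h.trans hab⟩
      · rintro a b ⟨w, hw, h⟩ ⟨w', hw', h'⟩
        exact ⟨w ⊓ w', hF2 _ _ hw hw', le_inf
          ((inf_le_inf_right z inf_le_left).trans h) ((inf_le_inf_right z inf_le_right).trans h')⟩
    have hle : F ⊆ {a | ∃ w ∈ F, w ⊓ z ≤ a} := fun w hw => ⟨w, hw, inf_le_left⟩
    exact hz (hF.le_of_ge hP hle ⟨y, hyF', inf_le_right⟩)
  refine ⟨⟨F, ⟨y, hyF'⟩, hF0, fun {a b} => hF1 a b, fun {a b} => hF2 a b, ?_⟩, hyF'⟩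
  intro x hx Z hZ
  by_contra! hcon
  -- If `Z` misses `F`, the finitely many witnesses from `key` meet in an element of `F` below `x`
  -- that is disjoint from all of `Z`; it is nonzero, against the cover.
  have hw : ∀ Z' : Finset E, Z' ⊆ Z → ∃ w ∈ F, w ≤ x ∧ ∀ z ∈ Z', z ⊓ w = ⊥ := by
    intro Z'
    induction Z' using Finset.induction_on with
    | empty => exact fun _ => ⟨x, hx, le_rfl, by simp⟩
    | insert a s ha ih =>
      intro hs
      obtain ⟨w, hw, hwx, h⟩ := ih ((Finset.subset_insert a s).trans hs)
      obtain ⟨v, hv, hva⟩ := key a (hcon a (hs (Finset.mem_insert_self a s)))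
      refine ⟨w ⊓ v, hF2 _ _ hw hv, inf_le_left.trans hwx, fun z hz => ?_⟩
      rcases Finset.mem_insert.1 hz with rfl | hz
      · exact le_bot_iff.1 ((le_inf (inf_le_right.trans inf_le_right) inf_le_left).trans hva.le)
      · exact le_bot_iff.1 ((inf_le_inf_left z inf_le_left).trans (h z hz).le)
  obtain ⟨w, hwF, hwx, hwZ⟩ := hw Z subset_rfl
  obtain ⟨z, hz, hz0⟩ := hZ.2 w hwx fun h => hF0 (h ▸ hwF)
  exact hz0 (hwZ z hz)

theorem inf_mem_iff {ξ : TightFilter E} {x y : E} :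
    x ⊓ y ∈ ξ.carrier ↔ x ∈ ξ.carrier ∧ y ∈ ξ.carrier :=
  ⟨fun h => ⟨ξ.mem_of_le h inf_le_left, ξ.mem_of_le h inf_le_right⟩, fun h => ξ.inf_mem h.1 h.2⟩

/-- A tight filter that contains `x` meets every finite set that covers `x`. -/
theorem exists_mem_of_covers {ξ : TightFilter E} {x : E} (hx : x ∈ ξ.carrier) {Z : Finset E}
    (hZ : Covers Z x) : ∃ z ∈ Z, z ∈ ξ.carrier := by
  classical
  obtain ⟨w, hw, hwξ⟩ := ξ.tight x hx (Z.image (x ⊓ ·)) (by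
    constructor
    · intro w hw
      obtain ⟨z, -, rfl⟩ := Finset.mem_image.1 hw
      exact inf_le_left
    · intro y hy hy0
      obtain ⟨z, hz, h⟩ := hZ y hy hy0
      refine ⟨_, Finset.mem_image_of_mem _ hz, fun h' => h ?_⟩
      rw [← h', inf_comm x z, inf_assoc, inf_eq_right.2 hy])
  obtain ⟨z, hz, rfl⟩ := Finset.mem_image.1 hw
  exact ⟨z, hz, (inf_mem_iff.1 hwξ).2⟩

end TightFilter

/-! ### Monomials in the partial skew group ring. -/

namespace StrongGrading

open InverseSemigroupWithZero

variable {S G : Type*} [InverseSemigroupWithZero S] [Group G] (φ : StrongGrading S G)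
variable (R : Type*) [CommRing R]

theorem ran_zero : ran (0 : S) = ⊥ := Idem.ext (zero_mul _)

theorem ran_mem_E (s : S) : ran s ∈ φ.E (φ.toFun s) := by
  by_cases h : s = 0
  · exact Or.inl (by rw [h, ran_zero])
  · exact Or.inr ⟨s, h, rfl, rfl⟩

/-- The restriction `y * s` of `s` has the same degree as `s` and range `y`, so `E_g` is closed
downwards. -/
theorem mem_E_of_le {g : G} {x y : Idem S} (hx : x ∈ φ.E g) (hy : y ≤ x) : y ∈ φ.E g := by
  by_cases h0 : y = ⊥
  · exact Or.inl h0
  rcases hx with rfl | ⟨s, hs, rfl, rfl⟩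
  · exact absurd (le_bot_iff.1 hy) h0
  have hr : ran (y.1 * s) = y := Idem.ext <| by
    rw [ran_mul, inv_of_idem y.2]
    calc y.1 * (ran s).1 * y.1 = y.1 * y.1 := by rw [Idem.le_def.1 hy]
      _ = y.1 := y.2
  have hys : y.1 * s ≠ 0 := fun h => h0 (by rw [← hr, h, ran_zero])
  refine Or.inr ⟨y.1 * s, hys, ?_, hr⟩
  rw [φ.map_mul _ _ hys, φ.map_idem y.2 (Idem.ne_bot_iff.1 h0), one_mul]

/-- The characteristic function of `V_x`. -/
noncomputable def char (x : Idem S) : TightFilter (Idem S) → R :=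
  Set.indicator (TightFilter.V x) fun _ => 1

variable {R} in
theorem char_of_mem {x : Idem S} {ξ : TightFilter (Idem S)} (h : x ∈ ξ.carrier) :
    char R x ξ = 1 := Set.indicator_of_mem (s := TightFilter.V x) h _

variable {R} in
theorem char_of_notMem {x : Idem S} {ξ : TightFilter (Idem S)} (h : x ∉ ξ.carrier) :
    char R x ξ = 0 := Set.indicator_of_notMem (s := TightFilter.V x) h _

theorem char_mul (x y : Idem S) : char R x * char R y = char R (x ⊓ y) := by
  funext ξ
  rw [Pi.mul_apply]
  by_cases hx : x ∈ ξ.carrier <;> by_cases hy : y ∈ ξ.carrier <;>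
    simp [char, TightFilter.V, Set.indicator, TightFilter.inf_mem_iff, hx, hy]

theorem char_bot : char R (⊥ : Idem S) = 0 := by
  funext ξ
  exact char_of_notMem ξ.bot_notMem

/-- If `s s⁻¹ ∈ ξ`, the translate of `ξ` by `φ(s)⁻¹` contains `t t⁻¹` exactly when `ξ` contains `s t
t⁻¹ s⁻¹`; this is `translate_aux` for `s⁻¹`. If `s s⁻¹ ∉ ξ`, both sides vanish at `ξ` because `ran
(s * t) ≤ ran s`. -/
theorem alpha_char (s t : S) :
    φ.alpha (φ.toFun s) (φ.alpha (φ.toFun s)⁻¹ (char R (ran s)) * char R (ran t)) =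
      char R (ran (s * t)) := by
  classical
  funext ξ
  have hc : ran (s * t) = conj s (ran t) := Idem.ext (ran_mul s t)
  by_cases h : ξ ∈ φ.U (φ.toFun s)
  · simp only [alpha, h, dif_pos, Pi.mul_apply]
    set η := φ.translate (φ.toFun s)⁻¹ ξ (φ.mem_U_inv_inv h) with hη
    have hηU : η ∈ φ.U (φ.toFun s)⁻¹ := φ.translate_mem _ _ _
    rw [dif_pos hηU]
    have hback : φ.translate (φ.toFun s)⁻¹⁻¹ η (φ.mem_U_inv_inv hηU) = ξ :=
      φ.translate_translate _ _ _ _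
    rw [hback]
    by_cases hs : ran s ∈ ξ.carrier
    · rw [char_of_mem hs, one_mul]
      have hs0 := ne_zero_of_ran_mem hs
      have hmem : ran t ∈ η.carrier ↔ conj s (ran t) ∈ ξ.carrier := by
        have h1 := φ.translate_aux (t := s⁻¹) (ξ := ξ) (by rwa [src_inv]) (ran t)
        rw [inv_inv', φ.map_inv hs0] at h1
        rw [hη, mem_translate, h1]
      rw [hc]
      by_cases h2 : conj s (ran t) ∈ ξ.carrier
      · rw [char_of_mem h2, char_of_mem (hmem.2 h2)]
      · rw [char_of_notMem h2, char_of_notMem fun h3 => h2 (hmem.1 h3)]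
    · rw [char_of_notMem hs, zero_mul, char_of_notMem]
      exact fun h' => hs (ξ.mem_of_le h' (ran_mul_le s t))
  · have h1 : ran (s * t) ∉ ξ.carrier := fun h' =>
      h (φ.mem_U_iff.2 ⟨s, rfl, ξ.mem_of_le h' (ran_mul_le s t)⟩)
    rw [char_of_notMem h1]
    simp [alpha, h]

/-- The element `s s⁻¹ δ_{φ(s)}` of the partial skew group ring. -/
noncomputable def monomial (s : S) : φ.SkewRing R :=
  φ.idemDelta R (φ.toFun s) (ran s) (φ.ran_mem_E s)

theorem idemDelta_congr {g g' : G} {x x' : Idem S} (hg : g = g') (hx : x = x') (h : x ∈ φ.E g)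
    (h' : x' ∈ φ.E g') : φ.idemDelta R g x h = φ.idemDelta R g' x' h' := by
  subst hg; subst hx; rfl

theorem idemDelta_bot (g : G) (h : ⊥ ∈ φ.E g) : φ.idemDelta R g ⊥ h = 0 := by
  unfold idemDelta
  rw [show (⟨_, φ.indicator_mem R h⟩ : φ.D R g) = 0 from Subtype.ext (char_bot R), map_zero]

theorem monomial_zero : φ.monomial R (0 : S) = 0 :=
  (φ.idemDelta_congr R rfl ran_zero _ (Or.inl rfl)).trans (φ.idemDelta_bot R _ _)

theorem idemDelta_eq_monomial {g : G} {x : Idem S} (h : x ∈ φ.E g) :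
    ∃ s : S, φ.idemDelta R g x h = φ.monomial R s := by
  rcases id h with rfl | ⟨s, -, rfl, rfl⟩
  · exact ⟨0, by rw [idemDelta_bot, monomial_zero]⟩
  · exact ⟨s, rfl⟩

theorem monomial_mul (s t : S) : φ.monomial R s * φ.monomial R t = φ.monomial R (s * t) := by
  have h1 : φ.monomial R s * φ.monomial R t = φ.delta R (φ.toFun s * φ.toFun t)
      ⟨char R (ran (s * t)), by
        rw [← φ.alpha_char]
        exact φ.mulCoeff_mem (φ.indicator_mem R (φ.ran_mem_E s))
          (φ.indicator_mem R (φ.ran_mem_E t))⟩ := by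
    refine (φ.delta_mul_delta R _ _ _ _).trans (congrArg _ (Subtype.ext ?_))
    exact φ.alpha_char R s t
  rw [h1]
  -- If `s * t = 0`, the degree of the product need not be the product of the degrees, but both
  -- elements are zero.
  by_cases h0 : s * t = 0
  · rw [show φ.monomial R (s * t) = 0 by rw [h0, monomial_zero]]
    refine (congrArg _ (Subtype.ext ?_)).trans (map_zero _)
    change char R (ran (s * t)) = 0
    rw [h0, ran_zero, char_bot]
  · exact φ.idemDelta_congr R (φ.map_mul s t h0).symm rfl
      (by rw [← φ.map_mul s t h0]; exact φ.ran_mem_E _) (φ.ran_mem_E _)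

/-! ### The monomials span the skew ring. -/

/-- The span of the characteristic functions of the sets `V_x` with `x ∈ E_g`. -/
def charSpan (g : G) : Submodule R (TightFilter (Idem S) → R) :=
  Submodule.span R (char R '' φ.E g)

/-- The sets `O` such that restriction to `O` preserves the functions in `charSpan`. -/
def Restricts (g : G) (O : Set (TightFilter (Idem S))) : Prop :=
  ∀ f ∈ φ.charSpan R g, Set.indicator O (fun _ => 1) * f ∈ φ.charSpan R g

theorem restricts_V (g : G) (x : Idem S) : φ.Restricts R g (TightFilter.V x) := by
  intro f hf
  change char R x * f ∈ _
  induction hf using Submodule.span_induction with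
  | mem f hf =>
    obtain ⟨y, hy, rfl⟩ := hf
    rw [char_mul]
    exact Submodule.subset_span ⟨_, φ.mem_E_of_le hy inf_le_right, rfl⟩
  | zero => rw [mul_zero]; exact zero_mem _
  | add f f' _ _ h h' => rw [mul_add]; exact add_mem h h'
  | smul r f _ h => rw [mul_smul_comm]; exact Submodule.smul_mem _ r h

variable {R φ}

theorem Restricts.inter {g : G} {O O' : Set (TightFilter (Idem S))} (h : φ.Restricts R g O)
    (h' : φ.Restricts R g O') : φ.Restricts R g (O ∩ O') := by
  intro f hf
  have := h _ (h' f hf)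
  rwa [← mul_assoc, show Set.indicator O (fun _ => (1 : R)) * Set.indicator O' (fun _ => 1) =
    Set.indicator (O ∩ O') (fun _ => 1) by
      funext ξ; by_cases h1 : ξ ∈ O <;> by_cases h2 : ξ ∈ O' <;> simp [h1, h2]] at this

theorem Restricts.compl {g : G} {O : Set (TightFilter (Idem S))} (h : φ.Restricts R g O) :
    φ.Restricts R g Oᶜ := by
  intro f hf
  have := sub_mem hf (h f hf)
  convert this using 1
  funext ξ; by_cases h1 : ξ ∈ O <;> simp [h1]

theorem restricts_univ (g : G) : φ.Restricts R g Set.univ := by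
  intro f hf
  convert hf using 1
  funext ξ; simp

/-- Basic neighbourhoods in the topology induced from the product are finite intersections of sets
`V_x` and complements of such sets, and `Restricts` is stable under both operations. -/
theorem exists_restricts_mem_nhds (g : G) {ξ : TightFilter (Idem S)}
    {W : Set (TightFilter (Idem S))} (hW : W ∈ nhds ξ) :
    ∃ O, O ∈ nhds ξ ∧ O ⊆ W ∧ φ.Restricts R g O := by
  classical
  rw [nhds_induced, Filter.mem_comap] at hW
  obtain ⟨T, hT, hTW⟩ := hW
  rw [nhds_pi, Filter.mem_pi] at hT
  obtain ⟨I, hI, t, ht, hIT⟩ := hT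
  let O : Idem S → Set (TightFilter (Idem S)) := fun x =>
    if x ∈ ξ.carrier then TightFilter.V x else (TightFilter.V x)ᶜ
  have hO : ∀ x, φ.Restricts R g (O x) ∧ O x ∈ nhds ξ ∧
      ∀ η ∈ O x, TightFilter.indicator η x = TightFilter.indicator ξ x := by
    intro x
    by_cases hx : x ∈ ξ.carrier
    · simp only [O, hx, if_true]
      exact ⟨φ.restricts_V R g x, (TightFilter.isClopen_V x).isOpen.mem_nhds hx,
        fun η (hη : x ∈ η.carrier) => by simp [TightFilter.indicator, hx, hη]⟩
    · simp only [O, hx, if_false]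
      exact ⟨(φ.restricts_V R g x).compl,
        (TightFilter.isClopen_V x).isClosed.isOpen_compl.mem_nhds hx,
        fun η (hη : x ∉ η.carrier) => by simp [TightFilter.indicator, hx, hη]⟩
  refine ⟨⋂ x ∈ I, O x, (Filter.biInter_mem hI).2 fun x _ => (hO x).2.1, fun η hη => hTW (hIT ?_), ?_⟩
  · intro x hx
    rw [(hO x).2.2 η (Set.mem_iInter₂.1 hη x hx)]
    exact mem_of_mem_nhds (ht x)
  · clear ht hIT
    induction I, hI using Set.Finite.induction_on with
    | empty => simpa using restricts_univ g
    | insert _ _ ih =>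
      rw [Set.biInter_insert]
      exact (hO _).1.inter ih

/-- Near a point of its support, `f` is a scalar multiple of some `char R x` with `x ∈ E_g`.
Compactness of the support glues finitely many local pieces; carrying `Restricts` along makes the
gluing possible. -/
theorem mem_charSpan {g : G} {f : TightFilter (Idem S) → R} (hf : f ∈ φ.D R g) :
    f ∈ φ.charSpan R g := by
  obtain ⟨hl, hc, hU⟩ := hf
  have key : ∃ O, Function.support f ⊆ O ∧ φ.Restricts R g O ∧
      Set.indicator O (fun _ => 1) * f ∈ φ.charSpan R g := by
    refine hc.induction_on (p := fun s => ∃ O, s ⊆ O ∧ φ.Restricts R g O ∧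
      Set.indicator O (fun _ => 1) * f ∈ φ.charSpan R g) ?_ ?_ ?_ ?_
    · refine ⟨∅, subset_rfl, ?_, ?_⟩
      · have := (restricts_univ (R := R) (φ := φ) g).compl
        rwa [Set.compl_univ] at this
      · rw [Set.indicator_empty]
        change (0 : TightFilter (Idem S) → R) * f ∈ _
        rw [zero_mul]
        exact zero_mem _
    · rintro s t hst ⟨O, h1, h2, h3⟩
      exact ⟨O, hst.trans h1, h2, h3⟩
    · rintro s t ⟨O, h1, h2, h3⟩ ⟨O', h1', h2', h3'⟩
      refine ⟨O ∪ O', Set.union_subset_union h1 h1', ?_, ?_⟩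
      · have := (h2.compl.inter h2'.compl).compl
        rwa [Set.compl_inter, compl_compl, compl_compl] at this
      -- Inclusion–exclusion: `1_{O ∪ O'} f = 1_O f + 1_{O'} f - 1_O 1_{O'} f`, where `Restricts`
      -- for `O` controls the last term.
      · have := sub_mem (add_mem h3 h3') (h2 _ h3')
        convert this using 1
        funext ξ; by_cases h1 : ξ ∈ O <;> by_cases h2 : ξ ∈ O' <;> simp [h1, h2]
    · intro ξ hξ
      obtain ⟨x, hx, hxξ⟩ := hU hξ
      have hn : {η | f η = f ξ} ∈ nhds ξ := (IsLocallyConstant.iff_eventually_eq f).1 hl ξ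
      obtain ⟨O, hO, hOf, hOr⟩ := exists_restricts_mem_nhds (R := R) (φ := φ) g
        (Filter.inter_mem hn ((TightFilter.isClopen_V x).isOpen.mem_nhds hxξ))
      refine ⟨O, mem_nhdsWithin_of_mem_nhds hO, O, subset_rfl, hOr, ?_⟩
      have := hOr _ (Submodule.smul_mem _ (f ξ) (Submodule.subset_span ⟨x, hx, rfl⟩))
      convert this using 1
      funext η
      by_cases h1 : η ∈ O
      · have h2 : f η = f ξ := (hOf h1).1
        have h3 : char R x η = 1 := char_of_mem (hOf h1).2
        simp [h1, h2, h3]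
      · simp [h1]
  obtain ⟨O, h1, -, h3⟩ := key
  convert h3 using 1
  funext ξ
  by_cases h : ξ ∈ O
  · simp [h]
  · have : f ξ = 0 := by
      by_contra h'
      exact h (h1 h')
    simp [this]

variable (R φ)

/-- The elements `s s⁻¹ δ_{φ(s)}` span the partial skew group ring. -/
theorem span_monomial : Submodule.span R (Set.range (φ.monomial R)) = ⊤ := by
  classical
  rw [eq_top_iff]
  have h1 : ∀ (g : G) (f : TightFilter (Idem S) → R) (hf : f ∈ φ.D R g),
      φ.delta R g ⟨f, hf⟩ ∈ Submodule.span R (Set.range (φ.monomial R)) := by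
    intro g f hf
    have h2 := mem_charSpan hf
    have h3 : φ.charSpan R g ≤ φ.D R g := by
      refine Submodule.span_le.2 ?_
      rintro _ ⟨x, hx, rfl⟩
      exact φ.indicator_mem R hx
    have h4 : ∀ (f) (hf : f ∈ φ.charSpan R g), φ.delta R g ⟨f, h3 hf⟩ ∈
        Submodule.span R (Set.range (φ.monomial R)) := by
      intro f hf
      induction hf using Submodule.span_induction with
      | mem f hf =>
        obtain ⟨x, hx, rfl⟩ := hf
        obtain ⟨s, hs⟩ := φ.idemDelta_eq_monomial R hx
        exact Submodule.subset_span ⟨s, hs.symm⟩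
      | zero =>
        rw [show (⟨0, _⟩ : φ.D R g) = 0 from rfl, map_zero]
        exact zero_mem _
      | add f f' hf hf' h h' =>
        have := add_mem h h'
        rwa [← map_add] at this
      | smul r f hf h =>
        have := Submodule.smul_mem _ r h
        rwa [← map_smul] at this
    exact h4 f h2
  intro x _
  have hx : ∀ y : DirectSum G fun g => φ.D R g,
      (y : φ.SkewRing R) ∈ Submodule.span R (Set.range (φ.monomial R)) := by
    intro y
    induction y using DirectSum.induction_on with
    | zero => exact zero_mem _
    | of g a => exact h1 g a.1 a.2
    | add a b ha hb => exact add_mem ha hb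
  exact hx x

/-- The partial skew group ring is associative. -/
theorem skew_mul_assoc (x y z : φ.SkewRing R) : x * y * z = x * (y * z) := by
  -- By trilinearity it suffices to compare monomials, for which associativity is that of `S`.
  have hx : x ∈ Submodule.span R (Set.range (φ.monomial R)) := φ.span_monomial R ▸ Submodule.mem_top
  have hy : y ∈ Submodule.span R (Set.range (φ.monomial R)) := φ.span_monomial R ▸ Submodule.mem_top
  have hz : z ∈ Submodule.span R (Set.range (φ.monomial R)) := φ.span_monomial R ▸ Submodule.mem_top
  induction hx using Submodule.span_induction with
  | zero => simp only [zero_mul]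
  | add a b _ _ ha hb => simp only [add_mul, ha, hb]
  | smul r a _ ha => simp only [smul_mul_assoc, ha]
  | mem x hx =>
  obtain ⟨s, rfl⟩ := hx
  induction hy using Submodule.span_induction with
  | zero => simp only [zero_mul, mul_zero]
  | add a b _ _ ha hb => simp only [add_mul, mul_add, ha, hb]
  | smul r a _ ha => simp only [smul_mul_assoc, mul_smul_comm, ha]
  | mem y hy =>
  obtain ⟨t, rfl⟩ := hy
  induction hz using Submodule.span_induction with
  | zero => simp only [mul_zero]
  | add a b _ _ ha hb => simp only [mul_add, ha, hb]
  | smul r a _ ha => simp only [mul_smul_comm, ha]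
  | mem z hz =>
  obtain ⟨u, rfl⟩ := hz
  simp only [monomial_mul, mul_assoc]

/-- There is a linear map that reads off the coefficient at `g`. -/
theorem exists_coeff (g : G) : ∃ c : φ.SkewRing R →ₗ[R] (TightFilter (Idem S) → R),
    ∀ s, c (φ.monomial R s) = open Classical in if φ.toFun s = g then char R (ran s) else 0 := by
  classical
  refine ⟨φ.skewLift R fun g' => if g' = g then (φ.D R g').subtype else 0, fun s => ?_⟩
  refine (φ.skewLift_delta R _ _ _).trans ?_
  split_ifs <;> rfl


/-! ### Transfer of linear relations from monomials to tight maps. -/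

/-- Elements of equal degree agree where their ranges overlap: `s⁻¹ s'` is zero or has degree one,
so it is an idempotent, hence its own inverse, and `s⁻¹ s' = s'⁻¹ s`. -/
theorem mul_inv_mul_comm {s s' : S} (h : φ.toFun s = φ.toFun s') :
    s * s⁻¹ * s' = s' * s'⁻¹ * s := by
  by_cases h0 : s⁻¹ * s' = 0
  · have h1 : s'⁻¹ * s = 0 := by
      have := mul_inv_rev' s⁻¹ s'
      rw [h0, inv_inv', inv_of_idem (zero_mul (0 : S))] at this
      exact this.symm
    rw [mul_assoc, h0, mul_zero, mul_assoc, h1, mul_zero]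
  · have hs0 : s ≠ 0 := by
      rintro rfl
      exact h0 (by rw [inv_of_idem (zero_mul (0 : S)), zero_mul])
    have hf : (s⁻¹ * s') * (s⁻¹ * s') = s⁻¹ * s' := by
      refine φ.idem_of_eq_one _ h0 ?_
      rw [φ.map_mul _ _ h0, φ.map_inv hs0, h, inv_mul_cancel]
    have hf' : s⁻¹ * s' = s'⁻¹ * s := by
      have := mul_inv_rev' s⁻¹ s'
      rwa [inv_of_idem hf, inv_inv'] at this
    calc s * s⁻¹ * s' = s * (s⁻¹ * s') := mul_assoc _ _ _
      _ = s * ((s⁻¹ * s') * (s'⁻¹ * s)) := by rw [← hf', hf]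
      _ = (s * s⁻¹) * (s' * s'⁻¹) * s := by simp only [mul_assoc]
      _ = (s' * s'⁻¹) * (s * s⁻¹) * s := by rw [idem_comm _ _ (mul_inv_idem s) (mul_inv_idem s')]
      _ = s' * s'⁻¹ * (s * s⁻¹ * s) := by simp only [mul_assoc]
      _ = s' * s'⁻¹ * s := by rw [mul_inv_mul]

variable {𝓔 : Type*} [Ring 𝓔] [Algebra R 𝓔]

/-- A multiplicative map `t` is tight if an element that annihilates `t z` for all `z` in a finite
cover of `x` also annihilates `t x`. -/
def _root_.IsTight (t : S → 𝓔) : Prop :=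
  ∀ (x : Idem S) (Z : Finset (Idem S)), Covers Z x →
    ∀ e : 𝓔, (∀ z ∈ Z, e * t z.1 = 0) → e * t x.1 = 0

variable {R} {t : S → 𝓔}

/-- If every tight filter through `x` met `Z`, then `Z` would cover `x`, since each nonzero `y ≤ x`
lies in a tight filter; tightness of `t` would then give `e * t x = 0`. -/
theorem exists_tightFilter_of_tight (ht : IsTight t) {x : Idem S} {Z : Finset (Idem S)} {e : 𝓔}
    (hZ : ∀ z ∈ Z, e * t z.1 = 0) (hx : e * t x.1 ≠ 0) :
    ∃ ξ : TightFilter (Idem S), x ∈ ξ.carrier ∧ ∀ z ∈ Z, z ∉ ξ.carrier := by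
  by_contra! hcon
  refine hx (ht x Z (fun y hy hy0 => ?_) e hZ)
  by_contra! h
  obtain ⟨ξ, hξ⟩ := TightFilter.exists_mem y hy0
  obtain ⟨z, hz, hzξ⟩ := hcon ξ (ξ.mem_of_le hξ hy)
  exact ξ.bot_notMem (h z hz ▸ ξ.inf_mem hzξ hξ)


end StrongGrading

namespace StrongGrading

open InverseSemigroupWithZero

variable {S G : Type*} [InverseSemigroupWithZero S] [Group G] (φ : StrongGrading S G)
variable {R : Type*} [CommRing R] {𝓔 : Type*} [Ring 𝓔] [Algebra R 𝓔] {t : S → 𝓔}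

/-- The element `e` plays the role of the characteristic function of a cell, the tight filters that
contain `z` and avoid `W`. Induction on `F` splits the cell along `ran a`. Inside `ran a` the
element `a` acts as `s`, so `c a` is added to the coefficient `r`; outside, `a` is annihilated and
`ran a` joins `W`. When `F` is exhausted, either `e = 0` or the cell contains a tight filter, at
which `hc` reads `r = 0`. -/
theorem mul_sum_eq_zero_of_le_ran (hm : ∀ a b, t (a * b) = t a * t b) (ht : IsTight t)
    (F : Finset S) (c : S → R) (s : S) (hF : ∀ i ∈ F, φ.toFun i = φ.toFun s) (r : R)
    (z : Idem S) (hz : z ≤ ran s) (W : Finset (Idem S)) (e : 𝓔) (hez : e * t z.1 = e)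
    (heW : ∀ w ∈ W, e * t w.1 = 0)
    (hc : ∀ ξ : TightFilter (Idem S), z ∈ ξ.carrier → (∀ w ∈ W, w ∉ ξ.carrier) →
      r + ∑ i ∈ F, c i * char R (ran i) ξ = 0) :
    e * (r • t s + ∑ i ∈ F, c i • t i) = 0 := by
  classical
  induction F using Finset.induction_on generalizing r z W e with
  | empty =>
    by_contra h
    have he : e * t z.1 ≠ 0 := by
      rw [hez]; rintro rfl; exact h (zero_mul _)
    obtain ⟨ξ, hξ, hW⟩ := exists_tightFilter_of_tight ht heW he
    have hr : r = 0 := by simpa using hc ξ hξ hW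
    exact h (by simp [hr])
  | insert a F ha ih =>
    have hcm : ∀ w : Idem S, t (ran a).1 * t w.1 = t w.1 * t (ran a).1 := fun w => by
      rw [← hm, ← hm, idem_comm _ _ (ran a).2 w.2]
    have hxx : t (ran a).1 * t (ran a).1 = t (ran a).1 := by rw [← hm, (ran a).2]
    -- Since `e` absorbs `t z` and `z ≤ ran s`, it absorbs `t (ran s)`; and `s s⁻¹ a = a a⁻¹ s`
    -- because the degrees agree.
    have hea : e * t a = e * t (ran a).1 * t s := by
      have h1 : t z.1 * t (ran s).1 = t z.1 := by rw [← hm, Idem.le_def.1 hz]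
      have h2 : t (ran s).1 * t a = t (ran a).1 * t s := by
        rw [← hm, ← hm]
        exact congrArg t (φ.mul_inv_mul_comm (hF a (Finset.mem_insert_self a F)).symm)
      calc e * t a = e * (t z.1 * t (ran s).1) * t a := by rw [h1, hez]
        _ = e * t z.1 * (t (ran s).1 * t a) := by simp only [mul_assoc]
        _ = _ := by rw [h2, hez, mul_assoc]
    have hF' : ∀ i ∈ F, φ.toFun i = φ.toFun s := fun i hi => hF i (Finset.mem_insert_of_mem hi)
    have e1 := ih hF' (r + c a) (z ⊓ ran a) (inf_le_left.trans hz) W (e * t (ran a).1)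
      (by rw [Idem.inf_val, hm, ← mul_assoc, mul_assoc e, hcm, ← mul_assoc, hez, mul_assoc, hxx])
      (fun w hw => by rw [mul_assoc, hcm, ← mul_assoc, heW w hw, zero_mul])
      (fun ξ hξ hW => by
        have h1 := hc ξ (TightFilter.inf_mem_iff.1 hξ).1 hW
        rw [Finset.sum_insert ha, char_of_mem (TightFilter.inf_mem_iff.1 hξ).2, mul_one,
          ← add_assoc] at h1
        exact h1)
    have e2 := ih hF' r z hz (insert (ran a) W) (e - e * t (ran a).1)
      (by rw [sub_mul, hez, mul_assoc, hcm, ← mul_assoc, hez])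
      (fun w hw => by
        rcases Finset.mem_insert.1 hw with rfl | hw
        · rw [sub_mul, mul_assoc, hxx, sub_self]
        · rw [sub_mul, mul_assoc, hcm, ← mul_assoc, heW w hw, zero_mul, sub_zero])
      (fun ξ hξ hW => by
        have h1 := hc ξ hξ fun w hw => hW w (Finset.mem_insert_of_mem hw)
        rw [Finset.sum_insert ha, char_of_notMem (hW _ (Finset.mem_insert_self _ _)), mul_zero,
          zero_add] at h1
        exact h1)
    rw [Finset.sum_insert ha]
    -- The two parts `e * t (ran a)` and `e - e * t (ran a)` add up to `e`.
    rw [← add_zero (0 : 𝓔)]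
    nth_rewrite 1 [← e1]
    rw [← e2]
    simp only [mul_add, sub_mul, add_smul, mul_smul_comm, smul_sub, hea]
    abel

/-- No reference element `s` is available at the start. On the part of `e` inside `ran a`, the
element `a` itself serves as one, with coefficient `c a`, and the preceding lemma applies; on the
rest, `ran a` joins `W` and the induction goes on. -/
theorem mul_sum_eq_zero (hm : ∀ a b, t (a * b) = t a * t b) (ht : IsTight t)
    (F : Finset S) (c : S → R) (g : G) (hF : ∀ i ∈ F, φ.toFun i = g)
    (W : Finset (Idem S)) (e : 𝓔) (heW : ∀ w ∈ W, e * t w.1 = 0)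
    (hc : ∀ ξ : TightFilter (Idem S), (∀ w ∈ W, w ∉ ξ.carrier) →
      ∑ i ∈ F, c i * char R (ran i) ξ = 0) :
    e * ∑ i ∈ F, c i • t i = 0 := by
  classical
  induction F using Finset.induction_on generalizing W e with
  | empty => simp
  | insert a F ha ih =>
    have hcm : ∀ w : Idem S, t (ran a).1 * t w.1 = t w.1 * t (ran a).1 := fun w => by
      rw [← hm, ← hm, idem_comm _ _ (ran a).2 w.2]
    have hxx : t (ran a).1 * t (ran a).1 = t (ran a).1 := by rw [← hm, (ran a).2]
    have hxa : t (ran a).1 * t a = t a := by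
      rw [← hm]; exact congrArg t (mul_inv_mul a)
    have hF' : ∀ i ∈ F, φ.toFun i = g := fun i hi => hF i (Finset.mem_insert_of_mem hi)
    have e1 := φ.mul_sum_eq_zero_of_le_ran hm ht F c a
      (fun i hi => (hF' i hi).trans (hF a (Finset.mem_insert_self a F)).symm) (c a) (ran a) le_rfl W
      (e * t (ran a).1) (by rw [mul_assoc, hxx])
      (fun w hw => by rw [mul_assoc, hcm, ← mul_assoc, heW w hw, zero_mul])
      (fun ξ hξ hW => by
        have h1 := hc ξ hW
        rwa [Finset.sum_insert ha, char_of_mem hξ, mul_one] at h1)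
    have e2 := ih hF' (insert (ran a) W) (e - e * t (ran a).1)
      (fun w hw => by
        rcases Finset.mem_insert.1 hw with rfl | hw
        · rw [sub_mul, mul_assoc, hxx, sub_self]
        · rw [sub_mul, mul_assoc, hcm, ← mul_assoc, heW w hw, zero_mul, sub_zero])
      (fun ξ hW => by
        have h1 := hc ξ fun w hw => hW w (Finset.mem_insert_of_mem hw)
        rwa [Finset.sum_insert ha, char_of_notMem (hW _ (Finset.mem_insert_self _ _)), mul_zero,
          zero_add] at h1)
    rw [Finset.sum_insert ha, ← add_zero (0 : 𝓔)]
    nth_rewrite 1 [← e1]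
    rw [← e2]
    simp only [mul_add, sub_mul, mul_smul_comm, mul_assoc, hxa]
    abel

/-- A linear relation between the elements `s s⁻¹ δ_{φ(s)}` of the partial skew group ring holds
for every tight multiplicative map. -/
theorem sum_eq_zero_of_sum_monomial_eq_zero (hm : ∀ a b, t (a * b) = t a * t b) (ht : IsTight t)
    (c : S →₀ R) (hc : Finsupp.linearCombination R (φ.monomial R) c = 0) :
    Finsupp.linearCombination R t c = 0 := by
  classical
  rw [Finsupp.linearCombination_apply, Finsupp.sum] at hc ⊢
  rw [← Finset.sum_fiberwise_of_maps_to (t := c.support.image φ.toFun)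
    fun s hs => Finset.mem_image_of_mem _ hs]
  refine Finset.sum_eq_zero fun g _ => ?_
  -- Each degree is treated separately: the coefficient at `g` is a function on tight filters that
  -- vanishes identically. The initial cell is the whole space, with `e = 1` and `W = ∅`, which is
  -- where the unit of `𝓔` enters.
  obtain ⟨f, hf⟩ := φ.exists_coeff R g
  have h := φ.mul_sum_eq_zero hm ht (c.support.filter fun s => φ.toFun s = g) c g
    (fun i hi => (Finset.mem_filter.1 hi).2) ∅ 1 (by simp) fun ξ _ => ?_
  · rwa [one_mul] at h
  · have h1 := congrFun (congrArg f hc) ξ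
    rw [map_sum, map_zero, Finset.sum_apply] at h1
    rw [Finset.sum_filter]
    refine Eq.trans (Finset.sum_congr rfl fun s _ => ?_) h1
    rw [map_smul, hf]
    split_ifs <;> simp

end StrongGrading

/-! ### Conjugation of covers, and the idempotents `(α, A, α)`. -/

namespace StrongGrading

open InverseSemigroupWithZero

variable {S : Type*} [InverseSemigroupWithZero S]

-- Conjugation by `u` is an order isomorphism from the idempotents below `src u` onto those below
-- `ran u`, inverted by conjugation by `u⁻¹`. Members of `Z` outside `src u` do no harm, as
-- conjugation sees only their meet with `src u`.
open Classical in
theorem covers_image_conj {u : S} {Z : Finset (Idem S)} (hZ : Covers Z (src u)) :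
    Covers (Z.image (conj u)) (ran u) := by
  intro y hy hy0
  have hback : conj u (conj u⁻¹ y) = y := by rw [conj_conj_inv, inf_eq_right.2 hy]
  have hle : conj u⁻¹ y ≤ src u := by
    have := conj_le_ran u⁻¹ y
    rwa [ran_inv] at this
  obtain ⟨z, hz, h⟩ := hZ (conj u⁻¹ y) hle fun h => hy0 (by rw [← hback, h, conj_bot])
  refine ⟨_, Finset.mem_image_of_mem _ hz, fun h' => h ?_⟩
  have h2 := congrArg (conj u⁻¹) h'
  rwa [conj_inf, conj_inv_conj, conj_bot, inf_comm (src u), inf_assoc, inf_eq_right.2 hle] at h2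

end StrongGrading

namespace GenBoolDynSystem

open InverseSemigroupWithZero

variable {B L : Type*} [GeneralizedBooleanAlgebra B] {𝒟 : GenBoolDynSystem B L}

variable (𝒟) in
theorem mem_Iw_nil (A : B) : A ∈ 𝒟.Iw [] := trivial

theorem idem_ne_bot_iff {α : List L} {A : B} {hA : A ∈ 𝒟.Iw α} :
    𝒟.idem α A hA ≠ ⊥ ↔ A ≠ ⊥ := by
  rw [Idem.ne_bot_iff]
  change InvSgp.mk α A α hA hA ≠ 0 ↔ _
  constructor
  · rintro h rfl
    exact h (InvSgp.mk_bot _ _)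
  · intro h h'
    rw [InvSgp.mk_of_ne h] at h'
    cases h'

theorem idem_congr {α α' : List L} {A A' : B} (h : α = α') (h' : A = A') (hA : A ∈ 𝒟.Iw α)
    (hA' : A' ∈ 𝒟.Iw α') : 𝒟.idem α A hA = 𝒟.idem α' A' hA' := by
  subst h; subst h'; rfl

theorem exists_eq_idem (x : Idem 𝒟.InvSgp) : x = ⊥ ∨ ∃ α A hA, x = 𝒟.idem α A hA := by
  rcases InvSgp.exists_of_idem x.2 with h | ⟨α, A, hA, h⟩
  · exact Or.inl (Idem.ext h)
  · exact Or.inr ⟨α, A, hA, Idem.ext h⟩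

theorem idem_append_inf {α γ : List L} {A C : B} (hA : A ∈ 𝒟.Iw α) (hC : C ∈ 𝒟.Iw (α ++ γ)) :
    𝒟.idem (α ++ γ) C hC ⊓ 𝒟.idem α A hA =
      𝒟.idem (α ++ γ) (C ⊓ 𝒟.θw γ A) (InvSgp.inf_mem_left hC _) :=
  Idem.ext (InvSgp.mk_mul_right _ _ _ _)

theorem idem_inf_idem {α : List L} {A C : B} (hA : A ∈ 𝒟.Iw α) (hC : C ∈ 𝒟.Iw α) :
    𝒟.idem α A hA ⊓ 𝒟.idem α C hC = 𝒟.idem α (A ⊓ C) (InvSgp.inf_mem_left hA _) :=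
  Idem.ext (InvSgp.mk_mul_same _ _ _ _)

theorem idem_inf_nil {α : List L} {A C : B} (hC : C ∈ 𝒟.Iw α) :
    𝒟.idem α C hC ⊓ 𝒟.idem [] A (𝒟.mem_Iw_nil _) =
      𝒟.idem α (C ⊓ 𝒟.θw α A) (InvSgp.inf_mem_left hC _) :=
  idem_append_inf (α := []) (𝒟.mem_Iw_nil _) hC

theorem le_θw_of_idem_le {α : List L} {A C : B} {hC : C ∈ 𝒟.Iw α}
    (h : 𝒟.idem α C hC ≤ 𝒟.idem [] A (𝒟.mem_Iw_nil _)) : C ≤ 𝒟.θw α A := by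
  rw [← inf_eq_left, idem_inf_nil] at h
  have h1 : InvSgp.mk α _ α _ _ = InvSgp.mk α C α hC hC := congrArg Idem.val h
  by_cases hC0 : C = ⊥
  · rw [hC0]; exact bot_le
  rw [InvSgp.mk_of_ne hC0] at h1
  by_cases h0 : C ⊓ 𝒟.θw α A = ⊥
  · rw [InvSgp.mk_of_eq_bot h0] at h1; cases h1
  · rw [InvSgp.mk_of_ne h0] at h1
    injection h1 with _ h2
    exact inf_eq_left.1 h2

theorem idem_θ_le (a : L) (A : B) :
    𝒟.idem [a] (𝒟.θ a A) (𝒟.mem_Iw_singleton (𝒟.θ_mem_I a A)) ≤ 𝒟.idem [] A (𝒟.mem_Iw_nil _) := by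
  rw [← inf_eq_left, idem_inf_nil]
  exact idem_congr rfl (inf_idem _) _ _

theorem idem_nil_mono {A C : B} (h : A ≤ C) : 𝒟.idem [] A (𝒟.mem_Iw_nil _) ≤ 𝒟.idem [] C (𝒟.mem_Iw_nil _) := by
  rw [← inf_eq_left, idem_inf_idem]
  exact idem_congr rfl (inf_eq_left.2 h) _ _

theorem head_eq_of_inf_ne_bot {a b : L} {α β : List L} {A C : B} {hA : A ∈ 𝒟.Iw (a :: α)}
    {hC : C ∈ 𝒟.Iw (b :: β)} (h : 𝒟.idem (a :: α) A hA ⊓ 𝒟.idem (b :: β) C hC ≠ ⊥) : a = b := by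
  by_contra hab
  refine h (Idem.ext (InvSgp.mk_mul_none _ _ _ _ ?_ ?_))
  · rw [List.cons_prefix_cons]; exact fun h => hab h.1
  · rw [List.cons_prefix_cons]; exact fun h => hab h.1.symm

/-- The first letter of a triple `(α, A, β)` with `α` nonempty. -/
def InvSgp.head : 𝒟.InvSgp → Option L
  | .zero => none
  | .triple α _ _ _ _ _ => α.head?

/-- The words of the idempotents in a finite set have bounded length. -/
theorem exists_length_bound (Z : Finset (Idem 𝒟.InvSgp)) :
    ∃ n, ∀ z ∈ Z, z = ⊥ ∨ ∃ α A hA, z = 𝒟.idem α A hA ∧ α.length < n := by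
  have h : ∀ z : Idem 𝒟.InvSgp, ∃ n, z = ⊥ ∨ ∃ α A hA, z = 𝒟.idem α A hA ∧ α.length < n := by
    intro z
    rcases exists_eq_idem z with h | ⟨α, A, hA, h⟩
    · exact ⟨0, Or.inl h⟩
    · exact ⟨_, Or.inr ⟨α, A, hA, h, Nat.lt_succ_self _⟩⟩
  choose f hf using h
  refine ⟨Z.sup f, fun z hz => (hf z).imp_right ?_⟩
  rintro ⟨α, A, hA, h, hl⟩
  exact ⟨α, A, hA, h, hl.trans_le (Finset.le_sup (f := f) hz)⟩

/-- The element `(ω, A, α)`. -/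
noncomputable def coIsometry (α : List L) (A : B) (hA : A ∈ 𝒟.Iw α) : 𝒟.InvSgp :=
  InvSgp.mk [] A α (𝒟.mem_Iw_nil _) hA

theorem ran_coIsometry {α : List L} {A : B} (hA : A ∈ 𝒟.Iw α) :
    ran (coIsometry α A hA) = 𝒟.idem [] A (𝒟.mem_Iw_nil _) := Idem.ext <| by
  change InvSgp.mk [] A α (𝒟.mem_Iw_nil _) hA * (InvSgp.mk [] A α (𝒟.mem_Iw_nil _) hA)⁻¹ = InvSgp.mk _ _ _ _ _
  rw [InvSgp.inv_mk, InvSgp.mk_mul_same]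
  exact InvSgp.mk_congr rfl (inf_idem _) rfl

theorem src_coIsometry {α : List L} {A : B} (hA : A ∈ 𝒟.Iw α) :
    src (coIsometry α A hA) = 𝒟.idem α A hA := Idem.ext <| by
  change (InvSgp.mk [] A α (𝒟.mem_Iw_nil _) hA)⁻¹ * InvSgp.mk [] A α (𝒟.mem_Iw_nil _) hA = InvSgp.mk _ _ _ _ _
  rw [InvSgp.inv_mk, InvSgp.mk_mul_same]
  exact InvSgp.mk_congr rfl (inf_idem _) rfl

/-- Conjugation by `(ω, A, a)` strips the leading letter `a`. Only the shorter word matters later,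
so the middle entry is left existential. -/
theorem conj_coIsometry {a : L} {γ : List L} {A C : B} (hA : A ∈ 𝒟.Iw [a])
    (hC : C ∈ 𝒟.Iw (a :: γ)) :
    ∃ E hE, conj (coIsometry [a] A hA) (𝒟.idem (a :: γ) C hC) = 𝒟.idem γ E hE := by
  refine ⟨𝒟.θw γ A ⊓ C ⊓ 𝒟.θw γ A, InvSgp.inf_mem_right (𝒟.Iw_append (α := []) (𝒟.mem_Iw_nil _) γ) _,
    Idem.ext ?_⟩
  change InvSgp.mk [] A [a] (𝒟.mem_Iw_nil _) hA * InvSgp.mk ([a] ++ γ) C (a :: γ) hC hC *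
    (InvSgp.mk [] A [a] (𝒟.mem_Iw_nil _) hA)⁻¹ = InvSgp.mk _ _ _ _ _
  rw [InvSgp.inv_mk, InvSgp.mk_mul_left]
  exact InvSgp.mk_mul_right (γ := [a]) _ _ _ _

/-! ### The relations for joins and regular elements imply tightness. -/

variable {𝓔 : Type*} [Ring 𝓔]

/-- A multiplicative map on the inverse semigroup of the system that satisfies the relations
for joins and for regular elements. -/
structure IsCuntzKrieger (t : 𝒟.InvSgp → 𝓔) : Prop where
  map_mul : ∀ x y, t (x * y) = t x * t y
  map_zero : t 0 = 0
  map_sup : ∀ A C : B, t (𝒟.idem [] (A ⊔ C) (𝒟.mem_Iw_nil _)).1 = t (𝒟.idem [] A (𝒟.mem_Iw_nil _)).1 +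
    t (𝒟.idem [] C (𝒟.mem_Iw_nil _)).1 - t (𝒟.idem [] (A ⊓ C) (𝒟.mem_Iw_nil _)).1
  map_reg : ∀ (A : B) (hA : A ∈ 𝒟.Reg), t (𝒟.idem [] A (𝒟.mem_Iw_nil _)).1 =
    ∑ a ∈ (𝒟.Δ_finite_of_reg hA).toFinset,
      t (𝒟.idem [a] (𝒟.θ a A) (𝒟.mem_Iw_singleton (𝒟.θ_mem_I a A))).1

namespace IsCuntzKrieger

variable {t : 𝒟.InvSgp → 𝓔} (ht : IsCuntzKrieger t)
include ht

theorem map_inf (x y : Idem 𝒟.InvSgp) : t (x ⊓ y).1 = t x.1 * t y.1 := ht.map_mul _ _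

theorem map_comm (x y : Idem 𝒟.InvSgp) : t x.1 * t y.1 = t y.1 * t x.1 := by
  rw [← ht.map_inf, ← ht.map_inf, inf_comm]

/-- Since `u⁻¹ u = u⁻¹ (u u⁻¹) u`, an annihilation problem at `src u` moves to `ran u`, with `e * t
u⁻¹` in place of `e`. The next lemma moves the hypotheses on the cover in the same way. -/
theorem mul_map_src_eq_zero {u : 𝒟.InvSgp} {e : 𝓔} (h : e * t u⁻¹ * t (ran u).1 = 0) :
    e * t (src u).1 = 0 := by
  have h1 : t (src u).1 = t u⁻¹ * t (ran u).1 * t u := by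
    rw [← ht.map_mul, ← ht.map_mul]
    change t (u⁻¹ * u) = t (u⁻¹ * (u * u⁻¹) * u)
    rw [← mul_assoc, inv_mul_inv]
  rw [h1, ← mul_assoc, ← mul_assoc, h, zero_mul]

/-- Commuting idempotents gives `u⁻¹ (u z u⁻¹) = z (u⁻¹ u) u⁻¹`, which begins with the annihilated
`z`. -/
theorem mul_map_conj_eq_zero {u : 𝒟.InvSgp} {e : 𝓔} {z : Idem 𝒟.InvSgp} (h : e * t z.1 = 0) :
    e * t u⁻¹ * t (conj u z).1 = 0 := by
  rw [mul_assoc, ← ht.map_mul]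
  change e * t (u⁻¹ * (u * z.1 * u⁻¹)) = 0
  rw [show u⁻¹ * (u * z.1 * u⁻¹) = (u⁻¹ * u) * z.1 * u⁻¹ by simp only [mul_assoc],
    idem_comm _ _ (inv_mul_idem u) z.2, mul_assoc, ht.map_mul, ← mul_assoc, h, zero_mul]

/-- The witness is the join of the middle entries of the members of `Z` with empty word; `map_sup`
shows that a join of two annihilated elements is annihilated. -/
theorem exists_le_of_nil (Z : Finset (Idem 𝒟.InvSgp)) (e : 𝓔) (he : ∀ z ∈ Z, e * t z.1 = 0) :
    ∃ A : B, e * t (𝒟.idem [] A (𝒟.mem_Iw_nil _)).1 = 0 ∧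
      ∀ C : B, 𝒟.idem [] C (𝒟.mem_Iw_nil _) ∈ Z → 𝒟.idem [] C (𝒟.mem_Iw_nil _) ≤ 𝒟.idem [] A (𝒟.mem_Iw_nil _) := by
  classical
  induction Z using Finset.induction_on with
  | empty =>
    refine ⟨⊥, ?_, by simp⟩
    rw [show (𝒟.idem [] ⊥ (𝒟.mem_Iw_nil _)).1 = 0 from InvSgp.mk_bot _ _, ht.map_zero, mul_zero]
  | insert z Z hz ih =>
    obtain ⟨A, hA, h⟩ := ih fun z hz => he z (Finset.mem_insert_of_mem hz)
    by_cases hC : ∃ C, z = 𝒟.idem [] C (𝒟.mem_Iw_nil _)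
    · obtain ⟨C, rfl⟩ := hC
      refine ⟨A ⊔ C, ?_, fun C' hC' => ?_⟩
      · rw [ht.map_sup, ← idem_inf_idem (𝒟.mem_Iw_nil A) (𝒟.mem_Iw_nil C), ht.map_inf, mul_sub, mul_add, ← mul_assoc, hA,
          he _ (Finset.mem_insert_self _ _), zero_mul, add_zero, sub_zero]
      · rcases Finset.mem_insert.1 hC' with h1 | h1
        · rw [h1]; exact idem_nil_mono le_sup_right
        · exact (h C' h1).trans (idem_nil_mono le_sup_left)
    · refine ⟨A, hA, fun C' hC' => ?_⟩
      rcases Finset.mem_insert.1 hC' with h1 | h1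
      · exact absurd ⟨C', h1.symm⟩ hC
      · exact h C' h1

/-- `A` is the disjoint union of `A ⊓ A₀` and `A \ A₀`, and `e` annihilates the first part. -/
theorem mul_map_sdiff {A A₀ : B} {e : 𝓔} (h : e * t (𝒟.idem [] A₀ (𝒟.mem_Iw_nil _)).1 = 0) :
    e * t (𝒟.idem [] A (𝒟.mem_Iw_nil _)).1 = e * t (𝒟.idem [] (A \ A₀) (𝒟.mem_Iw_nil _)).1 := by
  have h1 := ht.map_sup (A ⊓ A₀) (A \ A₀)
  rw [show (𝒟.idem [] (A ⊓ A₀ ⊓ A \ A₀) (𝒟.mem_Iw_nil _)).1 = 0 from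
    InvSgp.mk_of_eq_bot (inf_inf_sdiff _ _), ht.map_zero, sub_zero] at h1
  rw [show (𝒟.idem [] (A ⊓ A₀ ⊔ A \ A₀) (𝒟.mem_Iw_nil _)) = 𝒟.idem [] A (𝒟.mem_Iw_nil _) from
    idem_congr rfl (sup_inf_sdiff A A₀) _ _] at h1
  rw [h1, ← idem_inf_idem (C := A₀) (𝒟.mem_Iw_nil _) (𝒟.mem_Iw_nil _), ht.map_inf, ht.map_comm, mul_add, ← mul_assoc,
    h, zero_mul, zero_add]

omit ht in
/-- If all nonzero elements below `(ω, A, ω)` meet an element of the finite set `Z` whose word is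
not empty, then `A` is regular. -/
theorem reg_of_covers {A : B} {Z : Finset (Idem 𝒟.InvSgp)}
    (h : ∀ y ≤ 𝒟.idem [] A (𝒟.mem_Iw_nil _), y ≠ ⊥ →
      ∃ a γ C hC, 𝒟.idem (a :: γ) C hC ∈ Z ∧ 𝒟.idem (a :: γ) C hC ⊓ y ≠ ⊥) : A ∈ 𝒟.Reg := by
  intro C hCA hC
  constructor
  · obtain ⟨a, γ, D, hD, -, h1⟩ := h _ (idem_nil_mono hCA) (idem_ne_bot_iff.2 hC)
    refine ⟨a, fun h2 => ?_⟩
    rw [idem_inf_nil, idem_ne_bot_iff, θw, h2, θw_bot, inf_bot_eq] at h1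
    exact h1 rfl
  -- For `a ∈ Δ_C` the nonzero element `(a, θ_a(C), a)` lies below `(ω, A, ω)`, so it meets a member
  -- of `Z`, whose word must begin with `a`. Hence `Δ_C` is contained in the finite set of first
  -- letters occurring in `Z`.
  · have hfin : {a : L | some a ∈ (fun z : Idem 𝒟.InvSgp => z.1.head) '' (Z : Set _)}.Finite :=
      (Z.finite_toSet.image _).preimage (Option.some_injective L).injOn
    refine hfin.subset fun a ha => ?_
    obtain ⟨b, γ, D, hD, hZ, h1⟩ := h _ ((idem_θ_le a C).trans (idem_nil_mono hCA))
      (idem_ne_bot_iff.2 ha)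
    obtain rfl := head_eq_of_inf_ne_bot h1
    refine ⟨_, hZ, ?_⟩
    have hD0 : D ≠ ⊥ := by
      rintro rfl
      exact h1 (le_bot_iff.1 (inf_le_left.trans (not_ne_iff.1 fun h2 => idem_ne_bot_iff.1 h2 rfl).le))
    change (InvSgp.mk (b :: γ) D (b :: γ) hD hD).head = some b
    rw [InvSgp.mk_of_ne hD0]
    rfl

/-- Induction on a strict bound `n` for the word lengths in `Z`. Removing the annihilated part `A₀`
leaves an element covered by nonempty words, hence regular; each of its letters then gives the same
problem with words shorter by one. -/
theorem mul_map_nil_eq_zero (n : ℕ) (A : B) (Z : Finset (Idem 𝒟.InvSgp))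
    (hn : ∀ z ∈ Z, z = ⊥ ∨ ∃ α C hC, z = 𝒟.idem α C hC ∧ α.length < n)
    (hZ : Covers Z (𝒟.idem [] A (𝒟.mem_Iw_nil _))) (e : 𝓔) (he : ∀ z ∈ Z, e * t z.1 = 0) :
    e * t (𝒟.idem [] A (𝒟.mem_Iw_nil _)).1 = 0 := by
  classical
  induction n generalizing A Z e with
  | zero =>
    -- No word has length below `0`, so `Z` contains at most `⊥` and covers only `⊥`.
    by_cases hA : A = ⊥
    · rw [show (𝒟.idem [] A (𝒟.mem_Iw_nil _)).1 = 0 from InvSgp.mk_of_eq_bot hA, ht.map_zero, mul_zero]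
    · obtain ⟨z, hz, hzA⟩ := hZ _ le_rfl (idem_ne_bot_iff.2 hA)
      rcases hn z hz with rfl | ⟨_, _, _, _, h⟩
      · exact absurd (bot_inf_eq _) hzA
      · exact absurd h (Nat.not_lt_zero _)
  | succ n ih =>
    obtain ⟨A₀, hA₀, hle⟩ := ht.exists_le_of_nil Z e he
    rw [ht.mul_map_sdiff hA₀]
    have hcov : ∀ y ≤ 𝒟.idem [] (A \ A₀) (𝒟.mem_Iw_nil _), y ≠ ⊥ →
        ∃ a γ C hC, 𝒟.idem (a :: γ) C hC ∈ Z ∧ 𝒟.idem (a :: γ) C hC ⊓ y ≠ ⊥ := by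
      intro y hy hy0
      obtain ⟨z, hz, hzy⟩ := hZ y (hy.trans (idem_nil_mono sdiff_le)) hy0
      rcases exists_eq_idem z with rfl | ⟨α, C, hC, rfl⟩
      · exact absurd (bot_inf_eq _) hzy
      cases α with
      | nil =>
        refine absurd (le_bot_iff.1 ((inf_le_inf (hle C hz) hy).trans ?_)) hzy
        rw [idem_inf_idem]
        exact (not_ne_iff.1 fun h2 => idem_ne_bot_iff.1 h2 inf_sdiff_self_right).le
      | cons a γ => exact ⟨a, γ, C, hC, hz, hzy⟩
    rw [ht.map_reg _ (reg_of_covers hcov), Finset.mul_sum]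
    refine Finset.sum_eq_zero fun a _ => ?_
    rw [← src_coIsometry]
    refine ht.mul_map_src_eq_zero ?_
    rw [ran_coIsometry]
    -- Members of `Z` whose word does not begin with `a` are orthogonal to everything below `(a,
    -- θ_a(A \ A₀), a)`, so they may be dropped before conjugating.
    refine ih _ ((Z.filter fun z => ∃ γ C hC, z = 𝒟.idem (a :: γ) C hC).image
      (conj (coIsometry [a] _ (𝒟.mem_Iw_singleton (𝒟.θ_mem_I a (A \ A₀)))))) ?_ ?_ _ ?_
    · intro z' hz'
      obtain ⟨z, hz, rfl⟩ := Finset.mem_image.1 hz'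
      obtain ⟨hz, γ, C, hC, rfl⟩ := Finset.mem_filter.1 hz
      rcases hn _ hz with h | ⟨α, C', hC', h, hα⟩
      · exact Or.inl (by rw [h, StrongGrading.conj_bot])
      · by_cases h0 : 𝒟.idem (a :: γ) C hC = ⊥
        · exact Or.inl (by rw [h0, StrongGrading.conj_bot])
        · obtain ⟨E, hE, h1⟩ := conj_coIsometry
            (𝒟.mem_Iw_singleton (𝒟.θ_mem_I a (A \ A₀))) hC
          refine Or.inr ⟨γ, E, hE, h1, ?_⟩
          -- A nonzero idempotent determines its triple, so the word `α` bounded by `hn` is `a :: γ`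
          -- and `γ` has length less than `n`.
          have hC0 := idem_ne_bot_iff.1 h0
          rw [h] at h0
          have hC0' := idem_ne_bot_iff.1 h0
          have h2 : InvSgp.mk _ _ _ _ _ = InvSgp.mk _ _ _ _ _ := congrArg Idem.val h
          rw [InvSgp.mk_of_ne hC0, InvSgp.mk_of_ne hC0'] at h2
          injection h2 with h3
          rw [← h3, List.length_cons] at hα
          omega
    · rw [← ran_coIsometry (𝒟.mem_Iw_singleton (𝒟.θ_mem_I a (A \ A₀)))]
      refine StrongGrading.covers_image_conj ?_
      rw [src_coIsometry]
      intro y hy hy0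
      obtain ⟨b, γ, C, hC, hz, hzy⟩ := hcov y (hy.trans (idem_θ_le a _)) hy0
      have hb := head_eq_of_inf_ne_bot fun h => hzy (le_bot_iff.1 ((inf_le_inf_left _ hy).trans h.le))
      subst hb
      exact ⟨_, Finset.mem_filter.2 ⟨hz, γ, C, hC, rfl⟩, hzy⟩
    · intro z' hz'
      obtain ⟨z, hz, rfl⟩ := Finset.mem_image.1 hz'
      exact ht.mul_map_conj_eq_zero (he z (Finset.mem_filter.1 hz).1)

/-- A nonzero idempotent `(α, A, α)` is the source of `(ω, A, α)`, whose range is `(ω, A, ω)`;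
conjugation by this element reduces to `mul_map_nil_eq_zero`. -/
theorem isTight : IsTight t := by
  classical
  intro x Z hZ e he
  rcases exists_eq_idem x with rfl | ⟨α, A, hA, rfl⟩
  · rw [Idem.bot_val, ht.map_zero, mul_zero]
  rw [← src_coIsometry] at hZ ⊢
  refine ht.mul_map_src_eq_zero ?_
  obtain ⟨n, hn⟩ := exists_length_bound (Z.image (conj (coIsometry α A hA)))
  have hcov := StrongGrading.covers_image_conj hZ
  rw [ran_coIsometry] at hcov ⊢
  refine ht.mul_map_nil_eq_zero n A _ hn hcov _ fun z' hz' => ?_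
  obtain ⟨z, hz, rfl⟩ := Finset.mem_image.1 hz'
  exact ht.mul_map_conj_eq_zero (he z hz)

end IsCuntzKrieger

end GenBoolDynSystem

/-! ### The relations for joins and regular elements in the skew ring. -/

namespace StrongGrading

open InverseSemigroupWithZero

variable {S G : Type*} [InverseSemigroupWithZero S] [Group G] (φ : StrongGrading S G)
variable (R : Type*) [CommRing R]

theorem mem_E_one_of_idem (x : Idem S) : x ∈ φ.E 1 := by
  by_cases h : x = ⊥
  · exact Or.inl h
  · exact Or.inr ⟨x.1, Idem.ne_bot_iff.1 h, φ.map_idem x.2 (Idem.ne_bot_iff.1 h), ran_idem x⟩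

/-- The degree is required only for `s ≠ 0`: at `0` the grading has an irrelevant value, and there
both sides are zero. -/
theorem monomial_eq_idemDelta {s : S} {g : G} {x : Idem S} (hg : s ≠ 0 → φ.toFun s = g)
    (hx : ran s = x) (h : x ∈ φ.E g) : φ.monomial R s = φ.idemDelta R g x h := by
  subst hx
  by_cases h0 : s = 0
  · subst h0
    rw [monomial_zero]
    exact ((φ.idemDelta_congr R rfl ran_zero _ (Or.inl rfl)).trans (φ.idemDelta_bot R _ _)).symm
  · exact φ.idemDelta_congr R (hg h0) rfl _ _

theorem monomial_idem (x : Idem S) :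
    φ.monomial R x.1 = φ.delta R 1 ⟨char R x, φ.indicator_mem R (φ.mem_E_one_of_idem x)⟩ :=
  φ.monomial_eq_idemDelta R (fun h => φ.map_idem x.2 h) (ran_idem x) (φ.mem_E_one_of_idem x)

theorem monomial_sup {x y z w : Idem S} (h : ∀ ξ : TightFilter (Idem S),
    z ∈ ξ.carrier ↔ x ∈ ξ.carrier ∨ y ∈ ξ.carrier) (hw : w = x ⊓ y) :
    φ.monomial R z.1 = φ.monomial R x.1 + φ.monomial R y.1 - φ.monomial R w.1 := by
  subst hw
  simp only [monomial_idem]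
  rw [← map_add, ← map_sub]
  refine congrArg _ (Subtype.ext (funext fun ξ => ?_))
  change char R z ξ = char R x ξ + char R y ξ - char R (x ⊓ y) ξ
  have h1 := h ξ
  by_cases hx : x ∈ ξ.carrier <;> by_cases hy : y ∈ ξ.carrier <;>
    simp [char, TightFilter.V, Set.indicator, TightFilter.inf_mem_iff, h1, hx, hy]

/-- The hypotheses make `V_z` the disjoint union of the sets `V_{x i}`: a filter cannot contain two
elements with meet `⊥`. -/
theorem monomial_sum {ι : Type*} (F : Finset ι) {z : Idem S} {x : ι → Idem S}
    (hle : ∀ i ∈ F, x i ≤ z) (hdisj : ∀ i ∈ F, ∀ j ∈ F, x i ⊓ x j ≠ ⊥ → i = j)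
    (hz : ∀ ξ : TightFilter (Idem S), z ∈ ξ.carrier → ∃ i ∈ F, x i ∈ ξ.carrier) :
    φ.monomial R z.1 = ∑ i ∈ F, φ.monomial R (x i).1 := by
  simp only [monomial_idem]
  rw [← map_sum]
  refine congrArg _ (Subtype.ext (funext fun ξ => ?_))
  rw [Submodule.coe_sum, Finset.sum_apply]
  change char R z ξ = ∑ i ∈ F, char R (x i) ξ
  by_cases hzξ : z ∈ ξ.carrier
  · obtain ⟨i, hi, hξ⟩ := hz ξ hzξ
    rw [Finset.sum_eq_single_of_mem i hi, char_of_mem hzξ, char_of_mem hξ]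
    intro j hj hji
    refine char_of_notMem fun hjξ => hji (hdisj j hj i hi fun h => ξ.bot_notMem ?_)
    exact h ▸ ξ.inf_mem hjξ hξ
  · rw [char_of_notMem hzξ, Finset.sum_eq_zero]
    exact fun i hi => char_of_notMem fun h => hzξ (ξ.mem_of_le h (hle i hi))

end StrongGrading

namespace GenBoolDynSystem

open InverseSemigroupWithZero

variable {B L : Type*} [GeneralizedBooleanAlgebra B] (𝒟 : GenBoolDynSystem B L)
variable (R : Type*) [CommRing R]

-- The elements for `A` and `C` cover the one for `A ⊔ C`: a nonzero `(β, D, β)` below the latter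
-- has `D ≤ θ_β(A) ⊔ θ_β(C)`, so `D` meets one of the two.
variable {𝒟} in
theorem mem_tightFilter_sup (A C : B) (ξ : TightFilter (Idem 𝒟.InvSgp)) :
    𝒟.idem [] (A ⊔ C) (𝒟.mem_Iw_nil _) ∈ ξ.carrier ↔
      𝒟.idem [] A (𝒟.mem_Iw_nil _) ∈ ξ.carrier ∨ 𝒟.idem [] C (𝒟.mem_Iw_nil _) ∈ ξ.carrier := by
  classical
  constructor
  · intro h
    obtain ⟨z, hz, hzξ⟩ := TightFilter.exists_mem_of_covers (Z := {𝒟.idem [] A (𝒟.mem_Iw_nil _),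
      𝒟.idem [] C (𝒟.mem_Iw_nil _)}) h (by
        intro y hy hy0
        rcases exists_eq_idem y with rfl | ⟨β, D, hD, rfl⟩
        · exact absurd rfl hy0
        have hle := le_θw_of_idem_le hy
        have hsup : 𝒟.θw β (A ⊔ C) = 𝒟.θw β A ⊔ 𝒟.θw β C := by
          clear * -
          induction β generalizing A C with
          | nil => rfl
          | cons b β ih => rw [θw, 𝒟.map_sup, ih]; rfl
        by_contra! hcon
        have h1 := hcon _ (Finset.mem_insert_self _ _)
        have h2 := hcon _ (Finset.mem_insert_of_mem (Finset.mem_singleton_self _))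
        rw [inf_comm, idem_inf_nil] at h1 h2
        have h1' := not_ne_iff.1 fun h => idem_ne_bot_iff.2 h h1
        have h2' := not_ne_iff.1 fun h => idem_ne_bot_iff.2 h h2
        refine idem_ne_bot_iff.1 hy0 ?_
        rw [← inf_eq_left.2 hle, hsup, inf_sup_left, h1', h2', bot_sup_eq])
    rcases Finset.mem_insert.1 hz with rfl | hz
    · exact Or.inl hzξ
    · rw [Finset.mem_singleton.1 hz] at hzξ
      exact Or.inr hzξ
  · rintro (h | h)
    · exact ξ.mem_of_le h (idem_nil_mono le_sup_left)
    · exact ξ.mem_of_le h (idem_nil_mono le_sup_right)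

-- The elements `(a, θ_a(A), a)` with `a ∈ Δ_A` cover `(ω, A, ω)`. For a nonzero `(ω, D, ω)` below
-- it, regularity gives a letter with `θ_a(D) ≠ ∅`; an element `(aβ, D, aβ)` below it already lies
-- below `(a, θ_a(A), a)`.
variable {𝒟} in
theorem exists_mem_tightFilter_of_reg {A : B} (hA : A ∈ 𝒟.Reg) (ξ : TightFilter (Idem 𝒟.InvSgp))
    (h : 𝒟.idem [] A (𝒟.mem_Iw_nil _) ∈ ξ.carrier) :
    ∃ a ∈ (𝒟.Δ_finite_of_reg hA).toFinset,
      𝒟.idem [a] (𝒟.θ a A) (𝒟.mem_Iw_singleton (𝒟.θ_mem_I a A)) ∈ ξ.carrier := by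
  classical
  obtain ⟨z, hz, hzξ⟩ := TightFilter.exists_mem_of_covers
    (Z := (𝒟.Δ_finite_of_reg hA).toFinset.image fun a =>
      𝒟.idem [a] (𝒟.θ a A) (𝒟.mem_Iw_singleton (𝒟.θ_mem_I a A))) h (by
    intro y hy hy0
    rcases exists_eq_idem y with rfl | ⟨β, D, hD, rfl⟩
    · exact absurd rfl hy0
    have hle := le_θw_of_idem_le hy
    have hD0 := idem_ne_bot_iff.1 hy0
    cases β with
    | nil =>
      obtain ⟨a, ha⟩ := (hA D hle hD0).1
      have hle' : 𝒟.θ a D ≤ 𝒟.θ a A := 𝒟.θw_mono [a] hle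
      refine ⟨_, Finset.mem_image_of_mem _ ((Set.Finite.mem_toFinset _).2
        (show a ∈ 𝒟.Δ A from fun h => ha (le_bot_iff.1 (hle'.trans h.le)))), ?_⟩
      rw [idem_inf_nil, idem_ne_bot_iff]
      rwa [show 𝒟.θ a A ⊓ 𝒟.θw [a] D = 𝒟.θ a D from inf_eq_right.2 hle']
    | cons a β =>
      refine ⟨_, Finset.mem_image_of_mem _ ((Set.Finite.mem_toFinset _).2
        (show a ∈ 𝒟.Δ A from fun h => hD0 (le_bot_iff.1 (hle.trans ?_)))), ?_⟩
      · rw [θw, h, θw_bot]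
      · rw [inf_comm]
        have h1 := idem_append_inf (𝒟 := 𝒟) (α := [a]) (γ := β)
          (𝒟.mem_Iw_singleton (𝒟.θ_mem_I a A)) hD
        refine fun h2 => hD0 ?_
        have h3 := not_ne_iff.1 fun h => idem_ne_bot_iff.2 h (h1.symm.trans h2)
        exact (inf_eq_left.2 hle).symm.trans h3)
  obtain ⟨a, ha, rfl⟩ := Finset.mem_image.1 hz
  exact ⟨a, ha, hzξ⟩

/-! ### The homomorphism from the universal algebra, and generation of the semigroup. -/

variable {𝒟} in
/-- The elements of the inverse semigroup that correspond to the generators. -/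
noncomputable def Gen.toInvSgp : 𝒟.Gen → 𝒟.InvSgp
  | .p A => InvSgp.mk [] A [] (𝒟.mem_Iw_nil _) (𝒟.mem_Iw_nil _)
  | .s a A hA => InvSgp.mk [a] A [] (𝒟.mem_Iw_singleton hA) (𝒟.mem_Iw_nil _)
  | .sStar a A hA => InvSgp.mk [] A [a] (𝒟.mem_Iw_nil _) (𝒟.mem_Iw_singleton hA)


/-- The universal property. Associativity of `X` is an explicit hypothesis because the ring
structure of the skew ring is declared without it and associativity is only known through the
spanning monomials. -/
theorem exists_lift {X : Type*} [NonUnitalNonAssocRing X] [Module R X]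
    [IsScalarTower R X X] [SMulCommClass R X X] (hX : ∀ x y z : X, x * y * z = x * (y * z))
    (f : 𝒟.Gen → X)
    (hf : ∀ F : 𝒟.FreeAlg R →ₙₐ[R] X, (∀ x, F (ι R x) = f x) → ∀ x y, 𝒟.Rel R x y → F x = F y) :
    ∃ Φ : 𝒟.LeavittAlgebra R →ₙₐ[R] X, ∀ x, Φ (LeavittAlgebra.mk 𝒟 R (ι R x)) = f x := by
  let _ : Semigroup X := { mul_assoc := hX }
  let F : 𝒟.FreeAlg R →ₙₐ[R] X := MonoidAlgebra.liftMagma R (FreeSemigroup.lift f)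
  have hF : ∀ x, F (ι R x) = f x := by
    intro x
    change MonoidAlgebra.liftMagma R (FreeSemigroup.lift f)
      (MonoidAlgebra.single (FreeSemigroup.of x) 1) = f x
    simp [MonoidAlgebra.liftMagma_apply_apply]
  have hcon : ∀ x y, 𝒟.con R x y → F x = F y := by
    intro x y h
    change RingConGen.Rel _ x y at h
    induction h with
    | of x y h =>
      obtain ⟨r, x', y', h, rfl, rfl⟩ := h
      rw [map_smul, map_smul, hf F hF _ _ h]
    | refl x => rfl
    | symm _ ih => exact ih.symm
    | trans _ _ ih1 ih2 => exact ih1.trans ih2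
    | add _ _ ih1 ih2 => rw [map_add, map_add, ih1, ih2]
    | mul _ _ ih1 ih2 => rw [map_mul, map_mul, ih1, ih2]
  refine ⟨{ toFun := Quotient.lift F hcon
            map_smul' := ?_
            map_zero' := map_zero F
            map_add' := ?_
            map_mul' := ?_ }, hF⟩
  · intro r x
    induction x using Quotient.inductionOn with | _ x => exact map_smul F r x
  · intro x y
    induction x using Quotient.inductionOn with | _ x =>
    induction y using Quotient.inductionOn with | _ y => exact map_add F x y
  · intro x y
    induction x using Quotient.inductionOn with | _ x =>
    induction y using Quotient.inductionOn with | _ y => exact map_mul F x y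

/-- The relations of the algebra hold for the elements `s s⁻¹ δ_{φ(s)}`. -/
theorem exists_hom_skewRing : ∃ Φ : 𝒟.LeavittAlgebra R →ₙₐ[R] 𝒟.grading.SkewRing R,
    ∀ x, Φ (LeavittAlgebra.mk 𝒟 R (ι R x)) = 𝒟.grading.monomial R x.toInvSgp := by
  refine 𝒟.exists_lift R (𝒟.grading.skew_mul_assoc R) _ fun F hF x y h => ?_
  cases h with
  | p_bot =>
    rw [hF, map_zero, Gen.toInvSgp, InvSgp.mk_bot, StrongGrading.monomial_zero]
  | p_inf A A' =>
    rw [map_mul, hF, hF, hF, StrongGrading.monomial_mul]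
    simp only [Gen.toInvSgp, InvSgp.mk_mul_same]
  | p_sup A A' =>
    rw [map_sub, map_add, hF, hF, hF, hF]
    exact (𝒟.grading.monomial_sup R (x := 𝒟.idem [] A (𝒟.mem_Iw_nil _))
      (y := 𝒟.idem [] A' (𝒟.mem_Iw_nil _)) (z := 𝒟.idem [] (A ⊔ A') (𝒟.mem_Iw_nil _))
      (w := 𝒟.idem [] (A ⊓ A') (𝒟.mem_Iw_nil _)) (mem_tightFilter_sup A A')
      (idem_inf_idem (𝒟.mem_Iw_nil A) (𝒟.mem_Iw_nil A')).symm)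
  | p_s A a C hC =>
    rw [map_mul, map_mul, hF, hF, hF, StrongGrading.monomial_mul, StrongGrading.monomial_mul]
    refine congrArg _ ?_
    simp only [Gen.toInvSgp, InvSgp.mk_mul_same]
    refine (InvSgp.mk_mul_left (β := []) (γ' := [a]) _ _ _ _).trans ?_
    exact InvSgp.mk_congr rfl (inf_comm _ _) rfl
  | sStar_p A a C hC =>
    rw [map_mul, map_mul, hF, hF, hF, StrongGrading.monomial_mul, StrongGrading.monomial_mul]
    refine congrArg _ ?_
    simp only [Gen.toInvSgp, InvSgp.mk_mul_same]
    refine (InvSgp.mk_mul_right (γ := []) (β' := [a]) _ _ _ _).trans ?_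
    exact InvSgp.mk_congr rfl (inf_comm _ _) rfl
  | sStar_s_same a C C' hC hC' =>
    rw [map_mul, hF, hF, hF, StrongGrading.monomial_mul]
    simp only [Gen.toInvSgp, InvSgp.mk_mul_same]
  | sStar_s_ne a a' h C C' hC hC' =>
    rw [map_mul, hF, hF, map_zero, StrongGrading.monomial_mul]
    simp only [Gen.toInvSgp]
    rw [InvSgp.mk_mul_none, StrongGrading.monomial_zero]
    · rw [List.cons_prefix_cons]; exact fun h' => h h'.1
    · rw [List.cons_prefix_cons]; exact fun h' => h h'.1.symm
  | s_p a C hC C' =>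
    rw [map_mul, hF, hF, hF, StrongGrading.monomial_mul]
    simp only [Gen.toInvSgp, InvSgp.mk_mul_same]
  | p_sStar a C hC C' =>
    rw [map_mul, hF, hF, hF, StrongGrading.monomial_mul]
    simp only [Gen.toInvSgp, InvSgp.mk_mul_same]
    exact congrArg _ (InvSgp.mk_congr rfl (inf_comm _ _) rfl)
  | p_reg A hA =>
    rw [map_sum, hF]
    refine (𝒟.grading.monomial_sum R (𝒟.Δ_finite_of_reg hA).toFinset
      (z := 𝒟.idem [] A (𝒟.mem_Iw_nil _))
      (x := fun a => 𝒟.idem [a] (𝒟.θ a A) (𝒟.mem_Iw_singleton (𝒟.θ_mem_I a A)))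
      (fun a _ => idem_θ_le a A) (fun a _ b _ h => head_eq_of_inf_ne_bot h)
      (exists_mem_tightFilter_of_reg hA)).trans (Finset.sum_congr rfl fun a _ => ?_)
    rw [map_mul, hF, hF, StrongGrading.monomial_mul]
    simp only [Gen.toInvSgp, InvSgp.mk_mul_same]
    exact congrArg _ (InvSgp.mk_congr rfl (inf_idem _).symm rfl)

variable {𝒟} in
/-- The inverse semigroup is generated by zero and the elements that correspond to generators. -/
theorem InvSgp.induction_on_gen {P : 𝒟.InvSgp → Prop} (zero : P 0)
    (gen : ∀ x : 𝒟.Gen, P x.toInvSgp) (mul : ∀ s t, P s → P t → P (s * t)) (s : 𝒟.InvSgp) :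
    P s := by
  have hl : ∀ (α : List L) (A : B) (hA : A ∈ 𝒟.Iw α),
      P (InvSgp.mk α A [] hA (𝒟.mem_Iw_nil _)) := by
    intro α
    induction α with
    | nil => exact fun A _ => gen (.p A)
    | cons a α ih =>
      rintro A ⟨C, hC, hAC⟩
      have hA' : A ∈ 𝒟.Iw α := by
        cases α with
        | nil => trivial
        | cons b α => exact ⟨𝒟.θ b C, 𝒟.θ_mem_I b C, hAC⟩
      -- The product `(a, C, ω) (α, A, ω)` has middle entry `θ_α(C) ⊓ A`, which is `A` by `hAC`.
      have h := mul _ _ (gen (.s a C hC)) (ih A hA')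
      rw [Gen.toInvSgp, show InvSgp.mk [a] C [] (𝒟.mem_Iw_singleton hC) (𝒟.mem_Iw_nil _) *
        InvSgp.mk α A [] hA' (𝒟.mem_Iw_nil _) = InvSgp.mk (a :: α) A [] _ _ from
        (InvSgp.mk_mul_left (β := []) (γ' := α) _ _ _ _).trans
          (InvSgp.mk_congr rfl (inf_eq_right.2 hAC) rfl)] at h
      exact h
  have hr : ∀ (α : List L) (A : B) (hA : A ∈ 𝒟.Iw α),
      P (InvSgp.mk [] A α (𝒟.mem_Iw_nil _) hA) := by
    intro α
    induction α with
    | nil => exact fun A _ => gen (.p A)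
    | cons a α ih =>
      rintro A ⟨C, hC, hAC⟩
      have hA' : A ∈ 𝒟.Iw α := by
        cases α with
        | nil => trivial
        | cons b α => exact ⟨𝒟.θ b C, 𝒟.θ_mem_I b C, hAC⟩
      have h := mul _ _ (ih A hA') (gen (.sStar a C hC))
      rw [Gen.toInvSgp, show InvSgp.mk [] A α (𝒟.mem_Iw_nil _) hA' *
        InvSgp.mk [] C [a] (𝒟.mem_Iw_nil _) (𝒟.mem_Iw_singleton hC) = InvSgp.mk [] A (a :: α) _ _ from
        (InvSgp.mk_mul_right (γ := []) (β' := α) _ _ _ _).trans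
          (InvSgp.mk_congr rfl (inf_eq_left.2 hAC) rfl)] at h
      exact h
  rcases InvSgp.exists_mk s with rfl | ⟨α, A, β, hα, hβ, rfl⟩
  · exact zero
  -- A general triple factors as `(α, A, β) = (α, A, ω) (ω, A, β)`.
  · have h := mul _ _ (hl α A hα) (hr β A hβ)
    rw [InvSgp.mk_mul_same] at h
    rwa [InvSgp.mk_congr rfl (inf_idem A) rfl] at h

end GenBoolDynSystem

/-! ### The representation of the inverse semigroup in the universal algebra. -/

namespace GenBoolDynSystem

open InverseSemigroupWithZero

variable {B L : Type*} [GeneralizedBooleanAlgebra B] (𝒟 : GenBoolDynSystem B L)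
variable (R : Type*) [CommRing R]

namespace LeavittAlgebra

variable {R} in
theorem mk_eq_of_rel {x y : 𝒟.FreeAlg R} (h : 𝒟.Rel R x y) : mk 𝒟 R x = mk 𝒟 R y :=
  Quotient.sound (RingConGen.Rel.of _ _ ⟨1, x, y, h, (one_smul R x).symm, (one_smul R y).symm⟩)

/-- The quotient map from the free algebra, as a linear map. -/
noncomputable def mkₗ : 𝒟.FreeAlg R →ₗ[R] 𝒟.LeavittAlgebra R where
  toFun := mk 𝒟 R
  map_add' _ _ := rfl
  map_smul' _ _ := rfl

theorem p_bot : 𝒟.p R ⊥ = 0 := mk_eq_of_rel 𝒟 .p_bot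

theorem p_mul_p (A C : B) : 𝒟.p R A * 𝒟.p R C = 𝒟.p R (A ⊓ C) :=
  (mk_eq_of_rel 𝒟 (.p_inf A C)).symm

theorem p_sup (A C : B) : 𝒟.p R (A ⊔ C) = 𝒟.p R A + 𝒟.p R C - 𝒟.p R (A ⊓ C) :=
  (mk_eq_of_rel 𝒟 (.p_sup A C)).trans (map_sub (mkₗ 𝒟 R) _ _)

theorem p_mul_s (A : B) (a : L) (C : B) (hC : C ∈ 𝒟.I a) :
    𝒟.p R A * 𝒟.s R a C hC = 𝒟.s R a C hC * 𝒟.p R (𝒟.θ a A) :=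
  mk_eq_of_rel 𝒟 (.p_s A a C hC)

theorem sStar_mul_p (A : B) (a : L) (C : B) (hC : C ∈ 𝒟.I a) :
    𝒟.sStar R a C hC * 𝒟.p R A = 𝒟.p R (𝒟.θ a A) * 𝒟.sStar R a C hC :=
  mk_eq_of_rel 𝒟 (.sStar_p A a C hC)

theorem sStar_mul_s (a : L) (C C' : B) (hC : C ∈ 𝒟.I a) (hC' : C' ∈ 𝒟.I a) :
    𝒟.sStar R a C hC * 𝒟.s R a C' hC' = 𝒟.p R (C ⊓ C') :=
  mk_eq_of_rel 𝒟 (.sStar_s_same a C C' hC hC')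

theorem sStar_mul_s_of_ne {a a' : L} (h : a ≠ a') (C C' : B) (hC : C ∈ 𝒟.I a) (hC' : C' ∈ 𝒟.I a') :
    𝒟.sStar R a C hC * 𝒟.s R a' C' hC' = 0 :=
  mk_eq_of_rel 𝒟 (.sStar_s_ne a a' h C C' hC hC')

theorem s_mul_p (a : L) (C : B) (hC : C ∈ 𝒟.I a) (A : B) :
    𝒟.s R a C hC * 𝒟.p R A = 𝒟.s R a (C ⊓ A) (𝒟.inf_mem_I hC A) :=
  mk_eq_of_rel 𝒟 (.s_p a C hC A)

theorem p_mul_sStar (a : L) (C : B) (hC : C ∈ 𝒟.I a) (A : B) :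
    𝒟.p R A * 𝒟.sStar R a C hC = 𝒟.sStar R a (C ⊓ A) (𝒟.inf_mem_I hC A) :=
  mk_eq_of_rel 𝒟 (.p_sStar a C hC A)

theorem p_reg (A : B) (hA : A ∈ 𝒟.Reg) :
    𝒟.p R A = ∑ a ∈ (𝒟.Δ_finite_of_reg hA).toFinset,
      𝒟.s R a (𝒟.θ a A) (𝒟.θ_mem_I a A) * 𝒟.sStar R a (𝒟.θ a A) (𝒟.θ_mem_I a A) :=
  (mk_eq_of_rel 𝒟 (.p_reg A hA)).trans (map_sum (mkₗ 𝒟 R) _ _)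

theorem s_congr {a : L} {C C' : B} (h : C = C') (hC : C ∈ 𝒟.I a) (hC' : C' ∈ 𝒟.I a) :
    𝒟.s R a C hC = 𝒟.s R a C' hC' := by subst h; rfl

theorem sStar_congr {a : L} {C C' : B} (h : C = C') (hC : C ∈ 𝒟.I a) (hC' : C' ∈ 𝒟.I a) :
    𝒟.sStar R a C hC = 𝒟.sStar R a C' hC' := by subst h; rfl

variable {𝒟} in
theorem mem_Iw_of_cons {α : List L} {C A : B} (h : A ≤ 𝒟.θw α C) : A ∈ 𝒟.Iw α := by
  cases α with
  | nil => trivial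
  | cons b α => exact ⟨𝒟.θ b C, 𝒟.θ_mem_I b C, h⟩

open Classical in
/-- The element `s_{α,A}` for a word `α` and `A ∈ 𝓘_α`: it is `p_A` for the empty word, and
`s_{aα,A} = s_{a,C} s_{α,A}` for any `C ∈ 𝓘_a` with `A ≤ θ_α(C)`. -/
noncomputable def sw : List L → B → 𝒟.LeavittAlgebra R
  | [], A => 𝒟.p R A
  | a :: α, A => if h : ∃ C ∈ 𝒟.I a, A ≤ 𝒟.θw α C then 𝒟.s R a h.choose h.choose_spec.1 * sw α A
      else 0

open Classical in
/-- The element `s*_{α,A}` for a word `α` and `A ∈ 𝓘_α`. -/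
noncomputable def swStar : List L → B → 𝒟.LeavittAlgebra R
  | [], A => 𝒟.p R A
  | a :: α, A => if h : ∃ C ∈ 𝒟.I a, A ≤ 𝒟.θw α C then
      swStar α A * 𝒟.sStar R a h.choose h.choose_spec.1 else 0

variable {𝒟}

theorem sw_nil (A : B) : sw 𝒟 R [] A = 𝒟.p R A := rfl

theorem swStar_nil (A : B) : swStar 𝒟 R [] A = 𝒟.p R A := rfl

/-- The choice of `C` is immaterial: `s_{a,C ⊓ D} = s_{a,C} p_D`, and `p_D` fixes `s_{α,A}` if `A ≤
θ_α(D)`, so two admissible choices both agree with their meet. The commutation rule for the tail `α`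
is a hypothesis because its own induction, in `p_mul_sw`, uses this lemma. -/
theorem sw_cons_aux {α : List L} (hα : ∀ A ∈ 𝒟.Iw α, ∀ C : B,
    𝒟.p R C * sw 𝒟 R α A = sw 𝒟 R α (𝒟.θw α C ⊓ A)) {a : L} {A C : B} (hC : C ∈ 𝒟.I a)
    (hAC : A ≤ 𝒟.θw α C) : sw 𝒟 R (a :: α) A = 𝒟.s R a C hC * sw 𝒟 R α A := by
  have key : ∀ C D (hC : C ∈ 𝒟.I a), A ≤ 𝒟.θw α D →
      𝒟.s R a C hC * sw 𝒟 R α A = 𝒟.s R a (C ⊓ D) (𝒟.inf_mem_I hC D) * sw 𝒟 R α A := by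
    intro C D hC hD
    rw [← s_mul_p, mul_assoc, hα _ (mem_Iw_of_cons hD), inf_eq_right.2 hD]
  have h : ∃ C ∈ 𝒟.I a, A ≤ 𝒟.θw α C := ⟨C, hC, hAC⟩
  refine (dif_pos h).trans ?_
  rw [key _ C _ hAC, key C _ hC h.choose_spec.2]
  exact congrArg (· * _) (s_congr _ _ (inf_comm _ _) _ _)

theorem swStar_cons_aux {α : List L} (hα : ∀ A ∈ 𝒟.Iw α, ∀ C : B,
    swStar 𝒟 R α A * 𝒟.p R C = swStar 𝒟 R α (𝒟.θw α C ⊓ A)) {a : L} {A C : B} (hC : C ∈ 𝒟.I a)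
    (hAC : A ≤ 𝒟.θw α C) : swStar 𝒟 R (a :: α) A = swStar 𝒟 R α A * 𝒟.sStar R a C hC := by
  have key : ∀ C D (hC : C ∈ 𝒟.I a), A ≤ 𝒟.θw α D →
      swStar 𝒟 R α A * 𝒟.sStar R a C hC =
        swStar 𝒟 R α A * 𝒟.sStar R a (C ⊓ D) (𝒟.inf_mem_I hC D) := by
    intro C D hC hD
    rw [← p_mul_sStar, ← mul_assoc, hα _ (mem_Iw_of_cons hD), inf_eq_right.2 hD]
  have h : ∃ C ∈ 𝒟.I a, A ≤ 𝒟.θw α C := ⟨C, hC, hAC⟩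
  refine (dif_pos h).trans ?_
  rw [key _ C _ hAC, key C _ hC h.choose_spec.2]
  exact congrArg (_ * ·) (sStar_congr _ _ (inf_comm _ _) _ _)

theorem p_mul_sw (α : List L) (A : B) (hA : A ∈ 𝒟.Iw α) (C : B) :
    𝒟.p R C * sw 𝒟 R α A = sw 𝒟 R α (𝒟.θw α C ⊓ A) := by
  induction α generalizing A C with
  | nil => exact p_mul_p _ _ _ _
  | cons a α ih =>
    obtain ⟨D, hD, hAD⟩ := hA
    rw [sw_cons_aux R ih hD hAD, ← mul_assoc, p_mul_s, mul_assoc, ih _ (mem_Iw_of_cons hAD),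
      sw_cons_aux R ih hD (inf_le_right.trans hAD)]
    rfl

theorem swStar_mul_p (α : List L) (A : B) (hA : A ∈ 𝒟.Iw α) (C : B) :
    swStar 𝒟 R α A * 𝒟.p R C = swStar 𝒟 R α (𝒟.θw α C ⊓ A) := by
  induction α generalizing A C with
  | nil => exact (p_mul_p _ _ _ _).trans (congrArg _ (inf_comm _ _))
  | cons a α ih =>
    obtain ⟨D, hD, hAD⟩ := hA
    rw [swStar_cons_aux R ih hD hAD, mul_assoc, sStar_mul_p, ← mul_assoc,
      ih _ (mem_Iw_of_cons hAD), swStar_cons_aux R ih hD (inf_le_right.trans hAD)]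
    rfl

theorem sw_cons {α : List L} {a : L} {A C : B} (hC : C ∈ 𝒟.I a) (hAC : A ≤ 𝒟.θw α C) :
    sw 𝒟 R (a :: α) A = 𝒟.s R a C hC * sw 𝒟 R α A := sw_cons_aux R (p_mul_sw R α) hC hAC

theorem swStar_cons {α : List L} {a : L} {A C : B} (hC : C ∈ 𝒟.I a) (hAC : A ≤ 𝒟.θw α C) :
    swStar 𝒟 R (a :: α) A = swStar 𝒟 R α A * 𝒟.sStar R a C hC :=
  swStar_cons_aux R (swStar_mul_p R α) hC hAC

theorem sw_mul_p (α : List L) (A : B) (hA : A ∈ 𝒟.Iw α) (C : B) :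
    sw 𝒟 R α A * 𝒟.p R C = sw 𝒟 R α (A ⊓ C) := by
  induction α generalizing A C with
  | nil => exact p_mul_p _ _ _ _
  | cons a α ih =>
    obtain ⟨D, hD, hAD⟩ := hA
    rw [sw_cons R hD hAD, mul_assoc, ih _ (mem_Iw_of_cons hAD),
      sw_cons R hD (inf_le_left.trans hAD)]

theorem p_mul_swStar (α : List L) (A : B) (hA : A ∈ 𝒟.Iw α) (C : B) :
    𝒟.p R C * swStar 𝒟 R α A = swStar 𝒟 R α (A ⊓ C) := by
  induction α generalizing A C with
  | nil => exact (p_mul_p _ _ _ _).trans (congrArg _ (inf_comm _ _))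
  | cons a α ih =>
    obtain ⟨D, hD, hAD⟩ := hA
    rw [swStar_cons R hD hAD, ← mul_assoc, ih _ (mem_Iw_of_cons hAD),
      swStar_cons R hD (inf_le_left.trans hAD)]

theorem sw_bot (α : List L) : sw 𝒟 R α ⊥ = 0 := by
  cases α with
  | nil => exact p_bot _ _
  | cons a α =>
    have hb : (⊥ : B) ∈ 𝒟.Iw (a :: α) := ⟨𝒟.θ a ⊥, 𝒟.θ_mem_I a _, bot_le⟩
    have h := sw_mul_p R (a :: α) ⊥ hb ⊥
    rw [p_bot, mul_zero, inf_idem] at h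
    exact h.symm

/-- Common letters cancel one at a time through `s*_{a,D} s_{a,D'} = p_{D ⊓ D'}`. The projection
that appears is absorbed because `A ≤ θ_α(D)` and `C ≤ θ_{αγ}(D')`; this is `h1`. -/
theorem swStar_mul_sw_append (α γ : List L) (A C : B) (hA : A ∈ 𝒟.Iw α)
    (hC : C ∈ 𝒟.Iw (α ++ γ)) :
    swStar 𝒟 R α A * sw 𝒟 R (α ++ γ) C = sw 𝒟 R γ (𝒟.θw γ A ⊓ C) := by
  induction α generalizing A C with
  | nil => exact p_mul_sw R γ C hC A
  | cons a α ih =>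
    obtain ⟨D, hD, hAD⟩ := hA
    obtain ⟨D', hD', hCD⟩ := hC
    change C ≤ 𝒟.θw (α ++ γ) D' at hCD
    have hC' : C ∈ 𝒟.Iw (α ++ γ) := mem_Iw_of_cons hCD
    have h1 : 𝒟.θw γ A ⊓ (𝒟.θw (α ++ γ) (D ⊓ D') ⊓ C) = 𝒟.θw γ A ⊓ C := by
      rw [θw_inf, inf_assoc, inf_eq_right.2 hCD, θw_append, ← inf_assoc,
        inf_eq_left.2 (𝒟.θw_mono γ hAD)]
    rw [swStar_cons R hD hAD, List.cons_append, sw_cons R hD' hCD, mul_assoc,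
      ← mul_assoc (𝒟.sStar R a D hD), sStar_mul_s, p_mul_sw R _ _ hC',
      ih _ _ (mem_Iw_of_cons hAD) (InvSgp.inf_mem_right hC' _), h1]

theorem swStar_append_mul_sw (α γ : List L) (A C : B) (hA : A ∈ 𝒟.Iw (α ++ γ))
    (hC : C ∈ 𝒟.Iw α) :
    swStar 𝒟 R (α ++ γ) A * sw 𝒟 R α C = swStar 𝒟 R γ (A ⊓ 𝒟.θw γ C) := by
  induction α generalizing A C with
  | nil => exact (swStar_mul_p R γ A hA C).trans (congrArg _ (inf_comm _ _))
  | cons a α ih =>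
    obtain ⟨D, hD, hAD⟩ := hA
    obtain ⟨D', hD', hCD⟩ := hC
    change A ≤ 𝒟.θw (α ++ γ) D at hAD
    have hA' : A ∈ 𝒟.Iw (α ++ γ) := mem_Iw_of_cons hAD
    have h1 : 𝒟.θw (α ++ γ) (D ⊓ D') ⊓ A ⊓ 𝒟.θw γ C = A ⊓ 𝒟.θw γ C := by
      rw [inf_comm D, θw_inf, inf_assoc (𝒟.θw (α ++ γ) D'), inf_eq_right.2 hAD, θw_append,
        inf_assoc, inf_comm (𝒟.θw γ (𝒟.θw α D')), inf_assoc, inf_eq_left.2 (𝒟.θw_mono γ hCD)]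
    rw [List.cons_append, swStar_cons R hD hAD, sw_cons R hD' hCD, mul_assoc,
      ← mul_assoc (𝒟.sStar R a D hD), sStar_mul_s, ← mul_assoc, swStar_mul_p R _ _ hA',
      ih _ _ (InvSgp.inf_mem_right hA' _) (mem_Iw_of_cons hCD), h1]

/-- Incomparable words differ at some first position. The letters before it cancel, and the product
of the two distinct letters there is zero. -/
theorem swStar_mul_sw_none (α γ : List L) (A C : B) (hA : A ∈ 𝒟.Iw α) (hC : C ∈ 𝒟.Iw γ)
    (h1 : ¬ α <+: γ) (h2 : ¬ γ <+: α) : swStar 𝒟 R α A * sw 𝒟 R γ C = 0 := by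
  induction α generalizing γ A C with
  | nil => exact absurd List.nil_prefix h1
  | cons a α ih =>
    cases γ with
    | nil => exact absurd List.nil_prefix h2
    | cons b γ =>
      obtain ⟨D, hD, hAD⟩ := hA
      obtain ⟨D', hD', hCD⟩ := hC
      rw [swStar_cons R hD hAD, sw_cons R hD' hCD, mul_assoc, ← mul_assoc (𝒟.sStar R a D hD)]
      by_cases hab : a = b
      · subst hab
        rw [List.cons_prefix_cons] at h1 h2
        rw [sStar_mul_s, p_mul_sw R _ _ (mem_Iw_of_cons hCD)]
        exact ih _ _ _ (mem_Iw_of_cons hAD) (InvSgp.inf_mem_right (mem_Iw_of_cons hCD) _)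
          (fun h => h1 ⟨rfl, h⟩) fun h => h2 ⟨rfl, h⟩
      · rw [sStar_mul_s_of_ne _ _ hab, zero_mul, mul_zero]

theorem sw_append (α γ : List L) (A C : B) (hA : A ∈ 𝒟.Iw α) (hC : C ≤ 𝒟.θw γ A) :
    sw 𝒟 R α A * sw 𝒟 R γ C = sw 𝒟 R (α ++ γ) C := by
  induction α generalizing A C with
  | nil =>
    have hC' : C ∈ 𝒟.Iw γ := 𝒟.Iw_mono hC (𝒟.Iw_append (α := []) trivial γ)
    rw [sw_nil, p_mul_sw R _ _ hC', inf_eq_right.2 hC]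
    rfl
  | cons a α ih =>
    obtain ⟨D, hD, hAD⟩ := hA
    rw [sw_cons R hD hAD, mul_assoc, ih _ _ (mem_Iw_of_cons hAD) hC, List.cons_append, sw_cons R hD]
    rw [θw_append]
    exact hC.trans (𝒟.θw_mono γ hAD)

theorem swStar_append (α γ : List L) (A C : B) (hA : A ∈ 𝒟.Iw α) (hC : C ≤ 𝒟.θw γ A) :
    swStar 𝒟 R γ C * swStar 𝒟 R α A = swStar 𝒟 R (α ++ γ) C := by
  induction α generalizing A C with
  | nil =>
    have hC' : C ∈ 𝒟.Iw γ := 𝒟.Iw_mono hC (𝒟.Iw_append (α := []) trivial γ)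
    rw [swStar_nil, swStar_mul_p R _ _ hC', inf_eq_right.2 hC]
    rfl
  | cons a α ih =>
    obtain ⟨D, hD, hAD⟩ := hA
    rw [swStar_cons R hD hAD, ← mul_assoc, ih _ _ (mem_Iw_of_cons hAD) hC, List.cons_append,
      swStar_cons R hD]
    rw [θw_append]
    exact hC.trans (𝒟.θw_mono γ hAD)

/-- The element `s_{α,A} s*_{β,A}` for a triple `(α, A, β)`. -/
noncomputable def rep : 𝒟.InvSgp → 𝒟.LeavittAlgebra R
  | .zero => 0
  | .triple α A β _ _ _ => sw 𝒟 R α A * swStar 𝒟 R β A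

theorem rep_zero : rep R (0 : 𝒟.InvSgp) = 0 := rfl

theorem rep_mk {α β : List L} {A : B} (hα : A ∈ 𝒟.Iw α) (hβ : A ∈ 𝒟.Iw β) :
    rep R (InvSgp.mk α A β hα hβ) = sw 𝒟 R α A * swStar 𝒟 R β A := by
  by_cases h : A = ⊥
  · subst h
    rw [InvSgp.mk_bot, rep_zero, sw_bot, zero_mul]
  · rw [InvSgp.mk_of_ne h]
    rfl

/-- The inner product `s*_{β,A} s_{γ,C}` falls into the three cases of the multiplication of
triples. The leftover word is appended on the left or on the right, and projections carry the
reduced middle entry to the other factor. -/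
theorem rep_mul (x y : 𝒟.InvSgp) : rep R (x * y) = rep R x * rep R y := by
  rcases InvSgp.exists_mk x with rfl | ⟨α, A, β, hα, hβ, rfl⟩
  · rw [zero_mul, rep_zero, zero_mul]
  rcases InvSgp.exists_mk y with rfl | ⟨γ, C, δ, hγ, hδ, rfl⟩
  · rw [mul_zero, rep_zero, mul_zero]
  have h0 : ∀ u v w z : 𝒟.LeavittAlgebra R, u * v * (w * z) = u * (v * w) * z := by
    intro u v w z; simp only [mul_assoc]
  rw [rep_mk R hα hβ, rep_mk R hγ hδ, h0]
  rcases InvSgp.prefix_cases β γ with ⟨γ', rfl⟩ | ⟨β', rfl⟩ | ⟨h1, h2⟩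
  · have hC' : 𝒟.θw γ' A ⊓ C ∈ 𝒟.Iw (α ++ γ') := InvSgp.inf_mem_left (𝒟.Iw_append hα _) _
    rw [InvSgp.mk_mul_left, rep_mk, swStar_mul_sw_append R _ _ _ _ hβ hγ,
      sw_append R _ _ _ _ hα inf_le_left, inf_comm (𝒟.θw γ' A), ← p_mul_swStar R _ _ hδ,
      inf_comm C, ← mul_assoc]
    refine congrArg (· * _) ?_
    rw [sw_mul_p R _ _ hC', inf_assoc, inf_comm C, ← inf_assoc, inf_idem]
  · have hA' : A ⊓ 𝒟.θw β' C ∈ 𝒟.Iw (δ ++ β') := InvSgp.inf_mem_right (𝒟.Iw_append hδ _) _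
    have h3 : 𝒟.p R (A ⊓ 𝒟.θw β' C) * swStar 𝒟 R (δ ++ β') (A ⊓ 𝒟.θw β' C) =
        swStar 𝒟 R (δ ++ β') (A ⊓ 𝒟.θw β' C) := by
      rw [p_mul_swStar R _ _ hA', inf_idem]
    rw [InvSgp.mk_mul_right, rep_mk, swStar_append_mul_sw R _ _ _ _ hβ hγ, mul_assoc,
      swStar_append R _ _ _ _ hδ inf_le_right, ← h3, ← mul_assoc, ← mul_assoc,
      sw_mul_p R _ _ hα, sw_mul_p R _ _ (InvSgp.inf_mem_left hα _), inf_idem,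
      ← inf_assoc A A, inf_idem]
  · rw [InvSgp.mk_mul_none _ _ _ _ h1 h2, rep_zero, swStar_mul_sw_none R _ _ _ _ hβ hγ h1 h2,
      mul_zero, zero_mul]

theorem rep_toInvSgp (x : 𝒟.Gen) : rep R x.toInvSgp = mk 𝒟 R (ι R x) := by
  cases x with
  | p A =>
    rw [Gen.toInvSgp, rep_mk]
    exact (p_mul_p _ _ _ _).trans (congrArg _ (inf_idem A))
  | s a A hA =>
    rw [Gen.toInvSgp, rep_mk, sw_cons (α := []) (A := A) R hA le_rfl, sw_nil, swStar_nil, s_mul_p, s_mul_p]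
    exact s_congr _ _ (by rw [inf_idem, inf_idem]) _ _
  | sStar a A hA =>
    rw [Gen.toInvSgp, rep_mk, swStar_cons (α := []) (A := A) R hA le_rfl, sw_nil, swStar_nil, p_mul_sStar, p_mul_sStar]
    exact sStar_congr _ _ (by rw [inf_idem, inf_idem]) _ _

/-- The free algebra is spanned by products of generators, and each such product is sent to a value
of `rep` by multiplicativity. -/
theorem span_rep : Submodule.span R (Set.range (rep (𝒟 := 𝒟) R)) = ⊤ := by
  rw [eq_top_iff]
  intro x _
  induction x using Quotient.inductionOn with | _ x =>
  have hw : ∀ w : FreeSemigroup 𝒟.Gen,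
      ∃ s, rep R s = mk 𝒟 R (MonoidAlgebra.single w 1) := by
    intro w
    induction w using FreeSemigroup.recOnMul with
    | ih1 x => exact ⟨_, rep_toInvSgp R x⟩
    | ih2 x y hx hy =>
      obtain ⟨s, hs⟩ := hx
      obtain ⟨t, ht⟩ := hy
      refine ⟨s * t, ?_⟩
      rw [rep_mul, hs, ht]
      have h : (MonoidAlgebra.single (FreeSemigroup.of x * y) 1 : 𝒟.FreeAlg R) =
          MonoidAlgebra.single (FreeSemigroup.of x) 1 * MonoidAlgebra.single y 1 := by
        rw [MonoidAlgebra.single_mul_single, one_mul]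
      rw [h]
      rfl
  have hx : ∀ x, mkₗ 𝒟 R x ∈ Submodule.span R (Set.range (rep (𝒟 := 𝒟) R)) := by
    intro x
    induction x using MonoidAlgebra.induction_linear with
    | zero => rw [map_zero]; exact zero_mem _
    | add x y hx hy => rw [map_add]; exact add_mem hx hy
    | single w r =>
      have h : (MonoidAlgebra.single w r : 𝒟.FreeAlg R) = r • MonoidAlgebra.single w 1 := by
        simp
      rw [h, map_smul]
      exact Submodule.smul_mem _ r (Submodule.subset_span (hw w))
  exact hx x

/-- The representation of the inverse semigroup in the unitization of the algebra. -/
noncomputable def repUnit (s : 𝒟.InvSgp) : Unitization R (𝒟.LeavittAlgebra R) :=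
  Unitization.inr (rep R s)

/-- The transfer of relations needs a unital target, which the universal algebra need not be; it
embeds in its unitization, so no relation is lost there. -/
theorem isCuntzKrieger_repUnit : IsCuntzKrieger (repUnit (𝒟 := 𝒟) R) where
  map_mul x y := by rw [repUnit, rep_mul, Unitization.inr_mul]; rfl
  map_zero := Unitization.inr_zero R
  map_sup A C := by
    have h : ∀ A : B, rep R (𝒟.idem [] A (𝒟.mem_Iw_nil _)).1 = 𝒟.p R A :=
      fun A => rep_toInvSgp R (.p A)
    simp only [repUnit, h]
    rw [← Unitization.inr_add, ← Unitization.inr_sub, ← p_sup]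
  map_reg A hA := by
    have h : rep R (𝒟.idem [] A (𝒟.mem_Iw_nil _)).1 = 𝒟.p R A := rep_toInvSgp R (.p A)
    simp only [repUnit]
    rw [h, p_reg 𝒟 R A hA]
    refine (map_sum (Unitization.inrNonUnitalAlgHom R (𝒟.LeavittAlgebra R)) _ _).trans
      (Finset.sum_congr rfl fun a _ => congrArg Unitization.inr ?_)
    refine (congrArg₂ (· * ·) (rep_toInvSgp R (.s a _ _)) (rep_toInvSgp R (.sStar a _ _))).symm.trans ?_
    rw [← rep_mul]
    simp only [Gen.toInvSgp, InvSgp.mk_mul_same]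
    exact congrArg _ (InvSgp.mk_congr rfl (inf_idem _) rfl)

end LeavittAlgebra

end GenBoolDynSystem

/-! ### Bijectivity and the isomorphism. -/

namespace GenBoolDynSystem

open InverseSemigroupWithZero

variable {B L : Type*} [GeneralizedBooleanAlgebra B] (𝒟 : GenBoolDynSystem B L)
variable (R : Type*) [CommRing R] (Φ : 𝒟.LeavittAlgebra R →ₙₐ[R] 𝒟.grading.SkewRing R)
  (hΦ : ∀ x, Φ (LeavittAlgebra.mk 𝒟 R (ι R x)) = 𝒟.grading.monomial R x.toInvSgp)
include hΦ

/-- Both sides are multiplicative in `s`, vanish at `0` and agree on generators, and these generate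
the semigroup. -/
theorem apply_rep (s : 𝒟.InvSgp) : Φ (LeavittAlgebra.rep R s) = 𝒟.grading.monomial R s := by
  induction s using InvSgp.induction_on_gen with
  | zero => rw [LeavittAlgebra.rep_zero, map_zero, StrongGrading.monomial_zero]
  | gen x => rw [LeavittAlgebra.rep_toInvSgp, hΦ]
  | mul s t hs ht => rw [LeavittAlgebra.rep_mul, map_mul, hs, ht, StrongGrading.monomial_mul]

theorem surjective_of_apply_gen :
    Function.Surjective Φ := by
  intro y
  have hy : y ∈ Submodule.span R (Set.range (𝒟.grading.monomial R)) :=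
    𝒟.grading.span_monomial R ▸ Submodule.mem_top
  induction hy using Submodule.span_induction with
  | mem y hy =>
    obtain ⟨s, rfl⟩ := hy
    exact ⟨_, 𝒟.apply_rep R Φ hΦ s⟩
  | zero => exact ⟨0, map_zero Φ⟩
  | add y z _ _ hy hz =>
    obtain ⟨a, rfl⟩ := hy
    obtain ⟨b, rfl⟩ := hz
    exact ⟨a + b, map_add Φ a b⟩
  | smul r y _ hy =>
    obtain ⟨a, rfl⟩ := hy
    exact ⟨r • a, map_smul Φ r a⟩

/-- An element of the kernel is a combination of values of `rep`. Its image is the same combination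
of monomials, and since `repUnit` is tight, the vanishing of the latter carries back. -/
theorem injective_of_apply_gen : Function.Injective Φ := by
  rw [injective_iff_map_eq_zero]
  intro y hy
  have hspan : y ∈ Submodule.span R (Set.range (LeavittAlgebra.rep (𝒟 := 𝒟) R)) :=
    LeavittAlgebra.span_rep (𝒟 := 𝒟) R ▸ Submodule.mem_top
  obtain ⟨c, rfl⟩ := Finsupp.mem_span_range_iff_exists_finsupp.1 hspan
  have h1 : Finsupp.linearCombination R (𝒟.grading.monomial R) c = 0 := by
    rw [Finsupp.linearCombination_apply, ← hy, Finsupp.sum, Finsupp.sum, map_sum]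
    exact Finset.sum_congr rfl fun s _ => by rw [map_smul, 𝒟.apply_rep R Φ hΦ]
  have hck := LeavittAlgebra.isCuntzKrieger_repUnit (𝒟 := 𝒟) R
  have h2 := 𝒟.grading.sum_eq_zero_of_sum_monomial_eq_zero hck.map_mul hck.isTight c h1
  rw [Finsupp.linearCombination_apply] at h2
  refine Unitization.inr_injective (R := R) (Eq.trans ?_ (h2.trans (Unitization.inr_zero R).symm))
  rw [Finsupp.sum, Finsupp.sum]
  refine (map_sum (Unitization.inrNonUnitalAlgHom R (𝒟.LeavittAlgebra R)) _ _).trans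
    (Finset.sum_congr rfl fun s _ => ?_)
  exact Unitization.inr_smul R (c s) _

end GenBoolDynSystem

theorem mainTheorem4 {B L : Type*} [GeneralizedBooleanAlgebra B] (𝒟 : GenBoolDynSystem B L)
    (R : Type*) [CommRing R] :
    ∃ Φ : 𝒟.LeavittAlgebra R →ₙₐ[R] 𝒟.grading.SkewRing R,
      Function.Bijective Φ ∧
      (∀ A : B, Φ (𝒟.p R A) =
        𝒟.grading.idemDelta R 1 (𝒟.idem [] A trivial) (𝒟.mem_E_one A)) ∧
      (∀ (a : L) (A : B) (hA : A ∈ 𝒟.I a), Φ (𝒟.s R a A hA) =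
        𝒟.grading.idemDelta R (FreeGroup.of a)
          (𝒟.idem [a] A (𝒟.mem_Iw_singleton hA)) (𝒟.mem_E_of hA)) ∧
      (∀ (a : L) (A : B) (hA : A ∈ 𝒟.I a), Φ (𝒟.sStar R a A hA) =
        𝒟.grading.idemDelta R (FreeGroup.of a)⁻¹
          (𝒟.idem [] A trivial) (𝒟.mem_E_of_inv hA)) := by
  obtain ⟨Φ, hΦ⟩ := 𝒟.exists_hom_skewRing R
  refine ⟨Φ, ⟨𝒟.injective_of_apply_gen R Φ hΦ, 𝒟.surjective_of_apply_gen R Φ hΦ⟩, fun A => ?_,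
    fun a A hA => ?_, fun a A hA => ?_⟩
  · refine (hΦ (.p A)).trans (𝒟.grading.monomial_eq_idemDelta R (fun h => ?_) ?_ _)
    · exact (𝒟.degree_mk h).trans (mul_inv_cancel _)
    · exact GenBoolDynSystem.ran_coIsometry (𝒟.mem_Iw_nil A)
  · refine (hΦ (.s a A hA)).trans (𝒟.grading.monomial_eq_idemDelta R (fun h => ?_) ?_ _)
    · exact (𝒟.degree_mk h).trans (by simp [GenBoolDynSystem.word])
    -- `(a, A, ω)` is the inverse of `(ω, A, a)`, so its range is the source of the latter.
    · rw [← GenBoolDynSystem.src_coIsometry, ← StrongGrading.ran_inv,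
        GenBoolDynSystem.coIsometry, GenBoolDynSystem.InvSgp.inv_mk]
      rfl
  · refine (hΦ (.sStar a A hA)).trans (𝒟.grading.monomial_eq_idemDelta R (fun h => ?_) ?_ _)
    · exact (𝒟.degree_mk h).trans (by simp [GenBoolDynSystem.word])
    · exact GenBoolDynSystem.ran_coIsometry (𝒟.mem_Iw_singleton hA)
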